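/- Let $p$ be a prime, $k$ an algebraically closed field of characteristic $p$, and $G$ a nontrivial finite group. **Characters.** $R^+(G)$ is the set of characters of finite-dimensional complex representations of $G$; $\langle\psi,\chi\rangle=|G|^{-1}\sum_{\sigma}\overline{\psi(\sigma)}\chi(\sigma)$; $R^+(G,\mathbb{Q})$ is the set of $\mathbb{Q}$-linear combinations $\chi$ of characters with $\langle\psi,\chi\rangle\in\mathbb{Q}_{\ge 0}$ for all $\psi\in R^+(G)$. Let $r_G$ be the regular character, $u_G=r_G-1_G$, and for $H\le G$ let $\chi^*$ be the class function on $G$ induced from a class function $\chi$ on $H$. For a cyclic group $C=\langle\sigma\rangle$ of order $p^m$ let $\delta_C^{\rm mult}(\sigma^a)=-p^{i+1}/(p-1)$ with $i={\rm ord}_p(a)$ if $p^m\nmid a$, and $\delta_C^{\rm mult}(1)=-\sum_{c\ne1}\delta_C^{\rm mult}(c)$. **Hurwitz trees.** Let $T$ be a finite tree with a root $v_0$ lying on exactly one edge $e_0$ (the trunk). Orient every edge $e$ away from the root, from its source $s(e)$ to its target $t(e)$, and write $v\to v'$ if there is an edge from $v$ to $v'$; the leaves are the vertices without successors. A *Hurwitz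 tree* $\mathcal T$ of type $(G,p)$ consists of such a tree with numbers $\epsilon_e\in\mathbb{Q}_{\ge0}$ for all edges $e$, such that $\epsilon_e=0$ if and only if $t(e)$ is a leaf; conjugacy classes $[G_v]$ of subgroups $G_v\le G$ for all vertices $v$; $a_e\in R^+(G)$ for all edges $e$; and $\delta_v\in R^+(G,\mathbb{Q})$ for all vertices $v$, such that: * (H1) if $v\to v'$ then $G_{v'}\subset G_v$ up to conjugation in $G$; if $v$ is neither the root nor a leaf then $\sum_{v\to v'}[G_v:G_{v'}]>1$; and $G_{v_0}=G_{v'}=G$ for the unique successor $v'$ of $v_0$; * (H2) $G_b$ is nontrivial and cyclic for every leaf $b$; * (H3) $a_e=\sum_{s(e')=t(e)}a_{e'}$ if $t(e)$ is not a leaf, and $a_e=u_{G_b}^*$ if $b=t(e)$ is a leaf; * (H4) $\delta_{t(e)}=\delta_{s(e)}+\epsilon_e\,(a_e-u_{G_{t(e)}}^*)$ for every edge $e$; * (H5) $\delta_b=(\delta_{P_b}^{\rm mult})^*$ for every leaf $b$, where $P_b$ is the Sylow $p$-subgroup of $G_b$. Its Artin character is $a_{\mathcal T}=a_{e_0}$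 and its depth is $\delta_{\mathcal T}=\delta_{v_0}$. **Local actions.** Let $\phi:G\hookrightarrow{\rm Aut}_k(k[[z]])$ be a local $G$-action, i.e. an injective homomorphism. Its Artin character is given by $a_\phi(\sigma)=-{\rm ord}_z(\sigma(z)-z)$ for $\sigma\neq1$ and $a_\phi(1)=-\sum_{\sigma\ne1}a_\phi(\sigma)$. We say that $\phi$ lifts to characteristic zero if there are a discrete valuation ring $R$ of characteristic zero with residue field $k$ and an action $G\to{\rm Aut}_R(R[[z]])$ whose reduction to $k[[z]]$ is $\phi$. The Bertin obstruction of $\phi$ vanishes if there is a finite $G$-set $\Delta$ with cyclic stabilizers such that $a_\phi=|\Delta/G|\cdot r_G-\chi_\Delta$, where $\chi_\Delta$ is the permutation character of $\Delta$. **Theorem.** (1) If $\phi$ lifts to characteristic zero, then there exists a Hurwitz tree $\mathcal T$ of type $(G,p)$ with $a_{\mathcal T}=a_\phi$ and $\delta_{\mathcal T}=0$. (2) This necessary condition for liftability refines the Bertin obstruction: if there exists a Hurwitz tree $\mathcal T$ of type $(G,p)$ with $a_{\mathcal T}=a_\phi$, then the Bertin obstruction of $\phi$ vanishes. -/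

import Mathlib

universe uG uk uR

namespace Hurwitz

/-! ### Characters of a finite group, as functions to the complex numbers -/

/-- `χ` is the character of a finite-dimensional complex representation of `G`, that is, an
element of `R⁺(G)`. -/
def IsCharacter {G : Type*} [Group G] (χ : G → ℂ) : Prop :=
  ∃ (n : ℕ) (ρ : Representation ℂ G (Fin n → ℂ)), ∀ g, χ g = LinearMap.trace ℂ (Fin n → ℂ) (ρ g)

/-- The scalar product `⟨ψ, χ⟩ = |G|⁻¹ ∑ conj (ψ σ) * χ σ`. -/
noncomputable def scalarProduct {G : Type*} [Fintype G] (ψ χ : G → ℂ) : ℂ :=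
  (Fintype.card G : ℂ)⁻¹ * ∑ σ, (starRingEnd ℂ) (ψ σ) * χ σ

/-- `χ` is an element of `R⁺(G, ℚ)`: a rational linear combination of characters whose scalar
product with every character is a nonnegative rational number. -/
def IsNonnegRatCharacter {G : Type*} [Group G] [Fintype G] (χ : G → ℂ) : Prop :=
  χ ∈ Submodule.span ℚ {ψ : G → ℂ | IsCharacter ψ} ∧
    ∀ ψ : G → ℂ, IsCharacter ψ → ∃ q : ℚ, 0 ≤ q ∧ scalarProduct ψ χ = (q : ℂ)

open Classical in
/-- The regular character `r_G`. -/
noncomputable def regularChar (G : Type*) [Group G] : G → ℂ :=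
  fun σ => if σ = 1 then (Nat.card G : ℂ) else 0

/-- The augmentation character `u_G = r_G - 1_G`. -/
noncomputable def augChar (G : Type*) [Group G] : G → ℂ :=
  fun σ => regularChar G σ - 1

open Classical in
/-- The class function on `G` induced from a class function on the subgroup `H`:
`χ^*(σ) = |H|⁻¹ ∑ χ(x⁻¹ σ x)`, the sum over all `x` in `G` with `x⁻¹ σ x ∈ H`. -/
noncomputable def induced {G : Type*} [Group G] [Fintype G] (H : Subgroup G) (χ : H → ℂ) :
    G → ℂ :=
  fun σ => (Nat.card H : ℂ)⁻¹ * ∑ x : G, if h : x⁻¹ * σ * x ∈ H then χ ⟨x⁻¹ * σ * x, h⟩ else 0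

/-- The value at a nontrivial element `c` of the character `δ^mult` of a cyclic group `C` of
`p`-power order: if `c = σ ^ a` for a generator `σ`, then `|C| / orderOf c = p ^ i`
with `i = ord_p a`, and the value is `- p ^ (i + 1) / (p - 1)`. -/
noncomputable def multDepthAux (p : ℕ) (C : Type*) [Group C] (c : C) : ℂ :=
  -((p : ℂ) ^ (padicValNat p (Nat.card C / orderOf c) + 1) / ((p : ℂ) - 1))

open Classical in
/-- The character `δ^mult` of a cyclic group `C` of `p`-power order; its value at `1` is minus
the sum of the other values. -/
noncomputable def multDepth (p : ℕ) (C : Type*) [Group C] [Fintype C] : C → ℂ :=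
  fun c => if c = 1 then -∑ d ∈ Finset.univ.erase 1, multDepthAux p C d else multDepthAux p C c

theorem multDepth_pow_generator {p m : ℕ} (hp : p.Prime) {C : Type*} [Group C] [Fintype C]
    (hC : Nat.card C = p ^ m) {σ : C} (hσ : ∀ c : C, c ∈ Subgroup.zpowers σ) {a : ℕ}
    (ha : ¬ p ^ m ∣ a) :
    multDepth p C (σ ^ a) = -((p : ℂ) ^ (padicValNat p a + 1) / ((p : ℂ) - 1)) := by
  have : Fact p.Prime := ⟨hp⟩
  have ho : orderOf σ = p ^ m := by rw [orderOf_eq_card_of_forall_mem_zpowers hσ, hC]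
  have h1 : σ ^ a ≠ 1 := by
    rw [Ne, ← orderOf_dvd_iff_pow_eq_one, ho]; exact ha
  have ha0 : a ≠ 0 := by rintro rfl; exact ha (dvd_zero _)
  have hlt : padicValNat p a < m := by
    by_contra h
    exact ha ((padicValNat_dvd_iff_le ha0).2 (not_lt.1 h))
  obtain ⟨j, hj, hgcd⟩ := (Nat.dvd_prime_pow hp).1 (Nat.gcd_dvd_left (p ^ m) a)
  have hja : j ≤ padicValNat p a :=
    (padicValNat_dvd_iff_le ha0).1 (hgcd ▸ Nat.gcd_dvd_right (p ^ m) a)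
  have hdv : p ^ padicValNat p a ∣ p ^ j := by
    rw [← hgcd]
    exact Nat.dvd_gcd (pow_dvd_pow p hlt.le) pow_padicValNat_dvd
  have hje : j = padicValNat p a :=
    le_antisymm hja ((Nat.pow_dvd_pow_iff_le_right hp.one_lt).1 hdv)
  have hq : Nat.card C / orderOf (σ ^ a) = p ^ padicValNat p a := by
    rw [orderOf_pow, ho, hC, hgcd, hje]
    exact Nat.div_div_self (pow_dvd_pow p hlt.le) (pow_ne_zero _ hp.ne_zero)
  rw [multDepth, if_neg h1, multDepthAux, hq, padicValNat.prime_pow]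

/-! ### Metric trees -/

/-- A finite tree with a distinguished vertex, the root, which lies on exactly one edge. -/
structure PlantedTree where
  /-- The vertices. -/
  V : Type
  /-- There are finitely many vertices. -/
  fintypeV : Fintype V
  /-- The underlying graph. -/
  graph : SimpleGraph V
  isTree : graph.IsTree
  /-- The root. -/
  root : V
  existsUnique_adj_root : ∃! w, graph.Adj root w

namespace PlantedTree

instance (T : PlantedTree) : Fintype T.V := T.fintypeV

/-- `w` is a successor of `v` (notation `v → w`): `v` and `w` are joined by an edge, and `v` is
the end of this edge that lies in the component of the root once the edge is removed. -/
def Succ (T : PlantedTree) (v w : T.V) : Prop :=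
  T.graph.Adj v w ∧ (T.graph.deleteEdges {s(v, w)}).Reachable T.root v

/-- The edges of `T`, each one with its orientation away from the root. -/
def Edge (T : PlantedTree) : Type := {d : T.V × T.V // T.Succ d.1 d.2}

noncomputable instance (T : PlantedTree) : Fintype T.Edge :=
  @Fintype.ofFinite _ (inferInstanceAs (Finite {d : T.V × T.V // T.Succ d.1 d.2}))

/-- The source of an edge. -/
def Edge.source {T : PlantedTree} (e : T.Edge) : T.V := e.1.1

/-- The target of an edge. -/
def Edge.target {T : PlantedTree} (e : T.Edge) : T.V := e.1.2

/-- The leaves are the maximal vertices, that is, the vertices without successors. -/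
def IsLeaf (T : PlantedTree) (v : T.V) : Prop := ∀ w, ¬ T.Succ v w

/-- The trunk: the unique edge at the root. -/
noncomputable def trunk (T : PlantedTree) : T.Edge :=
  ⟨(T.root, T.existsUnique_adj_root.choose),
    T.existsUnique_adj_root.choose_spec.1, SimpleGraph.Reachable.refl _⟩

end PlantedTree

/-- A metric tree: every edge `e` has a thickness `ε e`, a nonnegative rational number which
vanishes if and only if the target of `e` is a leaf. -/
structure MetricTree extends PlantedTree where
  /-- The thickness of an edge. -/
  ε : toPlantedTree.Edge → ℚ
  ε_nonneg : ∀ e, 0 ≤ ε e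
  ε_eq_zero_iff : ∀ e, ε e = 0 ↔ toPlantedTree.IsLeaf e.target

/-! ### Hurwitz trees -/

open Classical in
/-- A Hurwitz tree of type `(G, p)`. The conjugacy class `[G_v]` attached to a vertex `v` is given
by a representative `grp v`; all the conditions are invariant under replacing these
representatives by conjugates. -/
structure HurwitzTree (G : Type*) [Group G] [Fintype G] (p : ℕ) extends MetricTree where
  /-- The monodromy group `G_v` of a vertex. -/
  grp : V → Subgroup G
  /-- The Artin character `a_e` of an edge. -/
  artin : toPlantedTree.Edge → G → ℂ
  artin_isCharacter : ∀ e, IsCharacter (artin e)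
  /-- The depth `δ_v` of a vertex. -/
  depth : V → G → ℂ
  depth_isNonneg : ∀ v, IsNonnegRatCharacter (depth v)
  /-- (H1) Along successors the monodromy groups decrease, up to conjugation. -/
  grp_succ_le : ∀ v w, toPlantedTree.Succ v w → ∃ g : G, ∀ x ∈ grp w, g * x * g⁻¹ ∈ grp v
  /-- (H1) `∑ [G_v : G_w] > 1`, the sum over the successors `w` of `v`. The index is that of a
  conjugate of `G_w` contained in `G_v`, hence the quotient of the orders. -/
  one_lt_sum_index : ∀ v, v ≠ root → ¬ toPlantedTree.IsLeaf v →
    1 < ∑ w with toPlantedTree.Succ v w, (Nat.card (grp v) : ℚ) / (Nat.card (grp w) : ℚ)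
  /-- (H1) At the root and at its unique successor the monodromy group is `G`. -/
  grp_root : grp root = ⊤
  grp_succ_root : ∀ w, toPlantedTree.Succ root w → grp w = ⊤
  /-- (H2) -/
  grp_leaf : ∀ b, toPlantedTree.IsLeaf b → grp b ≠ ⊥ ∧ IsCyclic (grp b)
  /-- (H3), for edges whose target is not a leaf. -/
  artin_eq_sum : ∀ e, ¬ toPlantedTree.IsLeaf e.target →
    artin e = ∑ e' with e'.source = e.target, artin e'
  /-- (H3), for edges whose target is a leaf. -/
  artin_leaf : ∀ e, toPlantedTree.IsLeaf e.target →
    artin e = induced (grp e.target) (augChar (grp e.target))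
  /-- (H4) `δ_{t(e)} = δ_{s(e)} + ε_e • (a_e - u_{G_{t(e)}}^*)`. -/
  depth_target : ∀ e, depth e.target = depth e.source +
    (ε e : ℂ) • (artin e - induced (grp e.target) (augChar (grp e.target)))
  /-- (H5) `δ_b = (δ_{P_b}^mult)^*` for the Sylow `p`-subgroup `P_b` of the cyclic group `G_b`. -/
  depth_leaf : ∀ b, toPlantedTree.IsLeaf b → ∀ P : Sylow p (grp b),
    depth b = induced ((P : Subgroup (grp b)).map (grp b).subtype)
      (multDepth p ((P : Subgroup (grp b)).map (grp b).subtype))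

/-- The Artin character `a_𝒯` of a Hurwitz tree: the Artin character of its trunk. -/
noncomputable def HurwitzTree.artinChar {G : Type*} [Group G] [Fintype G] {p : ℕ}
    (T : HurwitzTree G p) : G → ℂ := T.artin T.trunk

/-- The depth `δ_𝒯` of a Hurwitz tree: the depth of its root. -/
def HurwitzTree.depthChar {G : Type*} [Group G] [Fintype G] {p : ℕ}
    (T : HurwitzTree G p) : G → ℂ := T.depth T.root

/-! ### Actions on power series rings -/

/-- The order `ord_z (σ(z) - z)`. It is finite when `φ σ` is not the identity, since a
`k`-automorphism of `k⟦z⟧` is determined by the image of `z`. -/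
noncomputable def ramificationOrder {G k : Type*} [Group G] [Field k]
    (φ : G →* (PowerSeries k ≃ₐ[k] PowerSeries k)) (σ : G) : ℕ :=
  (PowerSeries.order (φ σ PowerSeries.X - PowerSeries.X)).toNat

open Classical in
/-- The Artin character `a_φ` of a faithful action `φ` of `G` on `k⟦z⟧`. -/
noncomputable def artinCharacter {G k : Type*} [Group G] [Fintype G] [Field k]
    (φ : G →* (PowerSeries k ≃ₐ[k] PowerSeries k)) : G → ℂ :=
  fun σ => if σ = 1 then ∑ τ ∈ Finset.univ.erase 1, (ramificationOrder φ τ : ℂ)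
    else -(ramificationOrder φ σ : ℂ)

/-- `φ` lifts to characteristic zero: there are a discrete valuation ring `R` of characteristic
zero with residue field `k` and an action of `G` on `R⟦z⟧` by `R`-automorphisms that reduces to
`φ`. -/
def LiftsToCharZero {G : Type uG} {k : Type uk} [Group G] [Field k]
    (φ : G →* (PowerSeries k ≃ₐ[k] PowerSeries k)) : Prop :=
  ∃ (R : Type uR) (_ : CommRing R) (_ : IsDomain R) (_ : IsDiscreteValuationRing R)
    (_ : CharZero R) (ι : IsLocalRing.ResidueField R ≃+* k)
    (Φ : G →* (PowerSeries R ≃ₐ[R] PowerSeries R)),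
    ∀ (σ : G) (f : PowerSeries R),
      PowerSeries.map ((ι : IsLocalRing.ResidueField R →+* k).comp (IsLocalRing.residue R))
          (Φ σ f) =
        φ σ (PowerSeries.map
          ((ι : IsLocalRing.ResidueField R →+* k).comp (IsLocalRing.residue R)) f)

/-- The Bertin obstruction for `φ` vanishes: there is a finite `G`-set `Δ` with cyclic stabilizers
such that `a_φ = m • r_G - χ_Δ`, where `m` is the number of orbits of `Δ` and `χ_Δ` is the
permutation character, `χ_Δ(σ)` being the number of fixed points of `σ`. -/
def BertinObstructionVanishes {G : Type uG} {k : Type uk} [Group G] [Fintype G] [Field k]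
    (φ : G →* (PowerSeries k ≃ₐ[k] PowerSeries k)) : Prop :=
  ∃ (Δ : Type uG) (_ : Finite Δ) (_ : MulAction G Δ),
    (∀ y : Δ, IsCyclic (MulAction.stabilizer G y)) ∧
    ∀ σ : G, artinCharacter φ σ =
      (Nat.card (MulAction.orbitRel.Quotient G Δ) : ℂ) * regularChar G σ
        - (Nat.card (MulAction.fixedBy Δ σ) : ℂ)

end Hurwitz

namespace Hurwitz

/-! Part (1). For σ ≠ 1 the series σ(z) - z of the lift has a nonzero reduction, of order -a_φ(σ),
so by Weierstrass preparation it is a unit times a distinguished polynomial of that degree. Over a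
complete discrete valuation ring `S` where all these polynomials split, G acts by isometries on the
maximal ideal of `S`, the points of the open disc, and the fixed points of σ are the zeros of σ(z) -
z. These zeros are simple, because an automorphism of finite order in characteristic zero has
derivative ≠ 1 at a fixed point (`IsFactorization.multiplier_ne_one`). Hence σ has exactly -a_φ(σ)
fixed points. The derivative also embeds the stabilizer of a point into the units of a domain, so
stabilizers are cyclic.

The Hurwitz tree depends only on the finite set Δ of points with nontrivial stabilizer and on their
distances; `FixedPointData` records what is needed. Vertices are G-orbits of discs centered at
points of Δ whose radii are distances in Δ; the root is the whole open disc, the leaves are the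
orbits of points. The monodromy group is the stabilizer of the disc, and -a_e(σ) counts the fixed
points of σ in the orbit of the disc at the target of e. The depth comes from the Gauss valuation of
σ(z) - z on the disc, minus the radius, divided by v(p).

Condition (H4) says that the Gauss valuation is piecewise linear in the radius, its slope being the
number of zeros inside (`discDepth_eq_add`). For (H5), let ζ be the derivative of σ at a fixed
point: it is a root of unity of the same order as σ, and v(ζ - 1) is the sum of the distances to the
other fixed points. The depth lies in R⁺(G, ℚ) because the Gauss valuation is ultrametric in σ: its
superlevel sets are subgroups H, and the depth is a nonnegative combination of the characters u_H^*
(`isNonnegRatCharacter_negConjSum`).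

Part (2). Unrolling (H3) writes the Artin character of the tree as a sum of characters u_{G_b}^* =
r_G - χ_{G/G_b} over leaves b; the disjoint union of the coset spaces G/G_b is the required G-set.
-/

open Classical in
theorem trace_eq_sum_apply_single {X : Type*} [Fintype X] (T : (X → ℂ) →ₗ[ℂ] (X → ℂ)) :
    LinearMap.trace ℂ (X → ℂ) T = ∑ x, T (Pi.single x 1) x := by
  rw [LinearMap.trace_eq_matrix_trace ℂ (Pi.basisFun ℂ X)]
  simp [Matrix.trace]

/-! ### Characters, induced class functions and R⁺(G, ℚ) -/

section Characters

variable {G : Type*} [Group G]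

theorem IsCharacter.of_representation {V : Type*} [AddCommGroup V] [Module ℂ V]
    [FiniteDimensional ℂ V] (ρ : Representation ℂ G V) :
    IsCharacter (fun g => LinearMap.trace ℂ V (ρ g)) := by
  let e : V ≃ₗ[ℂ] (Fin (Module.finrank ℂ V) → ℂ) := (Module.finBasis ℂ V).equivFun
  refine ⟨Module.finrank ℂ V,
    { toFun := fun g => e.conj (ρ g), map_one' := ?_, map_mul' := ?_ }, fun g => ?_⟩
  · ext; simp
  · intro g h; ext; simp [LinearEquiv.conj_apply]
  · exact (LinearMap.trace_conj' (ρ g) e).symm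

theorem IsCharacter.add {χ ψ : G → ℂ} (hχ : IsCharacter χ) (hψ : IsCharacter ψ) :
    IsCharacter (χ + ψ) := by
  obtain ⟨n, ρ, hρ⟩ := hχ
  obtain ⟨m, τ, hτ⟩ := hψ
  have := IsCharacter.of_representation (ρ.prod τ)
  convert this using 1
  ext g
  have h := LinearMap.congr_fun (LinearMap.trace_prodMap ℂ (Fin n → ℂ) (Fin m → ℂ)) (ρ g, τ g)
  simp only [Pi.add_apply, hρ, hτ]
  exact h.symm

theorem isCharacter_zero : IsCharacter (0 : G → ℂ) :=
  ⟨0, 1, fun g => by simp [Subsingleton.elim ((1 : Representation ℂ G (Fin 0 → ℂ)) g) 0]⟩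

theorem IsCharacter.sum {ι : Type*} (s : Finset ι) {χ : ι → G → ℂ}
    (h : ∀ i ∈ s, IsCharacter (χ i)) : IsCharacter (∑ i ∈ s, χ i) :=
  Finset.sum_induction _ _ (fun _ _ => IsCharacter.add) isCharacter_zero h

/-- A projection commuting with a representation cuts out a character. -/
theorem IsCharacter.of_idempotent {V : Type*} [AddCommGroup V] [Module ℂ V]
    [FiniteDimensional ℂ V] (ρ : Representation ℂ G V) (e : V →ₗ[ℂ] V) (he : e ∘ₗ e = e)
    (hc : ∀ g, e ∘ₗ ρ g = ρ g ∘ₗ e) :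
    IsCharacter (fun g => LinearMap.trace ℂ V (ρ g ∘ₗ e)) := by
  have hid : ∀ v : LinearMap.range e, e v = v := by
    rintro ⟨_, v, rfl⟩
    exact LinearMap.congr_fun he v
  have hc' : ∀ g v, e (ρ g v) = ρ g (e v) := fun g v => LinearMap.congr_fun (hc g) v
  have hmem : ∀ g (v : LinearMap.range e), ρ g v ∈ LinearMap.range e := fun g v =>
    ⟨ρ g v, by rw [hc', hid]⟩
  let τ : Representation ℂ G (LinearMap.range e) :=
    { toFun := fun g => (ρ g).restrict (fun v hv => hmem g ⟨v, hv⟩)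
      map_one' := by ext; simp
      map_mul' := by intro g h; ext; simp }
  convert IsCharacter.of_representation τ using 2 with g
  -- `τ g` and `ρ g ∘ₗ e` compose the same two maps between V and the range of e in opposite orders,
  -- so their traces agree.
  have h1 : τ g = e.rangeRestrict ∘ₗ (ρ g ∘ₗ (LinearMap.range e).subtype) := by
    ext v
    simp [τ, hc', hid]
  have h2 : ρ g ∘ₗ e = (ρ g ∘ₗ (LinearMap.range e).subtype) ∘ₗ e.rangeRestrict := by
    ext v; simp
  rw [h1, h2, LinearMap.trace_comp_comm']

variable [Fintype G]

/-- Artin characters, depths and the u_H^* all have sum zero over G, so the value at 1 is forced by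
the others, and identities between them need only be checked away from 1. -/
theorem eq_of_sum_eq_of_forall_ne_one {f g : G → ℂ} (hs : ∑ σ, f σ = ∑ σ, g σ)
    (h : ∀ σ, σ ≠ 1 → f σ = g σ) : f = g := by
  classical
  ext σ
  by_cases hσ : σ = 1
  · subst hσ
    rw [← Finset.add_sum_erase _ _ (Finset.mem_univ 1),
      ← Finset.add_sum_erase _ g (Finset.mem_univ 1),
      Finset.sum_congr rfl fun τ hτ => h τ (Finset.ne_of_mem_erase hτ)] at hs
    exact add_right_cancel hs
  · exact h σ hσ

open Classical in
/-- The class function with sum zero whose value at `σ ≠ 1` is `-∑ x, W (x⁻¹ σ x)`. -/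
noncomputable def negConjSum (W : G → ℚ) : G → ℂ :=
  fun σ => if σ = 1 then ∑ τ ∈ Finset.univ.erase 1, ∑ x : G, (W (x⁻¹ * τ * x) : ℂ)
    else -∑ x : G, (W (x⁻¹ * σ * x) : ℂ)

theorem negConjSum_of_ne_one (W : G → ℚ) {σ : G} (hσ : σ ≠ 1) :
    negConjSum W σ = -∑ x : G, (W (x⁻¹ * σ * x) : ℂ) := if_neg hσ

theorem sum_negConjSum (W : G → ℚ) : ∑ σ, negConjSum W σ = 0 := by
  classical
  rw [← Finset.add_sum_erase _ _ (Finset.mem_univ 1)]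
  simp only [negConjSum, if_true]
  rw [← Finset.sum_add_distrib]
  refine Finset.sum_eq_zero fun τ hτ => ?_
  rw [if_neg (Finset.ne_of_mem_erase hτ), add_neg_cancel]

theorem negConjSum_congr {W W' : G → ℚ} (h : ∀ σ, σ ≠ 1 → W σ = W' σ) :
    negConjSum W = negConjSum W' := by
  refine eq_of_sum_eq_of_forall_ne_one (by simp only [sum_negConjSum]) fun σ hσ => ?_
  rw [negConjSum_of_ne_one _ hσ, negConjSum_of_ne_one _ hσ]
  congr 1
  refine Finset.sum_congr rfl fun x _ => ?_
  rw [h]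
  intro hx
  apply hσ
  have : σ = x * (x⁻¹ * σ * x) * x⁻¹ := by group
  rw [this, hx]; group

theorem negConjSum_conj (W : G → ℚ) (g : G) :
    negConjSum (fun σ => W (g * σ * g⁻¹)) = negConjSum W := by
  refine eq_of_sum_eq_of_forall_ne_one (by simp only [sum_negConjSum]) fun σ hσ => ?_
  rw [negConjSum_of_ne_one _ hσ, negConjSum_of_ne_one _ hσ]
  congr 1
  refine Fintype.sum_equiv (Equiv.mulRight g⁻¹) _ _ fun x => ?_
  simp [mul_assoc]

theorem negConjSum_add (W W' : G → ℚ) :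
    negConjSum (fun σ => W σ + W' σ) = negConjSum W + negConjSum W' := by
  refine eq_of_sum_eq_of_forall_ne_one (by
    simp only [Pi.add_apply, Finset.sum_add_distrib, sum_negConjSum, add_zero]) fun σ hσ => ?_
  rw [Pi.add_apply, negConjSum_of_ne_one _ hσ, negConjSum_of_ne_one _ hσ,
    negConjSum_of_ne_one _ hσ]
  push_cast
  rw [Finset.sum_add_distrib, neg_add]

theorem negConjSum_const_mul (c : ℚ) (W : G → ℚ) :
    negConjSum (fun σ => c * W σ) = (c : ℂ) • negConjSum W := by
  refine eq_of_sum_eq_of_forall_ne_one (by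
    simp only [Pi.smul_apply, ← Finset.smul_sum, sum_negConjSum, smul_zero]) fun σ hσ => ?_
  rw [Pi.smul_apply, negConjSum_of_ne_one _ hσ, negConjSum_of_ne_one _ hσ]
  push_cast
  rw [← Finset.mul_sum, smul_eq_mul, mul_neg]

theorem negConjSum_eq_zero {W : G → ℚ} (h : ∀ σ, σ ≠ 1 → W σ = 0) : negConjSum W = 0 := by
  rw [negConjSum_congr (W' := fun σ => 0 * W σ) fun σ hσ => by rw [h σ hσ, zero_mul],
    negConjSum_const_mul]
  simp

open Classical in
theorem sum_induced (H : Subgroup G) (χ : H → ℂ) :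
    ∑ σ, induced H χ σ = (Nat.card H : ℂ)⁻¹ * Nat.card G * ∑ h, χ h := by
  classical
  unfold induced
  rw [← Finset.mul_sum, Finset.sum_comm, mul_assoc]
  congr 1
  have : ∀ x : G, ∑ σ : G, (if h : x⁻¹ * σ * x ∈ H then χ ⟨x⁻¹ * σ * x, h⟩ else 0) =
      ∑ h, χ h := by
    intro x
    have h1 : ∑ σ : G, (if h : x⁻¹ * σ * x ∈ H then χ ⟨x⁻¹ * σ * x, h⟩ else 0) =
        ∑ σ : G, (if h : σ ∈ H then χ ⟨σ, h⟩ else 0) :=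
      Fintype.sum_equiv (MulAut.conj x⁻¹).toEquiv _ _ fun σ => by simp
    rw [h1, ← Finset.sum_filter_add_sum_filter_not _ (· ∈ H)]
    rw [Finset.sum_eq_zero (s := Finset.univ.filter (¬ · ∈ H)), add_zero]
    · rw [← Finset.sum_subtype_of_mem (p := (· ∈ H)) _ (by simp)]
      refine Finset.sum_bij' (fun a _ => a) (fun a _ => a) ?_ ?_ ?_ ?_ ?_ <;> simp
    · intro y hy
      simp at hy
      simp [hy]
  rw [Finset.sum_congr rfl fun x _ => this x]
  simp

theorem sum_augChar (G : Type*) [Group G] [Fintype G] : ∑ σ, augChar G σ = 0 := by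
  classical
  simp [augChar, regularChar]

theorem induced_augChar_of_ne_one (H : Subgroup G) [DecidablePred (· ∈ H)] {σ : G} (hσ : σ ≠ 1) :
    induced H (augChar H) σ =
      -((Nat.card H : ℂ)⁻¹ * ∑ x : G, if x⁻¹ * σ * x ∈ H then 1 else 0) := by
  unfold induced
  rw [← mul_neg, ← Finset.sum_neg_distrib]
  congr 1
  refine Finset.sum_congr rfl fun x _ => ?_
  split_ifs with h
  · have : (⟨x⁻¹ * σ * x, h⟩ : H) ≠ 1 := by
      intro h1
      apply hσ
      have h2 : x⁻¹ * σ * x = 1 := congrArg Subtype.val h1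
      have : σ = x * (x⁻¹ * σ * x) * x⁻¹ := by group
      rw [this, h2]; group
    simp [augChar, regularChar, this]
  · simp

-- Away from 1 the function u_H is -1 on H, so induction sums the indicator of H over conjugates;
-- the factor |H|⁻¹ is that of the induction formula.
open Classical in
theorem induced_augChar (H : Subgroup G) :
    induced H (augChar H) =
      ((Nat.card H : ℂ)⁻¹) • negConjSum (fun τ => if τ ∈ H then 1 else 0) := by
  refine eq_of_sum_eq_of_forall_ne_one (by
    rw [sum_induced, sum_augChar]
    simp only [Pi.smul_apply, ← Finset.smul_sum, sum_negConjSum, smul_zero, mul_zero])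
    fun σ hσ => ?_
  rw [induced_augChar_of_ne_one H hσ, Pi.smul_apply, negConjSum_of_ne_one _ hσ]
  rw [smul_eq_mul, mul_neg]
  congr! 3
  split_ifs <;> simp

theorem negConjSum_indicator (H : Subgroup G) [DecidablePred (· ∈ H)] :
    negConjSum (fun τ => if τ ∈ H then 1 else 0) =
      (Nat.card H : ℂ) • induced H (augChar H) := by
  have : (Nat.card H : ℂ) ≠ 0 := by simp
  rw [induced_augChar, smul_smul, mul_inv_cancel₀ this, one_smul]
  congr!

open Classical in
/-- `u_H^*` is a character: the functions on `G` whose sum over every coset `x H` vanishes. -/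
theorem isCharacter_induced_augChar (H : Subgroup G) : IsCharacter (induced H (augChar H)) := by
  let ρ : Representation ℂ G (G → ℂ) :=
    { toFun := fun g => LinearMap.funLeft ℂ ℂ (fun x => g⁻¹ * x)
      map_one' := by ext; simp [LinearMap.funLeft]
      map_mul' := by intro g h; ext; simp [LinearMap.funLeft, mul_assoc] }
  let a : (G → ℂ) →ₗ[ℂ] (G → ℂ) :=
    (Nat.card H : ℂ)⁻¹ • ∑ h : H, LinearMap.funLeft ℂ ℂ (fun x => x * (h : G))
  have hcard : (Nat.card H : ℂ) ≠ 0 := by simp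
  have haf : ∀ f x, a f x = (Nat.card H : ℂ)⁻¹ * ∑ h : H, f (x * h) := by
    intro f x
    simp [a, LinearMap.funLeft]
  have haa : a ∘ₗ a = a := by
    refine LinearMap.ext fun f => funext fun x => ?_
    rw [LinearMap.comp_apply, haf, haf]
    have : ∀ h : H, a f (x * h) = (Nat.card H : ℂ)⁻¹ * ∑ h : H, f (x * h) := by
      intro h
      rw [haf]
      congr 1
      exact Fintype.sum_equiv (Equiv.mulLeft h) _ _ fun y => by simp [mul_assoc]
    rw [Finset.sum_congr rfl fun h _ => this h]
    simp only [Finset.sum_const, Finset.card_univ, nsmul_eq_mul, ← Nat.card_eq_fintype_card]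
    rw [← mul_assoc, ← mul_assoc, inv_mul_cancel₀ hcard, one_mul]
  have hac : ∀ g, a ∘ₗ ρ g = ρ g ∘ₗ a := by
    intro g
    refine LinearMap.ext fun f => funext fun x => ?_
    rw [LinearMap.comp_apply, LinearMap.comp_apply, haf]
    change _ = a f (g⁻¹ * x)
    rw [haf]
    simp [ρ, LinearMap.funLeft, mul_assoc]
  convert IsCharacter.of_idempotent ρ (LinearMap.id - a) (by
    rw [LinearMap.sub_comp, LinearMap.comp_sub, LinearMap.comp_sub, haa]; simp) (fun g => by
    rw [LinearMap.sub_comp, LinearMap.comp_sub, hac]; simp) with σ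
  -- The traces are read off on delta functions: `h1` detects σ x = x, and `h2` detects σ x H = x H
  -- with weight |H|⁻¹.
  rw [LinearMap.comp_sub, map_sub, LinearMap.comp_id, trace_eq_sum_apply_single,
    trace_eq_sum_apply_single]
  have h1 : ∀ x : G, ρ σ (Pi.single x 1) x = if σ = 1 then 1 else 0 := by
    intro x
    simp [ρ, LinearMap.funLeft, Pi.single_apply]
  have h2 : ∀ x : G, (ρ σ ∘ₗ a) (Pi.single x 1) x =
      (Nat.card H : ℂ)⁻¹ * if x⁻¹ * σ * x ∈ H then 1 else 0 := by
    intro x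
    change a (Pi.single x 1) (σ⁻¹ * x) = _
    rw [haf]
    congr 1
    simp only [Pi.single_apply]
    split_ifs with h
    · rw [Finset.sum_eq_single ⟨x⁻¹ * σ * x, h⟩]
      · simp [mul_assoc]
      · intro b _ hb
        rw [if_neg]
        intro hb'
        apply hb
        ext
        rw [← eq_inv_mul_iff_mul_eq] at hb'
        simpa [mul_assoc] using hb'
      · simp
    · refine Finset.sum_eq_zero fun b _ => ?_
      rw [if_neg]
      intro hb'
      apply h
      rw [← eq_inv_mul_iff_mul_eq] at hb'
      have : x⁻¹ * σ * x = b := by rw [hb']; simp [mul_assoc]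
      rw [this]; exact b.2
  rw [Finset.sum_congr rfl fun x _ => h1 x, Finset.sum_congr rfl fun x _ => h2 x,
    ← Finset.mul_sum]
  by_cases hσ : σ = 1
  · subst hσ
    simp [induced, augChar, regularChar]
    field_simp
  · rw [induced_augChar_of_ne_one H hσ]
    simp [hσ]

open Classical in
/-- `⟨ψ, u_H^*⟩ = dim V - dim V^H` for the character `ψ` of a representation on `V`. -/
theorem exists_scalarProduct_induced_augChar (H : Subgroup G) {ψ : G → ℂ} (hψ : IsCharacter ψ) :
    ∃ n : ℕ, scalarProduct ψ (induced H (augChar H)) = n := by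
  obtain ⟨n, ρ, hρ⟩ := hψ
  have hconj : ∀ x σ, ψ (x * σ * x⁻¹) = ψ σ := by
    intro x σ
    rw [hρ, hρ]
    exact ρ.char_conj σ x
  have hG : (Fintype.card G : ℂ) ≠ 0 := by simp
  have hH : (Nat.card H : ℂ) ≠ 0 := by simp
  let τ : Representation ℂ H (Fin n → ℂ) := ρ.comp H.subtype
  have : Invertible (Nat.card H : ℂ) := invertibleOfNonzero hH
  have hinv := τ.card_inv_mul_sum_char_eq_finrank
  have hle : Module.finrank ℂ τ.invariants ≤ n := by
    simpa using Submodule.finrank_le τ.invariants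
  refine ⟨n - Module.finrank ℂ τ.invariants, ?_⟩
  rw [Nat.cast_sub hle, ← hinv]
  -- The sum of the character over H is |H| dim V^H, a real number, so the conjugation in the scalar
  -- product may be dropped.
  have hsum : ∑ h : H, (starRingEnd ℂ) (ψ h) = ∑ h : H, τ.character h := by
    have h1 : ∑ h : H, τ.character h = Nat.card H * Module.finrank ℂ τ.invariants := by
      rw [← hinv, ← mul_assoc, mul_inv_cancel₀ hH, one_mul]
    have h2 : ∀ h : H, ψ h = τ.character h := fun h => hρ h
    simp_rw [h2]
    rw [← map_sum, h1]
    simp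
  have hone : ψ 1 = n := by
    rw [hρ, map_one]; simp
  -- Since ψ is a class function, conjugating σ by x shows that every x contributes the same sum
  -- over H.
  have key : ∀ x : G, ∑ σ : G, (starRingEnd ℂ) (ψ σ) *
      (if h : x⁻¹ * σ * x ∈ H then augChar H ⟨x⁻¹ * σ * x, h⟩ else 0) =
        (Nat.card H : ℂ) * n - ∑ h : H, (starRingEnd ℂ) (ψ h) := by
    intro x
    have h1 : ∑ σ : G, (starRingEnd ℂ) (ψ σ) *
        (if h : x⁻¹ * σ * x ∈ H then augChar H ⟨x⁻¹ * σ * x, h⟩ else 0) =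
        ∑ σ : G, (starRingEnd ℂ) (ψ σ) * (if h : σ ∈ H then augChar H ⟨σ, h⟩ else 0) := by
      refine Fintype.sum_equiv (MulAut.conj x⁻¹).toEquiv _ _ fun σ => ?_
      have := hconj x⁻¹ σ
      simp only [inv_inv] at this
      simp [this]
    rw [h1, ← Finset.sum_filter_add_sum_filter_not _ (· ∈ H),
      Finset.sum_eq_zero (s := Finset.univ.filter (¬ · ∈ H)), add_zero]
    · have h2 : ∑ σ : G with σ ∈ H, (starRingEnd ℂ) (ψ σ) *
          (if h : σ ∈ H then augChar H ⟨σ, h⟩ else 0) =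
          ∑ h : H, (starRingEnd ℂ) (ψ h) * augChar H h := by
        rw [← Finset.sum_subtype_of_mem (p := (· ∈ H)) _ (by simp)]
        refine Finset.sum_bij' (fun a _ => a) (fun a _ => a) ?_ ?_ ?_ ?_ ?_ <;> simp
      rw [h2]
      simp only [augChar, regularChar, mul_sub, mul_one, Finset.sum_sub_distrib, mul_ite, mul_zero]
      simp [hone, mul_comm]
    · intro y hy
      simp at hy
      simp [hy]
  unfold scalarProduct induced
  simp_rw [mul_left_comm _ ((Nat.card H : ℂ)⁻¹), Finset.mul_sum]
  rw [Finset.sum_comm]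
  simp_rw [← Finset.mul_sum]
  rw [Finset.sum_congr rfl fun x _ => key x, hsum]
  rw [Finset.sum_const, Finset.card_univ, nsmul_eq_mul]
  field_simp

theorem IsNonnegRatCharacter.zero : IsNonnegRatCharacter (0 : G → ℂ) :=
  ⟨Submodule.zero_mem _, fun ψ _ => ⟨0, le_rfl, by simp [scalarProduct]⟩⟩

theorem IsNonnegRatCharacter.add {χ χ' : G → ℂ} (h : IsNonnegRatCharacter χ)
    (h' : IsNonnegRatCharacter χ') : IsNonnegRatCharacter (χ + χ') := by
  refine ⟨Submodule.add_mem _ h.1 h'.1, fun ψ hψ => ?_⟩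
  obtain ⟨q, hq, hq'⟩ := h.2 ψ hψ
  obtain ⟨r, hr, hr'⟩ := h'.2 ψ hψ
  refine ⟨q + r, add_nonneg hq hr, ?_⟩
  push_cast
  rw [← hq', ← hr']
  simp [scalarProduct, mul_add, Finset.sum_add_distrib]

theorem IsNonnegRatCharacter.smul {χ : G → ℂ} (h : IsNonnegRatCharacter χ) {c : ℚ} (hc : 0 ≤ c) :
    IsNonnegRatCharacter ((c : ℂ) • χ) := by
  constructor
  · have : (c : ℂ) • χ = c • χ := by
      ext; simp [Rat.smul_def]
    rw [this]
    exact Submodule.smul_mem _ _ h.1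
  · intro ψ hψ
    obtain ⟨q, hq, hq'⟩ := h.2 ψ hψ
    refine ⟨c * q, mul_nonneg hc hq, ?_⟩
    push_cast
    rw [← hq']
    simp only [scalarProduct, Pi.smul_apply, smul_eq_mul, mul_left_comm _ (c : ℂ)]
    rw [← Finset.mul_sum]
    ring

theorem isNonnegRatCharacter_induced_augChar (H : Subgroup G) :
    IsNonnegRatCharacter (induced H (augChar H)) := by
  refine ⟨Submodule.subset_span (isCharacter_induced_augChar H), fun ψ hψ => ?_⟩
  obtain ⟨n, hn⟩ := exists_scalarProduct_induced_augChar H hψ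
  exact ⟨n, by positivity, by rw [hn]; simp⟩

/-- A nonnegative function whose superlevel sets are subgroups (up to the identity) gives rise to
an element of `R⁺(G, ℚ)`. -/
theorem isNonnegRatCharacter_negConjSum (W : G → ℚ) (h0 : ∀ σ, 0 ≤ W σ)
    (hinv : ∀ σ, W σ⁻¹ = W σ)
    (hmul : ∀ σ τ, σ ≠ 1 → τ ≠ 1 → σ * τ ≠ 1 → min (W σ) (W τ) ≤ W (σ * τ)) :
    IsNonnegRatCharacter (negConjSum W) := by
  classical
  induction hn : (Finset.univ.filter fun σ : G => σ ≠ 1 ∧ W σ ≠ 0).card using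
    Nat.strong_induction_on generalizing W with
  | _ n ih =>
  subst hn
  rcases (Finset.univ.filter fun σ : G => σ ≠ 1 ∧ W σ ≠ 0).eq_empty_or_nonempty with he | hne
  · rw [negConjSum_eq_zero]
    · exact IsNonnegRatCharacter.zero
    · intro σ hσ
      by_contra h
      have : σ ∈ Finset.univ.filter fun σ : G => σ ≠ 1 ∧ W σ ≠ 0 := by simp [hσ, h]
      rw [he] at this
      simp at this
  obtain ⟨σ₀, hσ₀, hmin⟩ := Finset.exists_min_image _ W hne
  simp only [Finset.mem_filter, Finset.mem_univ, true_and] at hσ₀ hmin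
  set t := W σ₀
  have ht : 0 < t := lt_of_le_of_ne (h0 _) (Ne.symm hσ₀.2)
  have hdich : ∀ σ, σ ≠ 1 → W σ = 0 ∨ t ≤ W σ := fun σ hσ =>
    (eq_or_ne (W σ) 0).imp_right fun h => hmin σ ⟨hσ, h⟩
  -- H is the support of W together with 1, since W takes no value strictly between 0 and t away
  -- from 1. Subtracting t times the indicator of H leaves a function of the same kind with strictly
  -- smaller support.
  let H : Subgroup G :=
    { carrier := {σ | σ = 1 ∨ t ≤ W σ}
      one_mem' := Or.inl rfl
      mul_mem' := by
        rintro σ τ (rfl | hσ) hτ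
        · simpa using hτ
        rcases hτ with rfl | hτ
        · right; simpa using hσ
        by_cases h : σ * τ = 1
        · exact Or.inl h
        by_cases h1 : σ = 1
        · subst h1; right; simpa using hτ
        by_cases h2 : τ = 1
        · subst h2; right; simpa using hσ
        exact Or.inr ((le_min hσ hτ).trans (hmul σ τ h1 h2 h))
      inv_mem' := by
        rintro σ (rfl | hσ)
        · left; simp
        · exact Or.inr (hσ.trans_eq (hinv σ).symm) }
  have hH : ∀ σ, σ ∈ H ↔ σ = 1 ∨ t ≤ W σ := fun σ => Iff.rfl
  have hW : negConjSum W = (t : ℂ) • negConjSum (fun τ => if τ ∈ H then 1 else 0) +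
      negConjSum (fun σ => max (W σ - t) 0) := by
    rw [← negConjSum_const_mul, ← negConjSum_add]
    refine negConjSum_congr fun σ hσ => ?_
    rcases hdich σ hσ with h | h
    · rw [if_neg (by rw [hH]; simp [hσ, h, ht]), h, max_eq_right (by linarith)]; simp
    · rw [if_pos ((hH σ).2 (Or.inr h)), max_eq_left (by linarith)]; ring
  rw [hW, negConjSum_indicator]
  refine IsNonnegRatCharacter.add (IsNonnegRatCharacter.smul ?_ ht.le) (ih _ ?_ _ ?_ ?_ ?_ rfl)
  · have := (isNonnegRatCharacter_induced_augChar H).smul (c := Nat.card H) (by positivity)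
    simpa using this
  · refine Finset.card_lt_card (Finset.ssubset_iff_of_subset ?_ |>.2 ⟨σ₀, ?_, ?_⟩)
    · intro σ
      simp only [Finset.mem_filter, Finset.mem_univ, true_and]
      rintro ⟨h1, h2⟩
      refine ⟨h1, fun h => h2 ?_⟩
      rw [h, max_eq_right (by linarith)]
    · simpa using hσ₀
    · simp [t]
  · exact fun σ => le_max_right _ _
  · exact fun σ => by rw [hinv]
  · intro σ τ h1 h2 h3
    have := hmul σ τ h1 h2 h3
    rcases min_le_iff.1 this with h | h
    · exact min_le_of_left_le (max_le_max_right _ (by linarith))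
    · exact min_le_of_right_le (max_le_max_right _ (by linarith))

end Characters

end Hurwitz

/-! ### Rooted trees and predecessor maps -/

namespace Hurwitz

namespace PlantedTree

/-- The edge v w of the tree is a bridge and v lies on the side of the root, so a shortest path from
the root to w crosses this edge and meets v before its end. -/
theorem Succ.dist_lt {T : PlantedTree} {v w : T.V} (h : T.Succ v w) :
    T.graph.dist T.root v < T.graph.dist T.root w := by
  classical
  obtain ⟨hadj, hr⟩ := h
  have hb : ¬ (T.graph.deleteEdges {s(v, w)}).Reachable v w := by
    have := SimpleGraph.isAcyclic_iff_forall_adj_isBridge.1 T.isTree.isAcyclic hadj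
    rw [SimpleGraph.isBridge_iff] at this
    exact this
  obtain ⟨q, hq⟩ := (T.isTree.connected T.root w).exists_walk_length_eq_dist
  rw [← hq]
  by_cases he : s(v, w) ∈ q.edges
  · have hv : v ∈ q.support := q.fst_mem_support_of_mem_edges he
    refine (SimpleGraph.dist_le (q.takeUntil v hv)).trans_lt ?_
    exact q.length_takeUntil_lt_length hv hadj.ne
  · exact absurd (hr.symm.trans ⟨q.toDeleteEdges {s(v, w)} (by
      rintro e h1 rfl; exact he h1)⟩) hb

/-- Induction from the leaves of a planted tree towards its root. -/
theorem induction_from_leaves (T : PlantedTree) {P : T.V → Prop}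
    (h : ∀ v, (∀ w, T.Succ v w → P w) → P v) (v : T.V) : P v := by
  let r : T.V → T.V → Prop := fun a b => T.graph.dist T.root b < T.graph.dist T.root a
  have : IsTrans T.V r := ⟨fun a b c h1 h2 => lt_trans h2 h1⟩
  have : Std.Irrefl r := ⟨fun a h => lt_irrefl _ h⟩
  induction v using (Finite.wellFounded_of_trans_of_irrefl r).induction with
  | _ v ih => exact h v fun w hw => ih w hw.dist_lt

theorem Edge.ext' {T : PlantedTree} {e e' : T.Edge} (h1 : e.source = e'.source)
    (h2 : e.target = e'.target) : e = e' :=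
  Subtype.ext (Prod.ext h1 h2)

end PlantedTree

/-- A tree given by the map sending each vertex to its predecessor, with a height function. -/
structure ParentMap (V : Type) where
  /-- The root. -/
  root : V
  /-- The predecessor of a vertex. -/
  par : V → V
  /-- A function that increases along the edges. -/
  ht : V → ℕ∞
  par_root : par root = root
  ht_par : ∀ v, v ≠ root → ht (par v) < ht v

namespace ParentMap

variable {V : Type} (P : ParentMap V)

/-- The underlying graph. -/
def graph : SimpleGraph V where
  Adj v w := (w ≠ P.root ∧ P.par w = v) ∨ (v ≠ P.root ∧ P.par v = w)
  symm := ⟨fun _ _ h => h.symm⟩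
  loopless := ⟨fun v h => by
    rcases h with ⟨h, h'⟩ | ⟨h, h'⟩ <;> exact absurd (P.ht_par v h) (by rw [h']; exact lt_irrefl _)⟩

theorem adj_par {w : V} (hw : w ≠ P.root) : P.graph.Adj (P.par w) w := Or.inl ⟨hw, rfl⟩

/-- `u` is `w` or a descendant of `w`. -/
def Desc (w u : V) : Prop := ∃ n : ℕ, P.par^[n] u = w

theorem ht_iterate_le (n : ℕ) (u : V) : P.ht (P.par^[n] u) ≤ P.ht u := by
  induction n with
  | zero => exact le_rfl
  | succ n ih =>
    rw [Function.iterate_succ_apply']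
    by_cases h : P.par^[n] u = P.root
    · rw [h, P.par_root, ← h]; exact ih
    · exact (P.ht_par _ h).le.trans ih

theorem not_desc_root {w : V} (hw : w ≠ P.root) : ¬ P.Desc w P.root := by
  rintro ⟨n, hn⟩
  rw [Function.iterate_fixed P.par_root] at hn
  exact hw hn.symm

theorem not_desc_par {w : V} (hw : w ≠ P.root) : ¬ P.Desc w (P.par w) := by
  rintro ⟨n, hn⟩
  have := P.ht_iterate_le n (P.par w)
  rw [hn] at this
  exact absurd (P.ht_par w hw) (not_lt.2 this)

theorem desc_refl (w : V) : P.Desc w w := ⟨0, rfl⟩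

/-- The edge from `par w` to w is the only one that joins a descendant of w to a vertex that is not
one. Deleting it separates the two sets; this gives both the absence of cycles and the orientation
of the edges. -/
theorem desc_iff_of_adj {w u u' : V}
    (h : (P.graph.deleteEdges {s(P.par w, w)}).Adj u u') : P.Desc w u ↔ P.Desc w u' := by
  have key : ∀ u, s(P.par u, u) ≠ s(P.par w, w) → (P.Desc w (P.par u) ↔ P.Desc w u) := by
    intro u hu
    constructor
    · rintro ⟨n, hn⟩
      exact ⟨n + 1, hn⟩
    · rintro ⟨n, hn⟩
      cases n with
      | zero => obtain rfl : u = w := hn; exact absurd rfl hu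
      | succ n => exact ⟨n, hn⟩
  rw [SimpleGraph.deleteEdges_adj] at h
  obtain ⟨⟨h1, rfl⟩ | ⟨h1, rfl⟩, h2⟩ := h
  · exact key u' (by simpa using h2)
  · exact (key u (by rw [Sym2.eq_swap]; exact fun h => h2 (by simpa using h))).symm

theorem desc_iff_of_reachable {w u u' : V}
    (h : (P.graph.deleteEdges {s(P.par w, w)}).Reachable u u') : P.Desc w u ↔ P.Desc w u' := by
  obtain ⟨p⟩ := h
  induction p with
  | nil => rfl
  | cons h _ ih => exact (P.desc_iff_of_adj h).trans ih

/-- The chain of predecessors from v to the root cannot use the edge at w, since it would then pass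
through w. -/
theorem reachable_of_not_desc {w : V} (hw : w ≠ P.root) (v : V) (hv : ¬ P.Desc w v) :
    (P.graph.deleteEdges {s(P.par w, w)}).Reachable P.root v := by
  induction hx : P.ht v using WellFoundedLT.induction generalizing v with
  | _ x ih =>
  subst hx
  by_cases h : v = P.root
  · subst h; exact SimpleGraph.Reachable.refl _
  · refine (ih _ (P.ht_par v h) (P.par v) ?_ rfl).trans ?_
    · rintro ⟨n, hn⟩
      exact hv ⟨n + 1, hn⟩
    · refine SimpleGraph.Adj.reachable ?_
      rw [SimpleGraph.deleteEdges_adj]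
      refine ⟨P.adj_par h, fun he => ?_⟩
      rcases Sym2.eq_iff.1 (Set.mem_singleton_iff.1 he) with ⟨_, rfl⟩ | ⟨h1, h2⟩
      · exact hv (P.desc_refl _)
      · have h3 := P.ht_par v h
        have h4 := P.ht_par w hw
        rw [h1] at h3
        rw [← h2] at h4
        exact lt_asymm h3 h4

theorem connected : P.graph.Connected := by
  have hr : ∀ v, P.graph.Reachable P.root v := by
    intro v
    induction hx : P.ht v using WellFoundedLT.induction generalizing v with
    | _ x ih =>
    subst hx
    by_cases h : v = P.root
    · subst h; exact SimpleGraph.Reachable.refl _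
    · exact (ih _ (P.ht_par v h) (P.par v) rfl).trans (P.adj_par h).reachable
  have : Nonempty V := ⟨P.root⟩
  exact ⟨fun u v => (hr u).symm.trans (hr v)⟩

theorem isTree : P.graph.IsTree := by
  refine ⟨P.connected, SimpleGraph.isAcyclic_iff_forall_adj_isBridge.2 ?_⟩
  have key : ∀ w, w ≠ P.root →
      ¬ (P.graph.deleteEdges {s(P.par w, w)}).Reachable (P.par w) w := fun w hw h =>
    P.not_desc_par hw ((P.desc_iff_of_reachable h).2 (P.desc_refl w))
  rintro v w (⟨h, rfl⟩ | ⟨h, rfl⟩)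
  · rw [SimpleGraph.isBridge_iff]
    exact key w h
  · rw [Sym2.eq_swap, SimpleGraph.isBridge_iff]
    exact key v h

/-- The planted tree of a parent map with a unique vertex over the root. -/
abbrev toPlantedTree [Fintype V] (h : ∃! w, w ≠ P.root ∧ P.par w = P.root) : PlantedTree where
  V := V
  fintypeV := inferInstance
  graph := P.graph
  isTree := P.isTree
  root := P.root
  existsUnique_adj_root := by
    have : ∀ w, P.graph.Adj P.root w ↔ w ≠ P.root ∧ P.par w = P.root := fun w =>
      ⟨fun h => h.elim id fun h => absurd rfl h.1, Or.inl⟩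
    simpa only [this] using h

theorem succ_iff [Fintype V] (h : ∃! w, w ≠ P.root ∧ P.par w = P.root) (v w : V) :
    (P.toPlantedTree h).Succ v w ↔ w ≠ P.root ∧ P.par w = v := by
  constructor
  · rintro ⟨h1 | ⟨h1, rfl⟩, h2⟩
    · exact h1
    · exfalso
      change (P.graph.deleteEdges {s(v, P.par v)}).Reachable P.root v at h2
      rw [Sym2.eq_swap] at h2
      exact P.not_desc_root h1 ((P.desc_iff_of_reachable h2).2 (P.desc_refl v))
  · rintro ⟨h1, rfl⟩
    exact ⟨P.adj_par h1, P.reachable_of_not_desc h1 _ (P.not_desc_par h1)⟩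

end ParentMap

end Hurwitz

/-! ### Distances between fixed points, and depths of discs -/

namespace Hurwitz

/-- The fixed points of a finite group acting on a nonarchimedean open disc, with their mutual
distances (in terms of a valuation with `v p = e`). -/
structure FixedPointData (G : Type*) [Group G] (p : ℕ) (Δ : Type) [Fintype Δ]
    [DecidableEq Δ] [MulAction G Δ] where
  /-- The valuation of the difference of two points. -/
  d : Δ → Δ → ℕ∞
  /-- The valuation of `p`. -/
  e : ℕ
  e_pos : 0 < e
  nonempty : Nonempty Δ
  d_eq_top : ∀ x y, d x y = ⊤ ↔ x = y
  d_pos : ∀ x y, 0 < d x y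
  d_symm : ∀ x y, d x y = d y x
  d_ultra : ∀ x y z, min (d x y) (d y z) ≤ d x z
  d_smul : ∀ (g : G) x y, d (g • x) (g • y) = d x y
  stabilizer_ne_bot : ∀ y : Δ, MulAction.stabilizer G y ≠ ⊥
  isCyclic_stabilizer : ∀ y : Δ, IsCyclic (MulAction.stabilizer G y)
  -- Models the evaluation at x of σ(z) - z = unit · ∏ (z - y), the product over the fixed points y
  -- of σ.
  d_smul_self : ∀ σ : G, σ ≠ 1 → ∀ x, d x (σ • x) = ∑ y with σ • y = y, d x y
  -- The sums are Gauss valuations on the smallest disc containing c and c'. At a generic point x of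
  -- it, the inequality is the ultrametric one for x - στx = (x - σx) + (σx - στx).
  min_sum_le : ∀ σ τ : G, σ ≠ 1 → τ ≠ 1 → σ * τ ≠ 1 → ∀ c c',
    min (∑ y with σ • y = y, min (d c c') (d c y)) (∑ y with τ • y = y, min (d c c') (d c y)) ≤
      ∑ y with (σ * τ) • y = y, min (d c c') (d c y)
  -- The sum is v(ζ - 1), where ζ is the derivative of σ at y, a root of unity of order p^(i+1). In
  -- the next field ζ - 1 is a unit.
  sum_of_orderOf : ∀ σ : G, ∀ y, σ • y = y → ∀ i, orderOf σ = p ^ (i + 1) →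
    ((p ^ i * (p - 1) : ℕ) : ℕ∞) * ∑ x with σ • x = x ∧ x ≠ y, d y x = e
  sum_of_orderOf_ne : ∀ σ : G, ∀ y, σ • y = y → (∀ i, orderOf σ ≠ p ^ i) →
    ∑ x with σ • x = x ∧ x ≠ y, d y x = 0

namespace FixedPointData

variable {G : Type*} [Group G] {p : ℕ} {Δ : Type} [Fintype Δ] [DecidableEq Δ] [MulAction G Δ]
  (D : FixedPointData G p Δ)

theorem d_self (x : Δ) : D.d x x = ⊤ := (D.d_eq_top x x).2 rfl

theorem le_d_trans {r : ℕ∞} {x y z : Δ} (h1 : r ≤ D.d x y) (h2 : r ≤ D.d y z) : r ≤ D.d x z :=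
  (le_min h1 h2).trans (D.d_ultra x y z)

/-- Every point of a disc is a center of it. Distances are valuations: the disc of radius r around c
is {y | r ≤ d c y}, so larger r means a smaller disc, r = 0 gives everything and r = ⊤ a single
point. -/
theorem le_d_iff {r : ℕ∞} {c c' : Δ} (h : r ≤ D.d c c') (y : Δ) : r ≤ D.d c y ↔ r ≤ D.d c' y :=
  ⟨D.le_d_trans (D.d_symm c c' ▸ h), D.le_d_trans h⟩

theorem d_eq_of_lt {r : ℕ∞} {c c' : Δ} (h : r ≤ D.d c c') {y : Δ} (hy : D.d c y < r) :
    D.d c' y = D.d c y := by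
  refine le_antisymm ?_ (D.le_d_trans (hy.le.trans (D.d_symm c c' ▸ h)) le_rfl)
  by_contra hlt
  rw [not_le] at hlt
  have h1 := (lt_min (hy.trans_le h) hlt).trans_le (D.d_ultra c c' y)
  exact lt_irrefl _ h1

/-- The radii of the discs around `c`, including `0`. -/
noncomputable def radii (c : Δ) : Finset ℕ∞ := insert 0 (Finset.univ.image (D.d c))

theorem zero_mem_radii (c : Δ) : 0 ∈ D.radii c := Finset.mem_insert_self _ _

theorem d_mem_radii (c y : Δ) : D.d c y ∈ D.radii c :=
  Finset.mem_insert_of_mem (Finset.mem_image_of_mem _ (Finset.mem_univ _))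

theorem top_mem_radii (c : Δ) : ⊤ ∈ D.radii c := D.d_self c ▸ D.d_mem_radii c c

theorem mem_radii {c : Δ} {r : ℕ∞} : r ∈ D.radii c ↔ r = 0 ∨ ∃ y, D.d c y = r := by
  simp [radii]

theorem mem_radii_of_le {r : ℕ∞} {c c' : Δ} (h : r ≤ D.d c c') (hr : r ∈ D.radii c) :
    r ∈ D.radii c' := by
  rcases D.mem_radii.1 hr with rfl | ⟨y, rfl⟩
  · exact D.zero_mem_radii _
  -- If y is closer to c' than to c, then c itself is at distance r from c'.
  · rcases ((D.le_d_iff h y).1 le_rfl).eq_or_lt with h1 | h1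
    · rw [h1]; exact D.d_mem_radii _ _
    · refine D.mem_radii.2 (Or.inr ⟨c, ?_⟩)
      rw [D.d_symm]
      refine le_antisymm ?_ h
      by_contra hlt
      rw [not_le] at hlt
      exact lt_irrefl _ ((lt_min hlt h1).trans_le (D.d_ultra c c' y))

theorem radii_smul (g : G) (c : Δ) : D.radii (g • c) = D.radii c := by
  ext r
  rw [mem_radii, mem_radii]
  refine or_congr Iff.rfl ⟨?_, ?_⟩
  · rintro ⟨y, rfl⟩
    exact ⟨g⁻¹ • y, by rw [← D.d_smul g, smul_inv_smul]⟩
  · rintro ⟨y, rfl⟩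
    exact ⟨g • y, D.d_smul g _ _⟩

/-- The largest radius around `c` that is smaller than `r`. -/
noncomputable def prev (c : Δ) (r : ℕ∞) : ℕ∞ := ((D.radii c).filter fun s => s < r).sup id

theorem prev_mem_and_lt {c : Δ} {r : ℕ∞} (hr : r ≠ 0) : D.prev c r ∈ D.radii c ∧ D.prev c r < r := by
  have hne : ((D.radii c).filter fun s => s < r).Nonempty :=
    ⟨0, Finset.mem_filter.2 ⟨D.zero_mem_radii c, pos_iff_ne_zero.2 hr⟩⟩
  obtain ⟨x, hx, hx'⟩ := Finset.exists_mem_eq_sup _ hne id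
  have hp : D.prev c r = x := hx'
  rw [hp]
  rw [Finset.mem_filter] at hx
  exact hx

theorem prev_mem (c : Δ) (r : ℕ∞) : D.prev c r ∈ D.radii c := by
  rcases eq_or_ne r 0 with rfl | h
  · have : D.prev c 0 = 0 := by simp [prev]
    rw [this]; exact D.zero_mem_radii c
  · exact (D.prev_mem_and_lt h).1

theorem prev_zero (c : Δ) : D.prev c 0 = 0 := by simp [prev]

theorem le_prev {c : Δ} {r s : ℕ∞} (hs : s ∈ D.radii c) (h : s < r) : s ≤ D.prev c r :=
  Finset.le_sup (f := id) (Finset.mem_filter.2 ⟨hs, h⟩)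

theorem prev_le (c : Δ) (r : ℕ∞) : D.prev c r ≤ r := by
  rcases eq_or_ne r 0 with rfl | h
  · rw [prev_zero]
  · exact (D.prev_mem_and_lt h).2.le

theorem prev_congr {r : ℕ∞} {c c' : Δ} (h : r ≤ D.d c c') : D.prev c r = D.prev c' r := by
  unfold prev
  congr 1
  ext s
  simp only [Finset.mem_filter]
  refine and_congr_left fun hs => ⟨D.mem_radii_of_le (hs.le.trans h), D.mem_radii_of_le ?_⟩
  rw [D.d_symm]; exact hs.le.trans h

theorem prev_smul (g : G) (c : Δ) (r : ℕ∞) : D.prev (g • c) r = D.prev c r := by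
  rw [prev, prev, radii_smul]

theorem exists_next {c : Δ} {r : ℕ∞} (hr : r ∈ D.radii c) (h : r ≠ ⊤) :
    ∃ s ∈ D.radii c, r < s ∧ D.prev c s = r := by
  have hne : ((D.radii c).filter fun s => r < s).Nonempty :=
    ⟨⊤, Finset.mem_filter.2 ⟨D.top_mem_radii c, lt_top_iff_ne_top.2 h⟩⟩
  obtain ⟨s, hs, hmin⟩ := Finset.exists_min_image _ id hne
  obtain ⟨hs1, hs2⟩ := Finset.mem_filter.1 hs
  refine ⟨s, hs1, hs2, le_antisymm ?_ (D.le_prev hr hs2)⟩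
  have h3 := D.prev_mem_and_lt (c := c) (r := s) (ne_bot_of_gt hs2)
  by_contra hlt
  exact absurd h3.2 (not_lt.2 (hmin _ (Finset.mem_filter.2 ⟨h3.1, not_le.1 hlt⟩)))

/-- The stabilizer of the disc of radius `r` around `c`. -/
def stab (c : Δ) (r : ℕ∞) : Subgroup G where
  carrier := {g | r ≤ D.d c (g • c)}
  one_mem' := by simp [d_self]
  mul_mem' {g h} hg hh := by
    refine D.le_d_trans hg ?_
    rw [mul_smul, D.d_smul]; exact hh
  inv_mem' {g} hg := by
    change r ≤ _
    rw [← D.d_smul g, smul_inv_smul, D.d_symm]; exact hg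

theorem mem_stab {c : Δ} {r : ℕ∞} {g : G} : g ∈ D.stab c r ↔ r ≤ D.d c (g • c) := Iff.rfl

theorem stab_mono (c : Δ) {r s : ℕ∞} (h : r ≤ s) : D.stab c s ≤ D.stab c r :=
  fun _ hg => h.trans hg

theorem stab_top (c : Δ) : D.stab c ⊤ = MulAction.stabilizer G c := by
  ext g
  rw [mem_stab, top_le_iff, d_eq_top, MulAction.mem_stabilizer_iff, eq_comm]

theorem mem_stab_of_smul_eq {c y : Δ} {r : ℕ∞} {τ : G} (hy : τ • y = y) (h : r ≤ D.d c y) :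
    τ ∈ D.stab c r := by
  refine D.le_d_trans h ?_
  rw [← hy, D.d_smul, D.d_symm]; exact h

/-- The element g carries the disc around c' onto the disc around c, hence conjugates one stabilizer
into the other. -/
theorem mem_stab_conj_iff {c c' : Δ} {r : ℕ∞} {g : G} (h : r ≤ D.d c (g • c')) (τ : G) :
    g * τ * g⁻¹ ∈ D.stab c r ↔ τ ∈ D.stab c' r := by
  have h2 : r ≤ D.d ((g * τ * g⁻¹) • c) ((g * τ * g⁻¹) • g • c') := by rwa [D.d_smul]
  have h3 : (g * τ * g⁻¹) • g • c' = g • τ • c' := by simp [mul_smul]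
  rw [h3] at h2
  rw [mem_stab, mem_stab, ← D.d_smul g c', D.le_d_iff h, D.d_symm, D.le_d_iff h2, D.d_symm]

theorem card_stab_eq {c c' : Δ} {r : ℕ∞} {g : G} (h : r ≤ D.d c (g • c')) :
    Nat.card (D.stab c r : Subgroup G) = Nat.card (D.stab c' r : Subgroup G) :=
  Nat.card_congr
    { toFun := fun x => ⟨g⁻¹ * x * g, (D.mem_stab_conj_iff h _).1 (by simp [mul_assoc])⟩
      invFun := fun x => ⟨g * x * g⁻¹, (D.mem_stab_conj_iff h _).2 x.2⟩
      left_inv := fun x => by ext; simp [mul_assoc]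
      right_inv := fun x => by ext; simp [mul_assoc] }

/-- The number of fixed points of `τ` in the disc of radius `r` around `c`. -/
def numFix (c : Δ) (r : ℕ∞) (τ : G) : ℕ := (Finset.univ.filter fun y => τ • y = y ∧ r ≤ D.d c y).card

open Classical in
/-- The depth of the action of `τ` on the boundary of the disc of radius `r` around `c`. -/
noncomputable def discDepth (c : Δ) (r : ℕ∞) (τ : G) : ℚ :=
  if τ ∈ D.stab c r then
    -- For finite r this is the sum of min r (d c y) over the fixed points y of τ, minus r. At r = ⊤
    -- the default `⊤.toNat = 0` removes the last term, where c is the only fixed point in the disc.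
    ∑ y with τ • y = y ∧ D.d c y < r, ((D.d c y).toNat : ℚ) + r.toNat * (D.numFix c r τ - 1)
  else 0

theorem _root_.Hurwitz.smul_conj_iff {G Δ : Type*} [Group G] [MulAction G Δ] (g τ : G) (y : Δ) : (g * τ * g⁻¹) • g • y = g • y ↔ τ • y = y := by
  simp [mul_smul]

theorem numFix_conj {c c' : Δ} {r : ℕ∞} {g : G} (h : r ≤ D.d c (g • c')) (τ : G) :
    D.numFix c r (g * τ * g⁻¹) = D.numFix c' r τ := by
  unfold numFix
  refine (Finset.card_equiv (MulAction.toPerm g) fun y => ?_).symm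
  simp only [Finset.mem_filter, Finset.mem_univ, true_and, MulAction.toPerm_apply, smul_conj_iff]
  rw [D.le_d_iff h, D.d_smul]

theorem discDepth_conj {c c' : Δ} {r : ℕ∞} {g : G} (h : r ≤ D.d c (g • c')) (τ : G) :
    D.discDepth c r (g * τ * g⁻¹) = D.discDepth c' r τ := by
  unfold discDepth
  rw [D.numFix_conj h]
  have hs : ∑ y with (g * τ * g⁻¹) • y = y ∧ D.d c y < r, ((D.d c y).toNat : ℚ) =
      ∑ y with τ • y = y ∧ D.d c' y < r, ((D.d c' y).toNat : ℚ) := by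
    refine (Finset.sum_equiv (MulAction.toPerm g) (fun y => ?_) fun y hy => ?_).symm
    · simp only [Finset.mem_filter, Finset.mem_univ, true_and, MulAction.toPerm_apply,
        smul_conj_iff]
      rw [← not_le, ← not_le, D.le_d_iff h, D.d_smul]
    · simp only [Finset.mem_filter, Finset.mem_univ, true_and] at hy
      have h' : r ≤ D.d (g • c') c := D.d_symm c _ ▸ h
      have := D.d_eq_of_lt h' (y := g • y) (by rw [D.d_smul]; exact hy.2)
      rw [MulAction.toPerm_apply, this, D.d_smul]
  rw [hs]
  by_cases h1 : τ ∈ D.stab c' r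
  · rw [if_pos h1, if_pos ((D.mem_stab_conj_iff h τ).2 h1)]
  · rw [if_neg h1, if_neg (mt (D.mem_stab_conj_iff h τ).1 h1)]

theorem sum_d_eq {s : Finset Δ} {c : Δ} (h : ∀ y ∈ s, D.d c y ≠ ⊤) :
    ∑ y ∈ s, D.d c y = ((∑ y ∈ s, (D.d c y).toNat : ℕ) : ℕ∞) := by
  push_cast
  exact Finset.sum_congr rfl fun y hy => (ENat.natCast_toNat (h y hy)).symm

theorem discDepth_of_notMem {c : Δ} {r : ℕ∞} {τ : G} (h : τ ∉ D.stab c r) :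
    D.discDepth c r τ = 0 := if_neg h

theorem numFix_of_notMem {c : Δ} {r : ℕ∞} {τ : G} (h : τ ∉ D.stab c r) : D.numFix c r τ = 0 := by
  unfold numFix
  rw [Finset.card_eq_zero, Finset.filter_eq_empty_iff]
  rintro y - ⟨h1, h2⟩
  exact h (D.mem_stab_of_smul_eq h1 h2)

theorem numFix_top {c : Δ} {τ : G} (h : τ ∈ D.stab c ⊤) : D.numFix c ⊤ τ = 1 := by
  unfold numFix
  rw [Finset.card_eq_one]
  refine ⟨c, ?_⟩
  ext y
  simp only [Finset.mem_filter, Finset.mem_univ, true_and, top_le_iff, d_eq_top,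
    Finset.mem_singleton]
  rw [stab_top, MulAction.mem_stabilizer_iff] at h
  constructor
  · exact fun h => h.2.symm
  · rintro rfl; exact ⟨h, rfl⟩

/-- The thickness (up to a constant) of the annulus below the disc of radius `r` around `c`. -/
noncomputable def width (c : Δ) (r : ℕ∞) : ℚ :=
  -- The edge to a leaf gets thickness 0, although the corresponding punctured disc is infinitely
  -- thick.
  if r = ⊤ then 0 else (r.toNat : ℚ) - (D.prev c r).toNat

theorem width_nonneg (c : Δ) (r : ℕ∞) : 0 ≤ D.width c r := by
  unfold width
  split_ifs with h
  · exact le_rfl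
  · rw [sub_nonneg, Nat.cast_le]
    exact ENat.toNat_le_toNat (D.prev_le c r) h

theorem width_eq_zero_iff {c : Δ} {r : ℕ∞} (hr : r ≠ 0) : D.width c r = 0 ↔ r = ⊤ := by
  unfold width
  split_ifs with h
  · simp [h]
  · simp only [h, iff_false, sub_eq_zero, Nat.cast_inj]
    intro h1
    have h2 := (D.prev_mem_and_lt (c := c) hr).2
    refine h2.ne ?_
    calc D.prev c r = ((D.prev c r).toNat : ℕ∞) := (ENat.natCast_toNat h2.ne_top).symm
      _ = (r.toNat : ℕ∞) := by rw [h1]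
      _ = r := ENat.natCast_toNat h

-- The source of (H4). Between two consecutive discs the Gauss valuation is linear in the radius,
-- with slope the number of fixed points in the smaller disc; subtracting the radius lowers the
-- slope by one. Fixed points at distance exactly `prev c r` pass from the inner count to the outer
-- sum without changing the value.
open Classical in
theorem discDepth_eq_add {c : Δ} {r : ℕ∞} (hr : r ≠ 0) {τ : G} (hτ : τ ≠ 1) :
    D.discDepth c r τ = D.discDepth c (D.prev c r) τ +
      D.width c r * (D.numFix c r τ - if τ ∈ D.stab c r then 1 else 0) := by
  set r' := D.prev c r
  obtain ⟨hr'mem, hr'⟩ := D.prev_mem_and_lt (c := c) hr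
  change r' < r at hr'
  have hdich : ∀ y, D.d c y < r → D.d c y ≤ r' := fun y hy => D.le_prev (D.d_mem_radii c y) hy
  have hsplit : ∑ y with τ • y = y ∧ D.d c y < r, ((D.d c y).toNat : ℚ) =
      ∑ y with τ • y = y ∧ D.d c y < r', ((D.d c y).toNat : ℚ) +
        (Finset.univ.filter fun y => τ • y = y ∧ D.d c y = r').card * r'.toNat := by
    rw [← Finset.sum_filter_add_sum_filter_not _ (fun y => D.d c y < r'), Finset.filter_filter,
      Finset.filter_filter]
    congr 1
    · refine Finset.sum_congr (Finset.filter_congr fun y _ => ?_) fun _ _ => rfl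
      exact ⟨fun h => ⟨h.1.1, h.2⟩, fun h => ⟨⟨h.1, h.2.trans hr'⟩, h.2⟩⟩
    · rw [← nsmul_eq_mul]
      have : (Finset.univ.filter fun y => (τ • y = y ∧ D.d c y < r) ∧ ¬ D.d c y < r') =
          Finset.univ.filter fun y => τ • y = y ∧ D.d c y = r' := by
        refine Finset.filter_congr fun y _ => ?_
        exact ⟨fun h => ⟨h.1.1, le_antisymm (hdich y h.1.2) (not_lt.1 h.2)⟩,
          fun h => ⟨⟨h.1, h.2.trans_lt hr'⟩, h.2.not_lt⟩⟩
      rw [this]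
      refine Finset.sum_eq_card_nsmul fun y hy => ?_
      rw [(Finset.mem_filter.1 hy).2.2]
  have hnum : D.numFix c r' τ = D.numFix c r τ +
      (Finset.univ.filter fun y => τ • y = y ∧ D.d c y = r').card := by
    unfold numFix
    rw [← Finset.card_filter_add_card_filter_not (s := Finset.univ.filter _)
      (fun y => r ≤ D.d c y), Finset.filter_filter, Finset.filter_filter]
    congr 2
    · refine Finset.filter_congr fun y _ => ?_
      exact ⟨fun h => ⟨h.1.1, h.2⟩, fun h => ⟨⟨h.1, hr'.le.trans h.2⟩, h.2⟩⟩
    · refine Finset.filter_congr fun y _ => ?_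
      exact ⟨fun h => ⟨h.1.1, le_antisymm (hdich y (not_le.1 h.2)) h.1.2⟩,
        fun h => ⟨⟨h.1, h.2.ge⟩, not_le.2 (h.2.trans_lt hr')⟩⟩
  by_cases hs : τ ∈ D.stab c r
  · have hs' : τ ∈ D.stab c r' := D.stab_mono c hr'.le hs
    rw [discDepth, if_pos hs, discDepth, if_pos hs', if_pos hs, hsplit, hnum]
    unfold width
    split_ifs with ht
    · subst ht
      rw [D.numFix_top hs]
      simp
      ring
    · push_cast
      ring
  · rw [D.discDepth_of_notMem hs, if_neg hs, D.numFix_of_notMem hs, discDepth]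
    split_ifs with hs'
    · rw [D.numFix_of_notMem hs, zero_add] at hnum
      -- Here τ preserves the larger disc but not the smaller. It has no fixed point in the smaller
      -- one, and it moves c by exactly r', so `d_smul_self` makes the depth at r' vanish.
      have hlt : D.d c (τ • c) < r := not_le.1 hs
      have hd : D.d c (τ • c) = r' := le_antisymm (hdich _ hlt) hs'
      have hfin : ∀ y ∈ Finset.univ.filter fun y => τ • y = y, D.d c y < r := by
        intro y hy
        by_contra h
        exact hs (D.mem_stab_of_smul_eq (Finset.mem_filter.1 hy).2 (not_lt.1 h))
      have h1 := D.d_smul_self τ hτ c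
      rw [hd, D.sum_d_eq fun y hy => (hfin y hy).ne_top] at h1
      have h2 : (r'.toNat : ℚ) = ∑ y with τ • y = y ∧ D.d c y < r, ((D.d c y).toNat : ℚ) := by
        rw [h1, ENat.toNat_natCast, Nat.cast_sum]
        have h3 : (Finset.univ.filter fun y => τ • y = y) =
            Finset.univ.filter fun y => τ • y = y ∧ D.d c y < r :=
          Finset.filter_congr fun y _ => ⟨fun h => ⟨h, hfin y (by simp [h])⟩, fun h => h.1⟩
        rw [h3]
      rw [hsplit] at h2
      rw [hnum]
      simp only [Nat.cast_zero, sub_zero, mul_zero, add_zero]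
      linarith
    · simp

/-- Up to the constant `r`, this is the Gauss valuation of `τ z - z` on a disc. -/
noncomputable def gauss (c : Δ) (r : ℕ∞) (τ : G) : ℕ∞ := ∑ y with τ • y = y, min r (D.d c y)

/-- If τ does not preserve the disc, it has no fixed point there and its Gauss valuation is d c (τ •
c) < r, so that truncated subtraction gives the required 0. If it does, the Gauss valuation is at
least r. -/
theorem discDepth_eq_gauss {c : Δ} {r : ℕ∞} (hr : r ≠ ⊤) {τ : G} (hτ : τ ≠ 1) :
    D.discDepth c r τ = ((D.gauss c r τ - r).toNat : ℚ) := by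
  obtain ⟨r, rfl⟩ := ENat.ne_top_iff_exists.1 hr
  have hV : D.gauss c r τ = ((∑ y with τ • y = y ∧ D.d c y < r, (D.d c y).toNat +
      D.numFix c r τ * r : ℕ) : ℕ∞) := by
    unfold gauss numFix
    rw [← Finset.sum_filter_add_sum_filter_not _ (fun y => D.d c y < r), Finset.filter_filter,
      Finset.filter_filter, Nat.cast_add, ← D.sum_d_eq]
    · congr 1
      · exact Finset.sum_congr rfl fun y hy => min_eq_right (Finset.mem_filter.1 hy).2.2.le
      · simp only [not_lt]
        rw [Finset.sum_eq_card_nsmul fun y hy => min_eq_left (Finset.mem_filter.1 hy).2.2]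
        rw [nsmul_eq_mul]
        push_cast; rfl
    · exact fun y hy => ((Finset.mem_filter.1 hy).2.2).ne_top
  have hsum0 : D.numFix c r τ = 0 → D.gauss c r τ = D.d c (τ • c) := by
    intro h0
    rw [D.d_smul_self τ hτ, gauss]
    refine Finset.sum_congr rfl fun y hy => min_eq_right ?_
    unfold numFix at h0
    rw [Finset.card_eq_zero, Finset.filter_eq_empty_iff] at h0
    by_contra h
    exact h0 (Finset.mem_univ y) ⟨(Finset.mem_filter.1 hy).2, (not_le.1 h).le⟩
  by_cases hs : τ ∈ D.stab c r
  · rw [discDepth, if_pos hs]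
    have hle : r ≤ D.gauss c r τ := by
      rcases Nat.eq_zero_or_pos (D.numFix c r τ) with h0 | h0
      · rw [hsum0 h0]; exact hs
      · rw [hV, Nat.cast_le]
        exact (Nat.le_mul_of_pos_left r h0).trans (Nat.le_add_left _ _)
    rw [hV, Nat.cast_le] at hle
    rw [hV, ← ENat.natCast_sub, ENat.toNat_natCast, ENat.toNat_natCast, Nat.cast_sub hle]
    push_cast
    ring
  · rw [D.discDepth_of_notMem hs, hsum0 (D.numFix_of_notMem hs),
      tsub_eq_zero_of_le (not_le.1 hs).le]
    simp

theorem gauss_ne_top {c : Δ} {r : ℕ∞} (hr : r ≠ ⊤) (τ : G) : D.gauss c r τ ≠ ⊤ := by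
  unfold gauss
  rw [ne_eq, ENat.sum_eq_top]
  rintro ⟨y, -, hy⟩
  exact hr (top_le_iff.1 (hy ▸ min_le_left _ _))

variable [Fintype G]

/-- For finite r, `min_sum_le` makes the Gauss valuation, and then its truncated difference with r,
ultrametric in τ. That inequality is only available at radii of the form d c y, with r = 0 trivial.
-/
theorem isNonnegRatCharacter_discDepth {c : Δ} {r : ℕ∞} (hr : r ∈ D.radii c) :
    IsNonnegRatCharacter (negConjSum (D.discDepth c r : G → ℚ)) := by
  have key : ∀ r ∈ D.radii c, r ≠ ⊤ →
      IsNonnegRatCharacter (negConjSum (D.discDepth c r : G → ℚ)) := by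
    intro r hr htop
    rw [negConjSum_congr fun σ hσ => D.discDepth_eq_gauss htop hσ]
    refine isNonnegRatCharacter_negConjSum _ (fun σ => by positivity) (fun σ => ?_) ?_
    · have : D.gauss c r σ⁻¹ = D.gauss c r σ := by
        unfold gauss
        refine Finset.sum_congr (Finset.filter_congr fun y _ => ?_) fun _ _ => rfl
        rw [inv_smul_eq_iff, eq_comm]
      rw [this]
    · intro σ τ h1 h2 h3
      have : min (D.gauss c r σ) (D.gauss c r τ) ≤ D.gauss c r (σ * τ) := by
        rcases D.mem_radii.1 hr with rfl | ⟨y, rfl⟩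
        · simp [gauss]
        · exact D.min_sum_le σ τ h1 h2 h3 c y
      have hne : D.gauss c r (σ * τ) - r ≠ ⊤ :=
        ne_top_of_le_ne_top (D.gauss_ne_top htop _) tsub_le_self
      rcases min_le_iff.1 this with h | h
      · refine min_le_of_left_le (Nat.cast_le.2 (ENat.toNat_le_toNat (tsub_le_tsub_right h _) hne))
      · refine min_le_of_right_le (Nat.cast_le.2 (ENat.toNat_le_toNat (tsub_le_tsub_right h _) hne))
  by_cases htop : r = ⊤
  · subst htop
    -- As the width at ⊤ is 0, a leaf has the depth of its predecessor, whose radius is finite.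
    rw [negConjSum_congr (W' := D.discDepth c (D.prev c ⊤)) fun σ hσ => by
      rw [D.discDepth_eq_add (by simp) hσ]; simp [width]]
    exact key _ (D.prev_mem c _) (D.prev_mem_and_lt (by simp)).2.ne
  · exact key r hr htop

end FixedPointData

end Hurwitz

/-! ### The Bertin obstruction -/

namespace Hurwitz

section Bertin

variable {G : Type*} [Group G] [Fintype G]

-- The condition x⁻¹ σ x ∈ H means that σ fixes the coset x H, and each coset has |H|
-- representatives.
open Classical in
theorem card_conj_mem_eq (H : Subgroup G) (σ : G) :
    (Finset.univ.filter fun x : G => x⁻¹ * σ * x ∈ H).card =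
      Nat.card H * Nat.card (MulAction.fixedBy (G ⧸ H) σ) := by
  have h1 : ((QuotientGroup.mk : G → G ⧸ H) ⁻¹' MulAction.fixedBy (G ⧸ H) σ) =
      {x : G | x⁻¹ * σ * x ∈ H} := by
    ext x
    simp only [Set.mem_preimage, MulAction.mem_fixedBy, Set.mem_ofPred_eq]
    rw [eq_comm, MulAction.Quotient.smul_mk, QuotientGroup.eq, smul_eq_mul, mul_assoc]
  rw [← Nat.card_prod, ← Nat.card_congr
    (QuotientGroup.preimageMkEquivSubgroupProdSet H (MulAction.fixedBy (G ⧸ H) σ)), h1]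
  simp [Fintype.card_subtype]

open Classical in
/-- `u_H^* = r_G - χ_{G/H}`. -/
theorem induced_augChar_eq_sub (H : Subgroup G) (σ : G) :
    induced H (augChar H) σ =
      regularChar G σ - (Nat.card (MulAction.fixedBy (G ⧸ H) σ) : ℂ) := by
  have hH : (Nat.card H : ℂ) ≠ 0 := by simp
  have hfix : (Nat.card (MulAction.fixedBy (G ⧸ H) σ) : ℂ) =
      (Nat.card H : ℂ)⁻¹ * ∑ x : G, if x⁻¹ * σ * x ∈ H then 1 else 0 := by
    rw [Finset.sum_boole, card_conj_mem_eq, Nat.cast_mul, inv_mul_cancel_left₀ hH]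
  by_cases hσ : σ = 1
  · subst hσ
    rw [hfix]
    simp only [induced, augChar, regularChar]
    simp
    field_simp
  · rw [induced_augChar_of_ne_one H hσ, hfix, regularChar, if_neg hσ, zero_sub]

/-- Unrolling (H3) up to the leaves leaves only characters u_{G_b}^*. How often a given leaf occurs
is irrelevant, so a multiset suffices. -/
theorem HurwitzTree.exists_artin_eq_sum {p : ℕ} (T : HurwitzTree G p) (e : T.Edge) :
    ∃ s : Multiset T.V, (∀ b ∈ s, T.IsLeaf b) ∧
      T.artin e = (s.map fun b => induced (T.grp b) (augChar (T.grp b))).sum := by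
  classical
  suffices h : ∀ v, ∀ e : T.Edge, e.target = v → ∃ s : Multiset T.V, (∀ b ∈ s, T.IsLeaf b) ∧
      T.artin e = (s.map fun b => induced (T.grp b) (augChar (T.grp b))).sum from h _ e rfl
  intro v
  induction v using T.induction_from_leaves with
  | h v ih =>
  rintro e rfl
  by_cases hl : T.IsLeaf e.target
  · exact ⟨{e.target}, by simpa using hl, by simp [T.artin_leaf e hl]⟩
  · have : ∀ e' : {e' : T.Edge // e'.source = e.target}, ∃ s : Multiset T.V,
        (∀ b ∈ s, T.IsLeaf b) ∧
        T.artin e' = (s.map fun b => induced (T.grp b) (augChar (T.grp b))).sum := fun ⟨e', he'⟩ =>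
      ih (PlantedTree.Edge.target e') (he' ▸ e'.2) e' rfl
    choose s hs1 hs2 using this
    refine ⟨∑ e', s e', fun b hb => ?_, ?_⟩
    · obtain ⟨e', -, he'⟩ := Multiset.mem_sum.1 hb
      exact hs1 e' b he'
    · rw [T.artin_eq_sum e hl, Finset.sum_subtype (p := fun e' => e'.source = e.target) _ (by simp)
        (fun e' => T.artin e')]
      rw [← Multiset.coe_mapAddMonoidHom, map_sum, ← Multiset.coe_sumAddMonoidHom, map_sum]
      exact Finset.sum_congr rfl fun e' _ => hs2 e'

end Bertin

theorem isCyclic_stabilizer_quotient {G : Type*} [Group G] (H : Subgroup G) (hH : IsCyclic H)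
    (y : G ⧸ H) : IsCyclic (MulAction.stabilizer G y) := by
  obtain ⟨g, rfl⟩ := QuotientGroup.mk_surjective y
  have h1 : (QuotientGroup.mk g : G ⧸ H) = g • (QuotientGroup.mk 1 : G ⧸ H) := by
    simp [MulAction.Quotient.smul_mk]
  have e := MulAction.stabilizerEquivStabilizer (G := G) h1
  rw [MulAction.stabilizer_quotient] at e
  exact isCyclic_of_surjective e e.surjective

/-- Each entry b of the multiset contributes r_G - χ_{G/G_b}, hence one orbit G/G_b of Δ, and the
stabilizers in it are conjugates of the cyclic group G_b. -/
theorem bertinObstructionVanishes_of_hurwitzTree {G : Type uG} {k : Type uk} [Group G] [Fintype G]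
    [Field k] (φ : G →* (PowerSeries k ≃ₐ[k] PowerSeries k)) {p : ℕ} (T : HurwitzTree G p)
    (hT : T.artinChar = artinCharacter φ) : BertinObstructionVanishes φ := by
  classical
  obtain ⟨s, hs, hsum⟩ := T.exists_artin_eq_sum T.trunk
  obtain ⟨l, rfl⟩ := Quot.exists_rep s
  let ι := Fin l.length
  let b : ι → T.V := fun i => l[i.1]
  have hb : ∀ i, T.IsLeaf (b i) := fun i => hs _ (List.getElem_mem i.2)
  have hart : artinCharacter φ = ∑ i : ι, induced (T.grp (b i)) (augChar (T.grp (b i))) := by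
    rw [← hT, HurwitzTree.artinChar, hsum]
    exact (Fin.sum_univ_fun_getElem l fun b => induced (T.grp b) (augChar (T.grp b))).symm
  refine ⟨Σ i : ι, G ⧸ T.grp (b i), inferInstance, inferInstance, ?_, fun σ => ?_⟩
  · rintro ⟨i, y⟩
    have h1 : MulAction.stabilizer G (⟨i, y⟩ : Σ i : ι, G ⧸ T.grp (b i)) =
        MulAction.stabilizer G y := by
      ext g
      simp [MulAction.mem_stabilizer_iff, Sigma.smul_mk]
    rw [h1]
    exact isCyclic_stabilizer_quotient _ (T.grp_leaf _ (hb i)).2 y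
  · have horb : Nat.card (MulAction.orbitRel.Quotient G (Σ i : ι, G ⧸ T.grp (b i))) =
        Nat.card ι := by
      refine Nat.card_congr (Equiv.ofBijective (Quotient.lift (fun x => x.1) ?_) ⟨?_, ?_⟩)
      · rintro _ ⟨i, y⟩ ⟨g, rfl⟩
        rfl
      · rintro ⟨i, x⟩ ⟨j, y⟩ (rfl : i = j)
        obtain ⟨g, rfl⟩ := MulAction.exists_smul_eq G y x
        exact Quotient.sound ⟨g, rfl⟩
      · exact fun i => ⟨Quotient.mk _ ⟨i, QuotientGroup.mk 1⟩, rfl⟩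
    have hfix : Nat.card (MulAction.fixedBy (Σ i : ι, G ⧸ T.grp (b i)) σ) =
        ∑ i, Nat.card (MulAction.fixedBy (G ⧸ T.grp (b i)) σ) := by
      rw [← Nat.card_sigma]
      refine Nat.card_congr
        { toFun := fun x => ⟨x.1.1, x.1.2, ?_⟩
          invFun := fun x => ⟨⟨x.1, x.2.1⟩, ?_⟩
          left_inv := fun x => rfl
          right_inv := fun x => rfl }
      · exact eq_of_heq (Sigma.ext_iff.1 x.2).2
      · have := x.2.2
        simp only [MulAction.mem_fixedBy] at this ⊢
        rw [Sigma.smul_mk, this]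
    rw [hart, Finset.sum_apply, horb, hfix, Nat.cast_sum, Nat.card_eq_fintype_card,
      ← nsmul_eq_mul, ← Finset.card_univ, ← Finset.sum_const, ← Finset.sum_sub_distrib]
    exact Finset.sum_congr rfl fun i _ => induced_augChar_eq_sub _ σ

end Hurwitz

/-! ### The tree of discs and conditions (H1), (H3), (H4) -/

namespace Hurwitz

namespace FixedPointData

variable {G : Type*} [Group G] {p : ℕ} {Δ : Type} [Fintype Δ] [DecidableEq Δ] [MulAction G Δ]
  (D : FixedPointData G p Δ)

/-- The discs with their centers. -/
def Cell : Type := Σ c : Δ, {r : ℕ∞ // r ∈ D.radii c}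

instance : Finite D.Cell := inferInstanceAs (Finite (Σ c : Δ, {r : ℕ∞ // r ∈ D.radii c}))

/-- Two centered discs are equivalent if they are equal up to the action of the group. -/
instance cellSetoid : Setoid D.Cell where
  r a b := a.2.1 = b.2.1 ∧ ∃ g : G, a.2.1 ≤ D.d a.1 (g • b.1)
  iseqv :=
    { refl := fun a => ⟨rfl, 1, by rw [one_smul, d_self]; exact le_top⟩
      symm := by
        rintro a b ⟨h, g, hg⟩
        refine ⟨h.symm, g⁻¹, ?_⟩
        rw [← h, ← D.d_smul g, smul_inv_smul, D.d_symm]; exact hg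
      trans := by
        rintro a b c ⟨h, g, hg⟩ ⟨h', g', hg'⟩
        refine ⟨h.trans h', g * g', D.le_d_trans hg ?_⟩
        rw [mul_smul, D.d_smul, h]; exact hg' }

/-- The vertices of the tree. -/
def Vertex : Type := Quotient D.cellSetoid

instance : Finite D.Vertex := inferInstanceAs (Finite (Quotient D.cellSetoid))

noncomputable instance : Fintype D.Vertex := Fintype.ofFinite _

/-- The vertex of the disc of radius `r` around `c`. -/
def vert (c : Δ) (r : ℕ∞) (hr : r ∈ D.radii c) : D.Vertex := Quotient.mk _ ⟨c, r, hr⟩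

theorem vert_eq_iff {c c' : Δ} {r r' : ℕ∞} {hr : r ∈ D.radii c} {hr' : r' ∈ D.radii c'} :
    D.vert c r hr = D.vert c' r' hr' ↔ r = r' ∧ ∃ g : G, r ≤ D.d c (g • c') := Quotient.eq

theorem exists_vert (v : D.Vertex) : ∃ c r hr, v = D.vert c r hr := by
  obtain ⟨⟨c, r, hr⟩, rfl⟩ := Quotient.exists_rep v
  exact ⟨c, r, hr, rfl⟩

theorem lift_eq {α : Type*} {f : Δ → ℕ∞ → α}
    (hf : ∀ c c' r (g : G), r ≤ D.d c (g • c') → f c r = f c' r) (a b : D.Cell) (h : a ≈ b) :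
    f a.1 a.2.1 = f b.1 b.2.1 := by
  obtain ⟨h, g, hg⟩ := h
  rw [hf _ _ _ g hg, h]

theorem prev_eq_of_le {c c' : Δ} {r : ℕ∞} {g : G} (h : r ≤ D.d c (g • c')) :
    D.prev c r = D.prev c' r := by rw [D.prev_congr h, prev_smul]

/-- The parent map of the tree of discs. -/
noncomputable def parentMap : ParentMap D.Vertex where
  root := D.vert D.nonempty.some 0 (D.zero_mem_radii _)
  par := Quotient.lift (fun a => D.vert a.1 (D.prev a.1 a.2.1) (D.prev_mem _ _)) (by
    rintro ⟨c, r, hr⟩ ⟨c', r', hr'⟩ ⟨h, g, hg⟩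
    obtain rfl : r = r' := h
    exact D.vert_eq_iff.2 ⟨D.prev_eq_of_le hg, g, (D.prev_le _ _).trans hg⟩)
  ht := Quotient.lift (fun a => a.2.1) fun a b h => h.1
  par_root := D.vert_eq_iff.2 ⟨D.prev_zero _, 1, by rw [one_smul, d_self]; exact le_top⟩
  ht_par := by
    intro v hv
    obtain ⟨c, r, hr, rfl⟩ := D.exists_vert v
    refine (D.prev_mem_and_lt (c := c) (r := r) ?_).2
    rintro rfl
    exact hv (D.vert_eq_iff.2 ⟨rfl, 1, bot_le⟩)

theorem par_vert (c : Δ) (r : ℕ∞) (hr : r ∈ D.radii c) :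
    D.parentMap.par (D.vert c r hr) = D.vert c (D.prev c r) (D.prev_mem _ _) := rfl

theorem vert_eq_root_iff {c : Δ} {r : ℕ∞} {hr : r ∈ D.radii c} :
    D.vert c r hr = D.parentMap.root ↔ r = 0 := by
  refine D.vert_eq_iff.trans ⟨And.left, ?_⟩
  rintro rfl
  exact ⟨rfl, 1, bot_le⟩

theorem le_d_of_prev_eq_zero {c : Δ} {r : ℕ∞} (h : D.prev c r = 0) (y : Δ) : r ≤ D.d c y := by
  by_contra hlt
  have := D.le_prev (D.d_mem_radii c y) (not_le.1 hlt)
  rw [h, nonpos_iff_eq_zero] at this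
  exact (D.d_pos c y).ne' this

/-- A disc whose preceding radius is 0 contains all of Δ, because distances are positive; its radius
is then the least distance in Δ (⊤ if Δ is a single point). -/
theorem existsUnique_child_root :
    ∃! w, w ≠ D.parentMap.root ∧ D.parentMap.par w = D.parentMap.root := by
  have c := D.nonempty.some
  obtain ⟨s, hs, hs0, hs'⟩ := D.exists_next (D.zero_mem_radii c) (by simp)
  refine ⟨D.vert c s hs, ⟨?_, ?_⟩, ?_⟩
  · rw [ne_eq, vert_eq_root_iff]; exact hs0.ne'
  · rw [par_vert, vert_eq_root_iff]; exact hs'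
  · intro w ⟨hw, hw'⟩
    obtain ⟨c', r, hr, rfl⟩ := D.exists_vert w
    rw [par_vert, vert_eq_root_iff] at hw'
    rw [ne_eq, vert_eq_root_iff] at hw
    have key : ∀ (c c' : Δ) (r s : ℕ∞), r ∈ D.radii c → r ≠ 0 → D.prev c r = 0 →
        D.prev c' s = 0 → s ≤ r := by
      intro c c' r s hr hr0 h h'
      obtain ⟨y, rfl⟩ := (D.mem_radii.1 hr).resolve_left hr0
      exact D.le_d_trans (D.d_symm c c' ▸ D.le_d_of_prev_eq_zero h' c)
        (D.le_d_of_prev_eq_zero h' y)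
    refine D.vert_eq_iff.2 ⟨le_antisymm (key _ _ _ _ hs hs0.ne' hs' hw')
      (key _ _ _ _ hr hw hw' hs'), 1, D.le_d_of_prev_eq_zero hw' _⟩

/-- The tree of discs. -/
noncomputable abbrev tree : PlantedTree := D.parentMap.toPlantedTree D.existsUnique_child_root

theorem tree_succ_iff (v w : D.Vertex) :
    D.tree.Succ v w ↔ w ≠ D.parentMap.root ∧ D.parentMap.par w = v :=
  D.parentMap.succ_iff _ v w

theorem isLeaf_vert_iff {c : Δ} {r : ℕ∞} {hr : r ∈ D.radii c} :
    D.tree.IsLeaf (D.vert c r hr) ↔ r = ⊤ := by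
  constructor
  · intro h
    by_contra htop
    obtain ⟨s, hs, hrs, hp⟩ := D.exists_next hr htop
    refine h (D.vert c s hs) ((D.tree_succ_iff _ _).2 ⟨?_, ?_⟩)
    · rw [ne_eq, vert_eq_root_iff]; exact (bot_le.trans_lt hrs).ne'
    · rw [par_vert, vert_eq_iff]
      exact ⟨hp, 1, by rw [one_smul, d_self]; exact le_top⟩
  · rintro rfl w hw
    obtain ⟨h1, h2⟩ := (D.tree_succ_iff _ _).1 hw
    have h3 := D.parentMap.ht_par w h1
    rw [h2] at h3
    exact not_top_lt h3

/-- The group attached to a vertex. -/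
noncomputable def grp (v : D.Vertex) : Subgroup G := D.stab (Quotient.out v).1 (Quotient.out v).2.1

/-- `grp` is the stabilizer of an arbitrarily chosen disc of the orbit, so it is known only up to
conjugation; orders and induced class functions do not see the difference. -/
theorem exists_grp_conj (c : Δ) (r : ℕ∞) (hr : r ∈ D.radii c) :
    ∃ g : G, ∀ x, g * x * g⁻¹ ∈ D.grp (D.vert c r hr) ↔ x ∈ D.stab c r := by
  obtain ⟨h, g, hg⟩ : (Quotient.out (D.vert c r hr)).2.1 = r ∧ ∃ g : G,
      (Quotient.out (D.vert c r hr)).2.1 ≤ D.d (Quotient.out (D.vert c r hr)).1 (g • c) :=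
    Quotient.mk_out (s := D.cellSetoid) ⟨c, r, hr⟩
  refine ⟨g, fun x => ?_⟩
  have := D.mem_stab_conj_iff hg x
  rw [← congrArg (D.stab (G := G) c) h]
  exact this

theorem card_grp_vert (c : Δ) (r : ℕ∞) (hr : r ∈ D.radii c) :
    Nat.card (D.grp (D.vert c r hr)) = Nat.card (D.stab c r : Subgroup G) := by
  obtain ⟨h, g, hg⟩ : (Quotient.out (D.vert c r hr)).2.1 = r ∧ ∃ g : G,
      (Quotient.out (D.vert c r hr)).2.1 ≤ D.d (Quotient.out (D.vert c r hr)).1 (g • c) :=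
    Quotient.mk_out (s := D.cellSetoid) ⟨c, r, hr⟩
  rw [← congrArg (D.stab (G := G) c) h]
  exact D.card_stab_eq hg

/-- Up to the choice of a representative, `v = vert c r` with `grp v = stab c r`. -/
theorem exists_vert_grp (v : D.Vertex) :
    ∃ c r hr, v = D.vert c r hr ∧ D.grp v = D.stab c r :=
  ⟨_, _, (Quotient.out v).2.2, (Quotient.out_eq v).symm, rfl⟩

/-- The thickness of the edge leading to a vertex. -/
noncomputable def thickness (v : D.Vertex) : ℚ :=
  -- The factor |G_v| cancels the |G_v|⁻¹ in the Artin character and in u_{G_v}^*; dividing by `e`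
  -- normalizes v(p) to 1.
  Nat.card (D.grp v) * Quotient.lift (fun a : D.Cell => D.width a.1 a.2.1)
    (D.lift_eq (f := D.width) fun c c' r g h => by
      rw [width, width, D.prev_eq_of_le h]) v / D.e

theorem thickness_vert (c : Δ) (r : ℕ∞) (hr : r ∈ D.radii c) :
    D.thickness (D.vert c r hr) = Nat.card (D.stab c r : Subgroup G) * D.width c r / D.e := by
  rw [thickness, card_grp_vert]; rfl

/-- `y` lies in one of the discs of the vertex `v`. -/
def OnBranch (v : D.Vertex) (y : Δ) : Prop := ∃ r hr, v = D.vert y r hr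

theorem onBranch_vert_iff {c : Δ} {r : ℕ∞} {hr : r ∈ D.radii c} {y : Δ} :
    D.OnBranch (D.vert c r hr) y ↔ ∃ g : G, r ≤ D.d c (g • y) := by
  constructor
  · rintro ⟨r', hr', h⟩
    exact (D.vert_eq_iff.1 h).2
  · rintro ⟨g, hg⟩
    have hr' : r ∈ D.radii y := by
      rw [← D.radii_smul g]; exact D.mem_radii_of_le hg hr
    exact ⟨r, hr', D.vert_eq_iff.2 ⟨rfl, g, hg⟩⟩

/-- The discs around y form a chain, in which each one determines the next. -/
theorem existsUnique_succ_onBranch {v : D.Vertex} {y : Δ} (hv : ¬ D.tree.IsLeaf v)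
    (hy : D.OnBranch v y) :
    ∃! w : D.Vertex, (w ≠ D.parentMap.root ∧ D.parentMap.par w = v) ∧ D.OnBranch w y := by
  obtain ⟨r, hr, rfl⟩ := hy
  rw [isLeaf_vert_iff] at hv
  obtain ⟨s, hs, hrs, hp⟩ := D.exists_next hr hv
  refine ⟨D.vert y s hs, ⟨⟨?_, ?_⟩, s, hs, rfl⟩, ?_⟩
  · rw [ne_eq, vert_eq_root_iff]; exact (bot_le.trans_lt hrs).ne'
  · rw [par_vert, vert_eq_iff]
    exact ⟨hp, 1, by rw [one_smul, d_self]; exact le_top⟩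
  · rintro _ ⟨⟨h1, h2⟩, s', hs', rfl⟩
    rw [ne_eq, vert_eq_root_iff] at h1
    rw [par_vert, vert_eq_iff] at h2
    have h3 : s' = s := by
      rcases lt_trichotomy s s' with h | h | h
      · have := D.le_prev hs h
        rw [h2.1] at this
        exact absurd this (not_le.2 hrs)
      · exact h.symm
      · have := D.le_prev hs' h
        rw [hp, ← h2.1] at this
        exact absurd this (not_le.2 (D.prev_mem_and_lt h1).2)
    subst h3
    rfl

theorem onBranch_of_par {w : D.Vertex} {y : Δ} (h : D.OnBranch w y) :
    D.OnBranch (D.parentMap.par w) y := by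
  obtain ⟨r, hr, rfl⟩ := h
  exact ⟨_, _, D.par_vert y r hr⟩

theorem exists_grp_conj_of_par (w : D.Vertex) :
    ∃ g : G, ∀ x ∈ D.grp w, g * x * g⁻¹ ∈ D.grp (D.parentMap.par w) := by
  obtain ⟨c, r, hr, rfl, h⟩ := D.exists_vert_grp w
  rw [par_vert, h]
  obtain ⟨g, hg⟩ := D.exists_grp_conj c _ (D.prev_mem c r)
  exact ⟨g, fun x hx => (hg x).2 (D.stab_mono c (D.prev_le c r) hx)⟩

variable [Fintype G]

/-- The depth of a vertex. -/
noncomputable def vertexDepth (v : D.Vertex) : G → ℂ :=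
  ((D.e : ℚ)⁻¹ : ℚ) • Quotient.lift (fun a : D.Cell => negConjSum (D.discDepth a.1 a.2.1 : G → ℚ))
    (D.lift_eq (f := fun c r => negConjSum (D.discDepth c r : G → ℚ)) fun c c' r g h => by
      rw [← negConjSum_conj _ g]
      exact congrArg negConjSum (funext fun τ => D.discDepth_conj h τ)) v

theorem vertexDepth_vert (c : Δ) (r : ℕ∞) (hr : r ∈ D.radii c) :
    D.vertexDepth (D.vert c r hr) =
      ((D.e : ℚ)⁻¹ : ℚ) • negConjSum (D.discDepth c r : G → ℚ) := rfl

/-- The Artin character of the edge leading to a vertex. -/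
noncomputable def vertexArtin (v : D.Vertex) : G → ℂ :=
  ((Nat.card (D.grp v) : ℂ)⁻¹) •
    Quotient.lift (fun a : D.Cell => negConjSum (fun τ : G => (D.numFix a.1 a.2.1 τ : ℚ)))
    (D.lift_eq (f := fun c r => negConjSum (fun τ : G => (D.numFix c r τ : ℚ))) fun c c' r g h => by
      rw [← negConjSum_conj _ g]
      exact congrArg negConjSum (funext fun τ => by rw [D.numFix_conj h])) v

theorem vertexArtin_vert (c : Δ) (r : ℕ∞) (hr : r ∈ D.radii c) :
    D.vertexArtin (D.vert c r hr) = ((Nat.card (D.stab c r : Subgroup G) : ℂ)⁻¹) •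
      negConjSum (fun τ : G => (D.numFix c r τ : ℚ)) := by
  rw [vertexArtin, card_grp_vert]; rfl

open Classical in
theorem card_inv_smul_negConjSum_grp (c : Δ) (r : ℕ∞) (hr : r ∈ D.radii c) :
    induced (D.grp (D.vert c r hr)) (augChar (D.grp (D.vert c r hr))) =
      ((Nat.card (D.stab c r : Subgroup G) : ℂ)⁻¹) •
        negConjSum (fun τ => if τ ∈ D.stab c r then 1 else 0) := by
  rw [induced_augChar, card_grp_vert]
  obtain ⟨g, hg⟩ := D.exists_grp_conj c r hr
  rw [← negConjSum_conj _ g]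
  simp only [hg]

theorem vertexDepth_isNonneg (v : D.Vertex) : IsNonnegRatCharacter (D.vertexDepth v) := by
  obtain ⟨c, r, hr, rfl⟩ := D.exists_vert v
  rw [vertexDepth_vert]
  have := (D.isNonnegRatCharacter_discDepth hr).smul (c := (D.e : ℚ)⁻¹) (by positivity)
  convert this using 1
  ext; simp [Rat.smul_def]

/-- This is (H4), obtained by applying `negConjSum` to `discDepth_eq_add`. -/
theorem vertexDepth_eq (v : D.Vertex) (hv : v ≠ D.parentMap.root) :
    D.vertexDepth v = D.vertexDepth (D.parentMap.par v) +
      (D.thickness v : ℂ) • (D.vertexArtin v - induced (D.grp v) (augChar (D.grp v))) := by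
  classical
  obtain ⟨c, r, hr, rfl⟩ := D.exists_vert v
  rw [ne_eq, vert_eq_root_iff] at hv
  have hcard : (Nat.card (D.stab c r : Subgroup G) : ℂ) ≠ 0 := by simp
  rw [par_vert, vertexDepth_vert, vertexDepth_vert, vertexArtin_vert,
    card_inv_smul_negConjSum_grp, thickness_vert,
    negConjSum_congr fun τ hτ => D.discDepth_eq_add hv hτ, negConjSum_add, negConjSum_const_mul]
  have h1 : (negConjSum fun τ : G => ((D.numFix c r τ : ℚ) - if τ ∈ D.stab c r then 1 else 0)) =
      negConjSum (fun τ : G => (D.numFix c r τ : ℚ)) -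
        negConjSum (fun τ => if τ ∈ D.stab c r then 1 else 0) := by
    rw [eq_sub_iff_add_eq, ← negConjSum_add]
    simp
  rw [h1, ← smul_sub, smul_smul, smul_add]
  congr 1
  ext σ
  simp only [Pi.smul_apply, Rat.smul_def, smul_eq_mul]
  push_cast
  field_simp

-- Count the pairs (x, y) with σ y = y and x⁻¹ y in the disc. For fixed y there are as many x as
-- elements of the stabilizer of the disc if y lies in the orbit of the disc, and none otherwise.
open Classical in
theorem vertexArtin_vert_apply (c : Δ) (r : ℕ∞) (hr : r ∈ D.radii c) {σ : G} (hσ : σ ≠ 1) :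
    D.vertexArtin (D.vert c r hr) σ =
      -((Finset.univ.filter fun y : Δ => σ • y = y ∧ ∃ g : G, r ≤ D.d c (g • y)).card : ℂ) := by
  have hcard : (Nat.card (D.stab c r : Subgroup G) : ℂ) ≠ 0 := by simp
  rw [vertexArtin_vert, Pi.smul_apply, negConjSum_of_ne_one _ hσ, smul_eq_mul, mul_neg]
  congr 1
  rw [inv_mul_eq_iff_eq_mul₀ hcard]
  have h1 : ∀ x : G, D.numFix c r (x⁻¹ * σ * x) =
      (Finset.univ.filter fun y => σ • y = y ∧ r ≤ D.d c (x⁻¹ • y)).card := by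
    intro x
    unfold numFix
    refine Finset.card_equiv (MulAction.toPerm x) fun y => ?_
    simp only [Finset.mem_filter, Finset.mem_univ, true_and, MulAction.toPerm_apply,
      inv_smul_smul]
    refine and_congr_left fun _ => ?_
    have := smul_conj_iff x (x⁻¹ * σ * x) y
    rw [← this]
    simp [mul_assoc]
  have h2 : ∑ x : G, (Finset.univ.filter fun y => σ • y = y ∧ r ≤ D.d c (x⁻¹ • y)).card =
      ∑ y with σ • y = y, (Finset.univ.filter fun x : G => r ≤ D.d c (x⁻¹ • y)).card := by
    simp only [Finset.card_filter, Finset.sum_filter]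
    rw [Finset.sum_comm]
    refine Finset.sum_congr rfl fun y _ => ?_
    by_cases h : σ • y = y <;> simp [h]
  have h3 : ∀ y : Δ, (Finset.univ.filter fun x : G => r ≤ D.d c (x⁻¹ • y)).card =
      if ∃ g : G, r ≤ D.d c (g • y) then Nat.card (D.stab c r : Subgroup G) else 0 := by
    intro y
    split_ifs with h
    · obtain ⟨g, hg⟩ := h
      rw [Nat.card_eq_fintype_card, Fintype.card_subtype]
      refine Finset.card_equiv ((Equiv.inv G).trans (Equiv.mulRight g⁻¹)) fun x => ?_
      simp only [Finset.mem_filter, Finset.mem_univ, true_and, Equiv.trans_apply, Equiv.inv_apply,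
        Equiv.coe_mulRight]
      have h4 : r ≤ D.d (x⁻¹ • y) ((x⁻¹ * g⁻¹) • c) := by
        rw [← D.d_smul (g * x), D.d_symm]
        simpa [mul_smul] using hg
      rw [mem_stab, D.d_symm c, D.d_symm c, D.le_d_iff h4]
    · rw [Finset.card_eq_zero, Finset.filter_eq_empty_iff]
      exact fun x _ hx => h ⟨_, hx⟩
  calc ∑ x : G, ((D.numFix c r (x⁻¹ * σ * x) : ℚ) : ℂ)
      = ((∑ x : G, D.numFix c r (x⁻¹ * σ * x) : ℕ) : ℂ) := by push_cast; rfl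
    _ = _ := by
        rw [Finset.sum_congr rfl fun x _ => h1 x, h2, Finset.sum_congr rfl fun y _ => h3 y,
          ← Finset.sum_filter, Finset.filter_filter, Finset.sum_const, smul_eq_mul]
        push_cast
        ring

theorem sum_vertexArtin (v : D.Vertex) : ∑ σ, D.vertexArtin v σ = 0 := by
  obtain ⟨c, r, hr, rfl⟩ := D.exists_vert v
  simp only [vertexArtin_vert, Pi.smul_apply, ← Finset.smul_sum, sum_negConjSum, smul_zero]

open Classical in
theorem vertexArtin_apply (v : D.Vertex) {σ : G} (hσ : σ ≠ 1) :
    D.vertexArtin v σ = -((Finset.univ.filter fun y : Δ => σ • y = y ∧ D.OnBranch v y).card : ℂ) := by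
  obtain ⟨c, r, hr, rfl⟩ := D.exists_vert v
  rw [vertexArtin_vert_apply _ _ _ _ hσ]
  simp only [onBranch_vert_iff]

-- Away from 1 both sides count fixed points, and each point in the orbit of v lies in the orbit of
-- exactly one successor.
open Classical in
theorem vertexArtin_eq_sum {v : D.Vertex} (hv : ¬ D.tree.IsLeaf v) :
    D.vertexArtin v = ∑ w with w ≠ D.parentMap.root ∧ D.parentMap.par w = v, D.vertexArtin w := by
  refine eq_of_sum_eq_of_forall_ne_one ?_ fun σ hσ => ?_
  · simp only [Finset.sum_apply]
    rw [Finset.sum_comm]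
    simp only [sum_vertexArtin, Finset.sum_const_zero]
  · rw [Finset.sum_apply, vertexArtin_apply _ _ hσ,
      Finset.sum_congr rfl fun w _ => D.vertexArtin_apply w hσ, Finset.sum_neg_distrib]
    congr 1
    norm_cast
    rw [← Finset.card_biUnion]
    · congr 1
      ext y
      simp only [Finset.mem_filter, Finset.mem_univ, true_and, Finset.mem_biUnion]
      constructor
      · rintro ⟨h1, h2⟩
        obtain ⟨w, ⟨hw, hw'⟩, -⟩ := D.existsUnique_succ_onBranch hv h2
        exact ⟨w, hw, h1, hw'⟩
      · rintro ⟨w, ⟨-, rfl⟩, h1, h2⟩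
        exact ⟨h1, D.onBranch_of_par h2⟩
    · intro w hw w' hw' hne
      refine Finset.disjoint_left.2 fun y hy hy' => hne ?_
      simp only [Finset.coe_filter, Finset.mem_univ, true_and, Finset.mem_filter,
        Set.mem_ofPred_eq] at hw hw' hy hy'
      have hb : D.OnBranch v y := hw.2 ▸ D.onBranch_of_par hy.2
      exact (D.existsUnique_succ_onBranch hv hb).unique ⟨hw, hy.2⟩ ⟨hw', hy'.2⟩

theorem vertexArtin_of_isLeaf {v : D.Vertex} (hv : D.tree.IsLeaf v) :
    D.vertexArtin v = induced (D.grp v) (augChar (D.grp v)) := by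
  classical
  obtain ⟨c, r, hr, rfl⟩ := D.exists_vert v
  rw [isLeaf_vert_iff] at hv
  subst hv
  rw [vertexArtin_vert, card_inv_smul_negConjSum_grp]
  congr 2
  funext τ
  split_ifs with h
  · rw [D.numFix_top h]; simp
  · rw [D.numFix_of_notMem h]; simp

/-- Counting fixed points does not exhibit a representation; (H3) does, by induction from the
leaves, where the function is u_H^*. -/
theorem isCharacter_vertexArtin (v : D.Vertex) : IsCharacter (D.vertexArtin v) := by
  classical
  induction v using D.tree.induction_from_leaves with
  | h v ih =>
  by_cases hv : D.tree.IsLeaf v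
  · rw [D.vertexArtin_of_isLeaf hv]
    exact isCharacter_induced_augChar _
  · rw [D.vertexArtin_eq_sum hv]
    refine IsCharacter.sum _ fun w hw => ih w ((D.tree_succ_iff _ _).2 ?_)
    simpa using hw

theorem card_grp_le (w : D.Vertex) : Nat.card (D.grp w) ≤ Nat.card (D.grp (D.parentMap.par w)) := by
  obtain ⟨g, hg⟩ := D.exists_grp_conj_of_par w
  refine Nat.card_le_card_of_injective (fun x : D.grp w =>
    (⟨g * x * g⁻¹, hg x x.2⟩ : D.grp (D.parentMap.par w))) fun x y h => ?_
  have := congrArg Subtype.val h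
  exact Subtype.ext (by simpa using this)

-- The radius is attained, r = d c c', so the discs around c and c' part immediately after v. Either
-- they give two distinct successors, or some element of the stabilizer carries one disc to the
-- other and the index is greater than 1.
open Classical in
theorem one_lt_sum_index (v : D.Vertex) (hv : v ≠ D.parentMap.root) (hl : ¬ D.tree.IsLeaf v) :
    1 < ∑ w with D.tree.Succ v w, (Nat.card (D.grp v) : ℚ) / (Nat.card (D.grp w) : ℚ) := by
  simp only [tree_succ_iff]
  obtain ⟨c, r, hr, rfl⟩ := D.exists_vert v
  rw [isLeaf_vert_iff] at hl
  rw [ne_eq, vert_eq_root_iff] at hv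
  obtain ⟨c', hc'⟩ := (D.mem_radii.1 hr).resolve_left hv
  have hr' : r ∈ D.radii c' := hc' ▸ D.d_symm c c' ▸ D.d_mem_radii c' c
  have hvert : D.vert c' r hr' = D.vert c r hr :=
    D.vert_eq_iff.2 ⟨rfl, 1, by rw [one_smul, D.d_symm, hc']⟩
  obtain ⟨s, hs, hrs, hp⟩ := D.exists_next hr hl
  obtain ⟨s', hs', hrs', hp'⟩ := D.exists_next hr' hl
  have hmem : ∀ (c : Δ) (s : ℕ∞) (hr : r ∈ D.radii c) (hs : s ∈ D.radii c), r < s →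
      D.prev c s = r → D.vert c s hs ≠ D.parentMap.root ∧
        D.parentMap.par (D.vert c s hs) = D.vert c r hr := by
    intro c s hr hs hrs hp
    refine ⟨?_, ?_⟩
    · rw [ne_eq, vert_eq_root_iff]; exact (bot_le.trans_lt hrs).ne'
    · rw [par_vert, vert_eq_iff]
      exact ⟨hp, 1, by rw [one_smul, d_self]; exact le_top⟩
  have h1 := hmem c s hr hs hrs hp
  have h1' := hmem c' s' hr' hs' hrs' hp'
  rw [hvert] at h1'
  set S := Finset.univ.filter fun w => w ≠ D.parentMap.root ∧ D.parentMap.par w = D.vert c r hr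
  set f : D.Vertex → ℚ := fun w => (Nat.card (D.grp (D.vert c r hr)) : ℚ) / Nat.card (D.grp w)
  have hpos : ∀ w, (0 : ℚ) < Nat.card (D.grp w) := fun w => by exact_mod_cast Nat.card_pos
  have hge : ∀ w ∈ S, 1 ≤ f w := by
    intro w hw
    rw [one_le_div (hpos w), ← (Finset.mem_filter.1 hw).2.2]
    exact_mod_cast D.card_grp_le w
  have hnn : ∀ w ∈ S, 0 ≤ f w := fun w hw => zero_le_one.trans (hge w hw)
  have hm : D.vert c s hs ∈ S := Finset.mem_filter.2 ⟨Finset.mem_univ _, h1⟩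
  have hm' : D.vert c' s' hs' ∈ S := Finset.mem_filter.2 ⟨Finset.mem_univ _, h1'⟩
  by_cases heq : D.vert c s hs = D.vert c' s' hs'
  · refine lt_of_lt_of_le ?_ (Finset.single_le_sum hnn hm)
    rw [one_lt_div (hpos _), card_grp_vert, card_grp_vert, Nat.cast_lt]
    refine lt_of_le_of_ne (Subgroup.card_le_of_le (D.stab_mono c hrs.le)) fun hcard => ?_
    have hst : (D.stab c s : Subgroup G) = D.stab c r :=
      Subgroup.eq_of_le_of_card_ge (D.stab_mono c hrs.le) hcard.ge
    -- The element g carries the disc of c' to that of c. If g also preserved the latter, c and c'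
    -- would share a disc of radius s > r.
    obtain ⟨-, g, hg⟩ := D.vert_eq_iff.1 heq
    have h2 : g ∈ D.stab c r := by
      refine D.le_d_trans (hrs.le.trans hg) ?_
      rw [D.d_smul, D.d_symm, hc']
    rw [← hst, mem_stab, D.d_symm] at h2
    have h3 := D.le_d_trans h2 hg
    rw [D.d_smul, hc'] at h3
    exact absurd hrs (not_lt.2 h3)
  · have h4 : ∑ w ∈ ({D.vert c s hs, D.vert c' s' hs'} : Finset D.Vertex), f w ≤ ∑ w ∈ S, f w := by
      refine Finset.sum_le_sum_of_subset_of_nonneg ?_ fun w hw _ => hnn w hw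
      intro w hw
      rcases Finset.mem_insert.1 hw with rfl | hw
      · exact hm
      · rw [Finset.mem_singleton.1 hw]; exact hm'
    rw [Finset.sum_pair heq] at h4
    linarith [hge _ hm, hge _ hm']

end FixedPointData

end Hurwitz

/-! ### The leaves, condition (H5), and the Hurwitz tree of fixed point data -/

namespace Hurwitz

theorem sum_multDepth (p : ℕ) (C : Type*) [Group C] [Fintype C] : ∑ c, multDepth p C c = 0 := by
  classical
  rw [← Finset.add_sum_erase _ _ (Finset.mem_univ 1)]
  simp only [multDepth, if_true]
  rw [Finset.sum_congr rfl fun c hc => if_neg (Finset.ne_of_mem_erase hc), neg_add_eq_zero]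

namespace FixedPointData

variable {G : Type*} [Group G] {p : ℕ} {Δ : Type} [Fintype Δ] [DecidableEq Δ] [MulAction G Δ]
  (D : FixedPointData G p Δ)

theorem discDepth_top {c : Δ} {τ : G} (h : τ ∈ D.stab c ⊤) :
    D.discDepth c ⊤ τ = ((∑ x with τ • x = x ∧ x ≠ c, D.d c x).toNat : ℚ) := by
  have hlt : ∀ x, D.d c x < ⊤ ↔ x ≠ c := fun x => by
    rw [lt_top_iff_ne_top, ne_eq, d_eq_top, eq_comm]
  rw [discDepth, if_pos h, D.numFix_top h, D.sum_d_eq]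
  · rw [ENat.toNat_natCast]
    simp [hlt]
  · intro y hy
    exact ((hlt y).2 (Finset.mem_filter.1 hy).2.2).ne

theorem thickness_nonneg (v : D.Vertex) : 0 ≤ D.thickness v := by
  obtain ⟨c, r, hr, rfl⟩ := D.exists_vert v
  rw [thickness_vert]
  have := D.width_nonneg c r
  positivity

theorem thickness_eq_zero_iff [Finite G] {v : D.Vertex} (hv : v ≠ D.parentMap.root) :
    D.thickness v = 0 ↔ D.tree.IsLeaf v := by
  obtain ⟨c, r, hr, rfl⟩ := D.exists_vert v
  rw [ne_eq, vert_eq_root_iff] at hv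
  rw [thickness_vert, isLeaf_vert_iff, ← D.width_eq_zero_iff (c := c) hv]
  have h1 : (D.e : ℚ) ≠ 0 := by exact_mod_cast D.e_pos.ne'
  have h2 : (Nat.card (D.stab c r : Subgroup G) : ℚ) ≠ 0 := by exact_mod_cast Nat.card_pos.ne'
  rw [div_eq_zero_iff, mul_eq_zero, or_iff_left h1, or_iff_right h2]

variable [Fintype G]

theorem sylow_mem_iff {H : Type*} [Group H] [Finite H] [IsCyclic H] {p : ℕ} [Fact p.Prime]
    (P : Sylow p H) (x : H) : x ∈ (P : Subgroup H) ↔ ∃ i, orderOf x = p ^ i := by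
  constructor
  · intro hx
    obtain ⟨i, hi⟩ := IsPGroup.iff_orderOf.1 P.2 ⟨x, hx⟩
    exact ⟨i, by rw [← hi, Subgroup.orderOf_mk]⟩
  · rintro ⟨i, hi⟩
    have hp : IsPGroup p (Subgroup.zpowers x) :=
      IsPGroup.of_card (n := i) (by rw [Nat.card_zpowers, hi])
    obtain ⟨Q, hQ⟩ := hp.exists_le_sylow
    let _ : CommGroup H := IsCyclic.commGroup
    have hn : (P : Subgroup H).Normal := inferInstance
    have := Sylow.unique_of_normal P hn
    rw [Subsingleton.elim P Q]
    exact hQ (Subgroup.mem_zpowers x)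

-- The two sides are compared term by term over x, with τ = x⁻¹ σ x. If τ fixes c and has order
-- p^(i+1), both terms are -1/(p^i (p - 1)): on the left by `sum_of_orderOf`, on the right because
-- |P_b|⁻¹ p^(m-i) = p^(-i) when |P_b| = p^m. All other τ contribute 0.
open Classical in
theorem vertexDepth_of_isLeaf [Fact p.Prime] {v : D.Vertex} (hv : D.tree.IsLeaf v)
    (P : Sylow p (D.grp v)) :
    D.vertexDepth v = induced ((P : Subgroup (D.grp v)).map (D.grp v).subtype)
      (multDepth p ((P : Subgroup (D.grp v)).map (D.grp v).subtype)) := by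
  obtain ⟨c, r, hr, hvc, hgrp⟩ := D.exists_vert_grp v
  have hp : p.Prime := Fact.out
  have htop : r = ⊤ := by
    rw [hvc, isLeaf_vert_iff] at hv; exact hv
  subst htop
  have hgst : D.grp v = MulAction.stabilizer G c := by rw [hgrp, stab_top]
  have hcyc : IsCyclic (D.grp v) := by
    rw [hgst]; exact D.isCyclic_stabilizer c
  have hdepth : D.vertexDepth v = ((D.e : ℚ)⁻¹ : ℚ) • negConjSum (D.discDepth c ⊤ : G → ℚ) := by
    rw [hvc, vertexDepth_vert]
  rw [hdepth]
  clear hdepth hvc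
  set Q := (P : Subgroup (D.grp v)).map (D.grp v).subtype with hQ
  have hmemQ : ∀ τ : G, τ ∈ Q ↔ τ ∈ D.stab c ⊤ ∧ ∃ i, orderOf τ = p ^ i := by
    intro τ
    rw [hQ, Subgroup.mem_map]
    constructor
    · rintro ⟨x, hx, rfl⟩
      refine ⟨hgrp ▸ x.2, ?_⟩
      obtain ⟨i, hi⟩ := (sylow_mem_iff P x).1 hx
      exact ⟨i, by rw [← hi]; exact Subgroup.orderOf_coe x⟩
    · rintro ⟨h1, i, hi⟩
      refine ⟨⟨τ, hgrp ▸ h1⟩, (sylow_mem_iff P _).2 ⟨i, ?_⟩, rfl⟩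
      rw [Subgroup.orderOf_mk, hi]
  obtain ⟨m, hm⟩ : ∃ m, Nat.card Q = p ^ m := by
    have h1 : IsPGroup p Q := P.2.map _
    exact IsPGroup.iff_card.1 h1
  have hQ0 : (Nat.card Q : ℂ) ≠ 0 := by simp
  refine eq_of_sum_eq_of_forall_ne_one ?_ fun σ hσ => ?_
  · rw [sum_induced, sum_multDepth]
    simp only [Pi.smul_apply, ← Finset.smul_sum, sum_negConjSum, smul_zero, mul_zero]
  · rw [Pi.smul_apply, negConjSum_of_ne_one _ hσ, Rat.smul_def, induced, ← Finset.sum_neg_distrib,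
      Finset.mul_sum, Finset.mul_sum]
    refine Finset.sum_congr rfl fun x _ => ?_
    have hτ : x⁻¹ * σ * x ≠ 1 := by
      intro hx
      apply hσ
      have : σ = x * (x⁻¹ * σ * x) * x⁻¹ := by group
      rw [this, hx]; group
    generalize x⁻¹ * σ * x = τ at hτ
    by_cases hs : τ ∈ D.stab c ⊤
    · have hfix : τ • c = c := by
        rw [stab_top] at hs; exact hs
      rw [D.discDepth_top hs]
      by_cases hpow : ∃ i, orderOf τ = p ^ i
      · obtain ⟨i, hi⟩ := hpow
        have hτQ : τ ∈ Q := (hmemQ τ).2 ⟨hs, i, hi⟩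
        rw [dif_pos hτQ, multDepth, if_neg (by simpa [Subtype.ext_iff] using hτ), multDepthAux]
        cases i with
        | zero => rw [pow_zero, orderOf_eq_one_iff] at hi; exact absurd hi hτ
        | succ i =>
          have him : i + 1 ≤ m := by
            have h1 : orderOf τ ∣ Nat.card Q := by
              rw [← Subgroup.orderOf_mk τ hτQ]; exact orderOf_dvd_natCard _
            rw [hi, hm] at h1
            exact (Nat.pow_dvd_pow_iff_le_right hp.one_lt).1 h1
          have hval : padicValNat p (Nat.card Q / orderOf (⟨τ, hτQ⟩ : Q)) = m - (i + 1) := by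
            rw [Subgroup.orderOf_mk, hi, hm, Nat.pow_div him hp.pos, padicValNat.prime_pow]
          have hsum := D.sum_of_orderOf τ c hfix i hi
          have hne : ∑ x with τ • x = x ∧ x ≠ c, D.d c x ≠ ⊤ := by
            rw [ne_eq, ENat.sum_eq_top]
            rintro ⟨y, hy, hy'⟩
            exact (Finset.mem_filter.1 hy).2.2 ((D.d_eq_top _ _).1 hy').symm
          rw [← ENat.natCast_toNat hne] at hsum
          generalize (∑ x with τ • x = x ∧ x ≠ c, D.d c x).toNat = n at hsum
          norm_cast at hsum
          have hsum' : (p : ℂ) ^ i * (p - 1) * n = D.e := by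
            have := congrArg (Nat.cast : ℕ → ℂ) hsum
            push_cast [Nat.cast_sub hp.one_lt.le] at this
            exact this
          rw [hval, hm]
          obtain ⟨j, rfl⟩ := Nat.exists_eq_add_of_le him
          have hp0 : (p : ℂ) ≠ 0 := by exact_mod_cast hp.ne_zero
          have hp1 : (p : ℂ) - 1 ≠ 0 := by
            rw [sub_ne_zero]; exact_mod_cast hp.one_lt.ne'
          have hn : (n : ℂ) ≠ 0 := by
            have : n ≠ 0 := by
              rintro rfl
              exact D.e_pos.ne' (by simpa using hsum.symm)
            exact_mod_cast this
          have he : (D.e : ℂ) ≠ 0 := by exact_mod_cast D.e_pos.ne'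
          rw [Nat.add_sub_cancel_left]
          push_cast
          rw [← hsum']
          field_simp
          ring
      · rw [D.sum_of_orderOf_ne τ c hfix fun i hi => hpow ⟨i, hi⟩,
          dif_neg fun h => hpow ((hmemQ τ).1 h).2]
        simp
    · rw [D.discDepth_of_notMem hs, dif_neg fun h => hs ((hmemQ τ).1 h).1]
      simp

theorem vertexArtin_of_par_eq_root {v : D.Vertex} (hv : D.parentMap.par v = D.parentMap.root)
    {σ : G} (hσ : σ ≠ 1) :
    D.vertexArtin v σ = -((Finset.univ.filter fun y : Δ => σ • y = y).card : ℂ) := by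
  classical
  rw [D.vertexArtin_apply _ hσ]
  congr 3
  ext y
  simp only [Finset.mem_filter, Finset.mem_univ, true_and, and_iff_left_iff_imp]
  intro _
  obtain ⟨c, r, hr, rfl⟩ := D.exists_vert v
  rw [par_vert, vert_eq_root_iff] at hv
  rw [onBranch_vert_iff]
  exact ⟨1, D.le_d_of_prev_eq_zero hv _⟩

/-- The Hurwitz tree attached to fixed point data. -/
noncomputable def hurwitzTree [Fact p.Prime] : HurwitzTree G p where
  toPlantedTree := D.tree
  ε e := D.thickness e.target
  ε_nonneg e := D.thickness_nonneg e.target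
  ε_eq_zero_iff e := D.thickness_eq_zero_iff ((D.tree_succ_iff _ _).1 e.2).1
  grp := D.grp
  artin e := D.vertexArtin e.target
  artin_isCharacter e := D.isCharacter_vertexArtin _
  depth := D.vertexDepth
  depth_isNonneg := D.vertexDepth_isNonneg
  grp_succ_le v w h := by
    obtain ⟨-, rfl⟩ := (D.tree_succ_iff _ _).1 h
    exact D.exists_grp_conj_of_par w
  one_lt_sum_index v hv hl := D.one_lt_sum_index v hv hl
  grp_root := by
    obtain ⟨c, r, hr, h, h'⟩ := D.exists_vert_grp D.parentMap.root
    have := (D.vert_eq_root_iff (hr := hr)).1 h.symm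
    change D.grp D.parentMap.root = ⊤
    rw [h', this, eq_top_iff]
    exact fun x _ => (bot_le : (0 : ℕ∞) ≤ _)
  grp_succ_root w hw := by
    obtain ⟨h1, h2⟩ := (D.tree_succ_iff _ _).1 hw
    obtain ⟨c, r, hr, h, h'⟩ := D.exists_vert_grp w
    rw [h, par_vert] at h2
    have h3 := (D.vert_eq_root_iff).1 h2
    rw [h', eq_top_iff]
    exact fun x _ => D.le_d_of_prev_eq_zero h3 _
  grp_leaf b hb := by
    obtain ⟨c, r, hr, h, h'⟩ := D.exists_vert_grp b
    rw [h, isLeaf_vert_iff] at hb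
    subst hb
    rw [h', stab_top]
    exact ⟨D.stabilizer_ne_bot c, D.isCyclic_stabilizer c⟩
  artin_eq_sum e he := by
    classical
    refine (D.vertexArtin_eq_sum he).trans (Eq.symm ?_)
    exact Finset.sum_bij (fun e' _ => e'.target)
      (fun e' he' => Finset.mem_filter.2 ⟨Finset.mem_univ _,
        (Finset.mem_filter.1 he').2 ▸ (D.tree_succ_iff _ _).1 e'.2⟩)
      (fun a ha b hb h => PlantedTree.Edge.ext'
        ((Finset.mem_filter.1 ha).2.trans (Finset.mem_filter.1 hb).2.symm) h)
      (fun w hw => ⟨⟨(e.target, w), (D.tree_succ_iff _ _).2 (Finset.mem_filter.1 hw).2⟩,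
        Finset.mem_filter.2 ⟨Finset.mem_univ _, rfl⟩, rfl⟩) fun _ _ => rfl
  artin_leaf e he := D.vertexArtin_of_isLeaf he
  depth_target e := by
    obtain ⟨h1, h2⟩ := (D.tree_succ_iff _ _).1 e.2
    have := D.vertexDepth_eq e.target h1
    rw [show D.parentMap.par e.target = e.source from h2] at this
    exact this
  depth_leaf b hb P := D.vertexDepth_of_isLeaf hb P

theorem hurwitzTree_depthChar [Fact p.Prime] : D.hurwitzTree.depthChar = 0 := by
  change D.vertexDepth (D.vert _ 0 _) = 0
  rw [vertexDepth_vert, negConjSum_eq_zero, smul_zero]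
  intro σ _
  simp [discDepth]

theorem hurwitzTree_artinChar [Fact p.Prime] {σ : G} (hσ : σ ≠ 1) :
    D.hurwitzTree.artinChar σ = -((Finset.univ.filter fun y : Δ => σ • y = y).card : ℂ) :=
  D.vertexArtin_of_par_eq_root ((D.tree_succ_iff _ _).1 D.tree.trunk.2).2 hσ

theorem sum_hurwitzTree_artinChar [Fact p.Prime] : ∑ σ, D.hurwitzTree.artinChar σ = 0 :=
  D.sum_vertexArtin _

end FixedPointData

end Hurwitz

/-! ### Substitution and evaluation of power series -/

namespace Hurwitz

open PowerSeries IsLocalRing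

open scoped PowerSeries.WithPiTopology in
/-- Substitution of a power series whose constant coefficient lies in an ideal with respect to
which the ring of coefficients is complete. -/
theorem exists_algHom_X_eq {A : Type*} [CommRing A] (I : Ideal A) [IsAdicComplete I A]
    (f : A⟦X⟧) (hf : constantCoeff f ∈ I) : ∃ ψ : A⟦X⟧ →ₐ[A] A⟦X⟧, ψ X = f := by
  let _ : WithIdeal A := ⟨I⟩
  have hadic : IsAdic I := rfl
  have h := hadic.isAdicComplete_iff.1 inferInstance
  have := h.1
  have := h.2
  -- The constant coefficient is topologically nilpotent in the I-adic topology, hence so is f, and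
  -- evaluation at f converges by completeness.
  have hn : HasEval f := by
    refine MvPowerSeries.LinearTopology.isTopologicallyNilpotent_of_constantCoeff ?_
    refine (hadic.hasBasis_nhds_zero.tendsto_right_iff).2 fun n _ => ?_
    filter_upwards [Filter.eventually_ge_atTop n] with m hm
    exact Ideal.pow_le_pow_right hm (Ideal.pow_mem_pow hf m)
  refine ⟨aeval hn, ?_⟩
  have := aeval_coe hn (Polynomial.X : Polynomial A)
  rwa [Polynomial.coe_X, Polynomial.aeval_X] at this

/-- A ring homomorphism from a power series ring to a noetherian local ring is determined by its
values on the constants and on `X`, if the latter is not a unit. -/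
theorem ringHom_powerSeries_ext {A B : Type*} [CommRing A] [CommRing B] [IsLocalRing B]
    [IsNoetherianRing B] {f g : A⟦X⟧ →+* B} (hC : ∀ a, f (C a) = g (C a)) (hX : f X = g X)
    (hm : f X ∈ maximalIdeal B) : f = g := by
  have hpoly : ∀ q : Polynomial A, f q = g q := by
    intro q
    induction q using Polynomial.induction_on' with
    | add p q hp hq => rw [Polynomial.coe_add, map_add, map_add, hp, hq]
    | monomial n a =>
      rw [← Polynomial.C_mul_X_pow_eq_monomial]
      simp [hC, hX]
  ext h
  -- By Krull's intersection theorem it suffices to work modulo each power of the maximal ideal,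
  -- where h may be replaced by a truncation. No continuity is assumed.
  rw [← sub_eq_zero, ← Ideal.mem_bot,
    ← Ideal.iInf_pow_eq_bot_of_isLocalRing _ (Ideal.IsPrime.ne_top' (I := maximalIdeal B)),
    Ideal.mem_iInf]
  intro n
  rw [eq_X_pow_mul_shift_add_trunc n h, map_add, map_add, hpoly, add_sub_add_right_eq_sub, map_mul,
    map_mul, map_pow, map_pow, ← hX, ← mul_sub]
  exact Ideal.mul_mem_right _ _ (Ideal.pow_mem_pow hm n)

theorem algHom_powerSeries_ext {A B : Type*} [CommRing A] [CommRing B] [Algebra A B]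
    [IsLocalRing B] [IsNoetherianRing B] {f g : A⟦X⟧ →ₐ[A] B} (hX : f X = g X)
    (hm : f X ∈ maximalIdeal B) : f = g := by
  have h : (f : A⟦X⟧ →+* B) = g := by
    refine ringHom_powerSeries_ext (fun a => ?_) hX hm
    exact (f.commutes a).trans (g.commutes a).symm
  exact AlgHom.coe_ringHom_injective h

theorem mem_maximalIdeal_powerSeries_iff {A : Type*} [CommRing A] [IsLocalRing A] {f : A⟦X⟧} :
    f ∈ maximalIdeal A⟦X⟧ ↔ constantCoeff f ∈ maximalIdeal A := by
  rw [mem_maximalIdeal, mem_maximalIdeal, mem_nonunits_iff, mem_nonunits_iff,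
    isUnit_iff_constantCoeff]

theorem X_mem_maximalIdeal {A : Type*} [CommRing A] [IsLocalRing A] :
    (X : A⟦X⟧) ∈ maximalIdeal A⟦X⟧ := by
  rw [mem_maximalIdeal_powerSeries_iff]; simp

theorem algEquiv_X_mem_maximalIdeal {A : Type*} [CommRing A] [IsLocalRing A]
    (ψ : A⟦X⟧ ≃ₐ[A] A⟦X⟧) : ψ X ∈ maximalIdeal A⟦X⟧ := by
  have h := X_mem_maximalIdeal (A := A)
  rw [mem_maximalIdeal, mem_nonunits_iff] at h ⊢
  exact fun h' => h ((MulEquiv.isUnit_map ψ).1 h')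

section Evaluation

variable {S : Type*} [CommRing S] [IsLocalRing S] [IsNoetherianRing S]
  [IsAdicComplete (maximalIdeal S) S]

/-- The translation `X ↦ X + y`. -/
noncomputable def translate (y : maximalIdeal S) : S⟦X⟧ →ₐ[S] S⟦X⟧ :=
  (exists_algHom_X_eq (maximalIdeal S) (X + C (y : S)) (by simp)).choose

theorem translate_X (y : maximalIdeal S) : translate y X = X + C (y : S) :=
  (exists_algHom_X_eq (maximalIdeal S) (X + C (y : S)) (by simp)).choose_spec

/-- Evaluation of power series at a point of the open disc. -/
noncomputable def evalAt (y : maximalIdeal S) : S⟦X⟧ →+* S :=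
  (constantCoeff (R := S)).comp (translate y : S⟦X⟧ →+* S⟦X⟧)

@[simp]
theorem evalAt_X (y : maximalIdeal S) : evalAt y X = (y : S) := by
  simp [evalAt, translate_X]

@[simp]
theorem evalAt_C (y : maximalIdeal S) (a : S) : evalAt y (C a) = a := by
  have : translate y (C a) = C a := (translate y).commutes a
  simp [evalAt, this]

theorem eq_evalAt {f : S⟦X⟧ →+* S} (hC : ∀ a, f (C a) = a) (y : maximalIdeal S) (hX : f X = y) :
    f = evalAt y := by
  refine ringHom_powerSeries_ext (fun a => by rw [hC, evalAt_C]) (by rw [hX, evalAt_X]) ?_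
  rw [hX]; exact y.2

theorem translate_neg_translate (y : maximalIdeal S) (h : S⟦X⟧) :
    translate (-y) (translate y h) = h := by
  have : (translate (-y)).comp (translate y) = AlgHom.id S S⟦X⟧ := by
    have hX : ((translate (-y)).comp (translate y)) X = AlgHom.id S S⟦X⟧ X := by
      have hc : translate (-y) (C (y : S)) = C (y : S) := (translate (-y)).commutes _
      rw [AlgHom.comp_apply, translate_X, map_add, translate_X, hc]
      simp
    refine algHom_powerSeries_ext hX ?_
    rw [hX]; exact X_mem_maximalIdeal
  exact congrArg (fun ψ : S⟦X⟧ →ₐ[S] S⟦X⟧ => ψ h) this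

/-- Translation moves y to 0, where vanishing is divisibility by X. -/
theorem evalAt_eq_zero_iff {y : maximalIdeal S} {h : S⟦X⟧} :
    evalAt y h = 0 ↔ X - C (y : S) ∣ h := by
  constructor
  · intro hh
    obtain ⟨q, hq⟩ := X_dvd_iff.2 hh
    refine ⟨translate (-y) q, ?_⟩
    have := translate_neg_translate y h
    rw [show translate y h = X * q from hq, map_mul, translate_X] at this
    rw [← this]
    simp [sub_eq_add_neg]
  · rintro ⟨q, rfl⟩
    simp

theorem X_sub_C_dvd_sub (y : maximalIdeal S) (h : S⟦X⟧) : X - C (y : S) ∣ h - C (evalAt y h) := by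
  rw [← evalAt_eq_zero_iff]
  simp

/-- Consequently an automorphism does not increase distances in the disc; applied also to the
inverse, this makes it an isometry. -/
theorem sub_dvd_evalAt_sub (x y : maximalIdeal S) (h : S⟦X⟧) :
    (x - y : S) ∣ evalAt x h - evalAt y h := by
  obtain ⟨q, hq⟩ := X_sub_C_dvd_sub y h
  have := congrArg (evalAt x) hq
  simp only [map_sub, map_mul, evalAt_X, evalAt_C] at this
  exact ⟨_, this⟩

theorem evalAt_mem_maximalIdeal (y : maximalIdeal S) {h : S⟦X⟧} (hh : h ∈ maximalIdeal S⟦X⟧) :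
    evalAt y h ∈ maximalIdeal S := by
  have h0 : (y - (0 : maximalIdeal S) : S) ∣ _ := sub_dvd_evalAt_sub y 0 h
  have h1 : evalAt (0 : maximalIdeal S) h = constantCoeff h := by
    rw [← eq_evalAt (f := constantCoeff (R := S)) (by simp) 0 (by simp)]
  rw [h1] at h0
  rw [← sub_add_cancel (evalAt y h) (constantCoeff h)]
  refine Ideal.add_mem _ (Ideal.mem_of_dvd _ h0 ?_) (mem_maximalIdeal_powerSeries_iff.1 hh)
  simp

end Evaluation

end Hurwitz

/-! ### Valuations of ζ - 1 for roots of unity, and generic points of discs -/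

namespace Hurwitz

open IsLocalRing

section Roots

variable {S : Type*} [CommRing S] [IsDomain S]

theorem sub_one_dvd_pow_sub_one {S : Type*} [CommRing S] (ζ : S) (n : ℕ) : ζ - 1 ∣ ζ ^ n - 1 := by
  simpa using sub_dvd_pow_sub_pow ζ 1 n

theorem associated_sub_one_of_isPrimitiveRoot {ζ μ : S} {n : ℕ} [NeZero n]
    (hζ : IsPrimitiveRoot ζ n) (hμ : IsPrimitiveRoot μ n) : Associated (ζ - 1) (μ - 1) := by
  obtain ⟨i, -, rfl⟩ := hζ.eq_pow_of_pow_eq_one hμ.pow_eq_one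
  obtain ⟨j, -, hj⟩ := hμ.eq_pow_of_pow_eq_one hζ.pow_eq_one
  refine associated_of_dvd_dvd (sub_one_dvd_pow_sub_one _ _) ?_
  conv_rhs => rw [← hj]
  exact sub_one_dvd_pow_sub_one _ _

variable [IsDiscreteValuationRing S]

theorem addVal_eq_of_associated {a b : S} (h : Associated a b) :
    IsDiscreteValuationRing.addVal S a = IsDiscreteValuationRing.addVal S b :=
  le_antisymm (IsDiscreteValuationRing.addVal_le_iff_dvd.2 h.dvd)
    (IsDiscreteValuationRing.addVal_le_iff_dvd.2 h.symm.dvd)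

theorem addVal_eq_zero_iff {a : S} : IsDiscreteValuationRing.addVal S a = 0 ↔ IsUnit a := by
  rw [← (IsDiscreteValuationRing.addVal S).map_one]
  constructor
  · intro h
    have h1 : a ∣ 1 := IsDiscreteValuationRing.addVal_le_iff_dvd.1 h.le
    exact isUnit_of_dvd_one h1
  · exact fun h => addVal_eq_of_associated (associated_one_iff_isUnit.2 h)

theorem addVal_prod {ι : Type*} (s : Finset ι) (f : ι → S) :
    IsDiscreteValuationRing.addVal S (∏ i ∈ s, f i) =
      ∑ i ∈ s, IsDiscreteValuationRing.addVal S (f i) := by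
  classical
  induction s using Finset.induction_on with
  | empty => simp
  | insert a s ha ih => rw [Finset.prod_insert ha, Finset.sum_insert ha, AddValuation.map_mul, ih]

/-- The valuation of `ζ - 1` for a root of unity `ζ` of order `p ^ (i + 1)`. -/
theorem mul_addVal_sub_one {p i : ℕ} (hp : p.Prime) {ζ : S} (hζ : orderOf ζ = p ^ (i + 1)) :
    ((p ^ i * (p - 1) : ℕ) : ℕ∞) * IsDiscreteValuationRing.addVal S (ζ - 1) =
      IsDiscreteValuationRing.addVal S (p : S) := by
  have : Fact p.Prime := ⟨hp⟩
  have hpr : IsPrimitiveRoot ζ (p ^ (i + 1)) := hζ ▸ IsPrimitiveRoot.orderOf ζ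
  have : NeZero (p ^ (i + 1)) := ⟨pow_ne_zero _ hp.ne_zero⟩
  -- The cyclotomic polynomial takes the value p at 1, which is thus the product of the p^i (p - 1)
  -- associated factors 1 - μ.
  have h1 := congrArg (Polynomial.eval 1) (Polynomial.cyclotomic_eq_prod_X_sub_primitiveRoots hpr)
  rw [Polynomial.eval_one_cyclotomic_prime_pow, Polynomial.eval_prod] at h1
  rw [h1, addVal_prod, Finset.sum_congr rfl fun μ hμ => ?_, Finset.sum_const,
    hpr.card_primitiveRoots, Nat.totient_prime_pow_succ hp, nsmul_eq_mul]
  rw [Polynomial.eval_sub, Polynomial.eval_X, Polynomial.eval_C, AddValuation.map_sub_swap]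
  exact (addVal_eq_of_associated (associated_sub_one_of_isPrimitiveRoot hpr
    (isPrimitiveRoot_of_mem_primitiveRoots hμ))).symm

/-- `ζ - 1` is a unit if the order of the root of unity `ζ` is not a power of the residue
characteristic. -/
theorem addVal_sub_one_eq_zero {p : ℕ} (hp : p.Prime) (hpS : (p : S) ∈ maximalIdeal S) {ζ : S}
    (h0 : orderOf ζ ≠ 0) (hζ : ∀ i, orderOf ζ ≠ p ^ i) :
    IsDiscreteValuationRing.addVal S (ζ - 1) = 0 := by
  obtain ⟨i, m, hm, hord⟩ := Nat.exists_eq_pow_mul_and_not_dvd h0 p hp.ne_one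
  rw [addVal_eq_zero_iff]
  by_contra hu
  have hmem : ζ - 1 ∈ maximalIdeal S := hu
  -- Here η ≠ 1 and η^m = 1 with m prime to p. If ζ were congruent to 1, then 0 = 1 + η + ... +
  -- η^(m-1) would be congruent to m, putting both p and m in the maximal ideal.
  set η := ζ ^ p ^ i
  have hη : η - 1 ∈ maximalIdeal S := Ideal.mem_of_dvd _ (sub_one_dvd_pow_sub_one ζ _) hmem
  have hηm : η ^ m = 1 := by
    rw [← pow_mul, ← hord, pow_orderOf_eq_one]
  have hη1 : η - 1 ≠ 0 := by
    intro h
    rw [sub_eq_zero] at h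
    have := orderOf_dvd_of_pow_eq_one h
    obtain ⟨j, -, hj⟩ := (Nat.dvd_prime_pow hp).1 this
    exact hζ j hj
  have hgeom : (∑ j ∈ Finset.range m, η ^ j) = 0 := by
    have := geom_sum_mul η m
    rw [hηm, sub_self, mul_eq_zero] at this
    exact this.resolve_right hη1
  have hmm : (m : S) ∈ maximalIdeal S := by
    have h2 : (m : S) - ∑ j ∈ Finset.range m, η ^ j ∈ maximalIdeal S := by
      have : (m : S) = ∑ j ∈ Finset.range m, 1 := by simp
      rw [this, ← Finset.sum_sub_distrib]
      refine Ideal.sum_mem _ fun j _ => ?_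
      rw [← neg_sub]
      exact (Ideal.neg_mem_iff _).2 (Ideal.mem_of_dvd _ (sub_one_dvd_pow_sub_one η j) hη)
    rwa [hgeom, sub_zero] at h2
  have hcop : Nat.Coprime p m := (Nat.Prime.coprime_iff_not_dvd hp).2 hm
  have hbez := Nat.Coprime.isCoprime hcop
  obtain ⟨a, b, hab⟩ := hbez
  have h1 : (1 : S) ∈ maximalIdeal S := by
    have := congrArg (Int.cast : ℤ → S) hab
    push_cast at this
    rw [← this]
    exact Ideal.add_mem _ (Ideal.mul_mem_left _ _ hpS) (Ideal.mul_mem_left _ _ hmm)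
  exact (Ideal.ne_top_iff_one _).1 (Ideal.IsPrime.ne_top' (I := maximalIdeal S)) h1

/-- A generic point of a disc is as far as possible from finitely many given points. -/
theorem exists_generic_point [Infinite (ResidueField S)] (s : Finset S) (c c' : S) :
    ∃ x : S, (c - c' ∣ x - c) ∧ ∀ y ∈ s, IsDiscreteValuationRing.addVal S (x - y) =
      min (IsDiscreteValuationRing.addVal S (c - c')) (IsDiscreteValuationRing.addVal S (c - y)) := by
  classical
  set ϖ := c - c' with hϖ
  by_cases h0 : ϖ = 0
  · refine ⟨c, by simp, fun y _ => ?_⟩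
    rw [h0, AddValuation.map_zero, min_eq_right le_top]
  let q : S → S := fun y => if h : ϖ ∣ y - c then h.choose else 0
  have hq : ∀ y, ϖ ∣ y - c → y - c = ϖ * q y := fun y h => by
    simp only [q, dif_pos h]; exact h.choose_spec
  -- The point is c + ϖ u, where the residue of u avoids the finitely many residues of the `q y`.
  obtain ⟨a, ha⟩ := Infinite.exists_notMem_finset (s.image fun y => residue S (q y))
  obtain ⟨u, rfl⟩ := residue_surjective a
  refine ⟨c + ϖ * u, by simp, fun y hy => ?_⟩
  by_cases hd : ϖ ∣ y - c
  · have hunit : IsUnit (u - q y) := by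
      by_contra h
      apply ha
      rw [Finset.mem_image]
      refine ⟨y, hy, ?_⟩
      rw [eq_comm, ← sub_eq_zero, ← map_sub, residue_eq_zero_iff]
      exact h
    have h1 : c + ϖ * u - y = ϖ * (u - q y) := by
      have := hq y hd
      linear_combination -this
    rw [h1, AddValuation.map_mul, addVal_eq_zero_iff.2 hunit, add_zero, min_eq_left]
    rw [AddValuation.map_sub_swap _ c y]
    exact IsDiscreteValuationRing.addVal_le_iff_dvd.2 hd
  · have hlt : IsDiscreteValuationRing.addVal S (c - y) <
        IsDiscreteValuationRing.addVal S ϖ := by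
      rw [← not_le, IsDiscreteValuationRing.addVal_le_iff_dvd]
      rwa [← dvd_neg, neg_sub]
    rw [min_eq_right hlt.le]
    have h1 : c + ϖ * u - y = (c - y) + ϖ * u := by ring
    rw [h1]
    refine AddValuation.map_add_eq_of_lt_left _ (hlt.trans_le ?_)
    exact IsDiscreteValuationRing.addVal_le_iff_dvd.2 (dvd_mul_right _ _)

end Roots

end Hurwitz

/-! ### The action on the open disc, multipliers and simplicity of fixed points -/

namespace Hurwitz

open PowerSeries IsLocalRing IsDiscreteValuationRing

theorem X_sub_C_ne_zero {A : Type*} [CommRing A] [Nontrivial A] (y : A) :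
    (X - C y : A⟦X⟧) ≠ 0 := by
  intro h
  have := congrArg (coeff 1) h
  simp [coeff_X] at this

theorem algEquiv_C {A : Type*} [CommRing A] (ψ : A⟦X⟧ ≃ₐ[A] A⟦X⟧) (a : A) : ψ (C a) = C a :=
  ψ.commutes a

section Action

variable {G : Type*} [Group G] {S : Type*} [CommRing S] [IsDomain S] [IsDiscreteValuationRing S]
  [IsAdicComplete (maximalIdeal S) S] (Ψ : G →* (S⟦X⟧ ≃ₐ[S] S⟦X⟧))

/-- The action on the points of the open disc. -/
noncomputable def pointAct (σ : G) (y : maximalIdeal S) : maximalIdeal S :=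
  -- The inverse turns pullback of series into a left action on points.
  ⟨evalAt y (Ψ σ⁻¹ X), evalAt_mem_maximalIdeal y (algEquiv_X_mem_maximalIdeal _)⟩

theorem evalAt_pointAct (σ : G) (y : maximalIdeal S) (h : S⟦X⟧) :
    evalAt (pointAct Ψ σ y) h = evalAt y (Ψ σ⁻¹ h) := by
  have : (evalAt y).comp (Ψ σ⁻¹ : S⟦X⟧ →+* S⟦X⟧) = evalAt (pointAct Ψ σ y) := by
    refine eq_evalAt (fun a => ?_) _ rfl
    have : Ψ σ⁻¹ (C a) = C a := (Ψ σ⁻¹).commutes a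
    change evalAt y (Ψ σ⁻¹ (C a)) = a
    rw [this, evalAt_C]
  rw [← this]; rfl

theorem pointAct_one (y : maximalIdeal S) : pointAct Ψ 1 y = y := by
  ext; simp [pointAct]

theorem pointAct_mul (σ τ : G) (y : maximalIdeal S) :
    pointAct Ψ (σ * τ) y = pointAct Ψ σ (pointAct Ψ τ y) := by
  ext
  change evalAt y _ = evalAt (pointAct Ψ τ y) _
  rw [evalAt_pointAct, mul_inv_rev, map_mul]
  rfl

theorem pointAct_inv_eq_iff {σ : G} {x y : maximalIdeal S} :
    pointAct Ψ σ⁻¹ x = y ↔ x = pointAct Ψ σ y := by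
  constructor
  · rintro rfl
    rw [← pointAct_mul, mul_inv_cancel, pointAct_one]
  · rintro rfl
    rw [← pointAct_mul, inv_mul_cancel, pointAct_one]

theorem coe_pointAct_inv (σ : G) (y : maximalIdeal S) :
    (pointAct Ψ σ⁻¹ y : S) = evalAt y (Ψ σ X) := by
  simp [pointAct]

theorem sub_dvd_pointAct_sub (σ : G) (x y : maximalIdeal S) :
    (x - y : S) ∣ pointAct Ψ σ x - pointAct Ψ σ y :=
  sub_dvd_evalAt_sub x y _

theorem addVal_pointAct_sub (σ : G) (x y : maximalIdeal S) :
    addVal S (pointAct Ψ σ x - pointAct Ψ σ y : S) = addVal S (x - y : S) := by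
  refine le_antisymm ?_ (addVal_le_iff_dvd.2 (sub_dvd_pointAct_sub Ψ σ x y))
  rw [addVal_le_iff_dvd]
  have := sub_dvd_pointAct_sub Ψ σ⁻¹ (pointAct Ψ σ x) (pointAct Ψ σ y)
  rwa [(pointAct_inv_eq_iff Ψ).2 rfl, (pointAct_inv_eq_iff Ψ).2 rfl] at this

theorem pointAct_eq_self_iff {σ : G} {y : maximalIdeal S} :
    pointAct Ψ σ y = y ↔ X - C (y : S) ∣ Ψ σ X - X := by
  rw [← evalAt_eq_zero_iff, map_sub, evalAt_X, ← coe_pointAct_inv, sub_eq_zero,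
    SetLike.coe_eq_coe, pointAct_inv_eq_iff, eq_comm]

open Classical in
/-- The multiplier of `σ` at a fixed point. -/
noncomputable def multiplier (y : maximalIdeal S) (σ : G) : S :=
  -- The derivative of σ(X) at y; the default 0 applies when y is not fixed.
  if h : X - C (y : S) ∣ Ψ σ X - C (y : S) then evalAt y h.choose else 0

theorem multiplier_eq {y : maximalIdeal S} {σ : G} {w : S⟦X⟧}
    (hw : Ψ σ X - C (y : S) = (X - C (y : S)) * w) : multiplier Ψ y σ = evalAt y w := by
  have h : X - C (y : S) ∣ Ψ σ X - C (y : S) := ⟨w, hw⟩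
  rw [multiplier, dif_pos h]
  congr 1
  refine mul_left_cancel₀ (X_sub_C_ne_zero (y : S)) ?_
  rw [← hw, ← h.choose_spec]

theorem exists_multiplier {y : maximalIdeal S} {σ : G} (h : pointAct Ψ σ y = y) :
    ∃ w, Ψ σ X - C (y : S) = (X - C (y : S)) * w := by
  have h1 : X - C (y : S) ∣ (Ψ σ X - X) + (X - C (y : S)) :=
    dvd_add ((pointAct_eq_self_iff Ψ).1 h) dvd_rfl
  rwa [sub_add_sub_cancel] at h1

theorem evalAt_map_of_pointAct_eq {y : maximalIdeal S} {σ : G} (h : pointAct Ψ σ y = y)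
    (f : S⟦X⟧) : evalAt y (Ψ σ f) = evalAt y f := by
  have h1 : pointAct Ψ σ⁻¹ y = y := (pointAct_inv_eq_iff Ψ).2 h.symm
  conv_rhs => rw [← h1]
  rw [evalAt_pointAct, inv_inv]

/-- The multiplier is multiplicative on the stabilizer of a point. -/
noncomputable def multiplierHom (y : maximalIdeal S) (H : Subgroup G)
    (hH : ∀ σ ∈ H, pointAct Ψ σ y = y) : H →* S where
  toFun σ := multiplier Ψ y σ
  map_one' := by
    rw [multiplier_eq (w := 1)]
    · simp
    · simp
  map_mul' σ τ := by
    obtain ⟨w, hw⟩ := exists_multiplier Ψ (hH σ σ.2)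
    obtain ⟨w', hw'⟩ := exists_multiplier Ψ (hH τ τ.2)
    have h : Ψ (σ * τ : H) X - C (y : S) = (X - C (y : S)) * (w * Ψ σ w') := by
      have := congrArg (Ψ σ) hw'
      rw [map_sub, map_mul, map_sub, algEquiv_C, hw] at this
      rw [Subgroup.coe_mul, map_mul, AlgEquiv.mul_apply, this, mul_assoc]
    rw [multiplier_eq Ψ hw, multiplier_eq Ψ hw', multiplier_eq Ψ h, map_mul,
      evalAt_map_of_pointAct_eq Ψ (hH σ σ.2)]

/-- The factorization of `σ(X) - X` according to its zeros. -/
def IsFactorization (σ : G) (s : Multiset (maximalIdeal S)) : Prop :=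
  ∃ u, IsUnit u ∧ Ψ σ X - X = u * (s.map fun y : maximalIdeal S => X - C (y : S)).prod

variable {Ψ} in
theorem IsFactorization.evalAt_eq {σ : G} {s : Multiset (maximalIdeal S)}
    (h : IsFactorization Ψ σ s) (x : maximalIdeal S) :
    ∃ u, IsUnit u ∧ (pointAct Ψ σ⁻¹ x - x : S) = u * (s.map fun y : maximalIdeal S => (x - y : S)).prod := by
  obtain ⟨u, hu, h⟩ := h
  refine ⟨evalAt x u, hu.map _, ?_⟩
  have := congrArg (evalAt x) h
  rw [map_sub, map_mul, evalAt_X, map_multiset_prod, Multiset.map_map] at this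
  rw [coe_pointAct_inv, this]
  simp

variable {Ψ} in
theorem IsFactorization.mem_iff {σ : G} {s : Multiset (maximalIdeal S)}
    (h : IsFactorization Ψ σ s) (x : maximalIdeal S) : x ∈ s ↔ pointAct Ψ σ x = x := by
  obtain ⟨u, hu, h⟩ := h.evalAt_eq x
  rw [eq_comm, ← pointAct_inv_eq_iff, ← SetLike.coe_eq_coe, ← sub_eq_zero, h, mul_eq_zero,
    or_iff_right hu.ne_zero, Multiset.prod_eq_zero_iff, Multiset.mem_map]
  constructor
  · exact fun hx => ⟨x, hx, sub_self _⟩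
  · rintro ⟨y, hy, hxy⟩
    rwa [show x = y from Subtype.ext (sub_eq_zero.1 hxy)]

variable [CharZero S] [Finite G]

variable {Ψ} in
/-- An automorphism of finite order is determined by its multiplier at a fixed point. -/
theorem IsFactorization.multiplier_ne_one {σ : G} {s : Multiset (maximalIdeal S)}
    (h : IsFactorization Ψ σ s) {y : maximalIdeal S} (hy : pointAct Ψ σ y = y) :
    multiplier Ψ y σ ≠ 1 := by
  classical
  intro h1
  obtain ⟨w, hw⟩ := exists_multiplier Ψ hy
  rw [multiplier_eq Ψ hw] at h1
  -- m is the multiplicity of y as a zero of σ(X) - X.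
  obtain ⟨m, u, hu, hmu⟩ : ∃ m u, evalAt y u ≠ 0 ∧ Ψ σ X - X = (X - C (y : S)) ^ m * u := by
    obtain ⟨u, hu, h⟩ := h
    refine ⟨s.count y, u * ((s.filter (· ≠ y)).map fun y : maximalIdeal S => X - C (y : S)).prod, ?_, ?_⟩
    · rw [map_mul, map_multiset_prod, Multiset.map_map]
      refine mul_ne_zero (hu.map _).ne_zero (Multiset.prod_ne_zero ?_)
      rw [Multiset.mem_map]
      rintro ⟨z, hz, hz'⟩
      refine (Multiset.mem_filter.1 hz).2 (Subtype.ext ?_)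
      simpa [sub_eq_zero, eq_comm] using hz'
    · rw [h]
      conv_lhs => rw [← Multiset.filter_add_not (· = y) s]
      rw [Multiset.filter_eq', Multiset.map_add, Multiset.prod_add, Multiset.map_replicate,
        Multiset.prod_replicate]
      ring
  -- With multiplier 1, applying σ preserves the leading coefficient u(y) at y. The images of σ(X) -
  -- X under σ^i, for i below the order n of σ, telescope to 0, so n u(y) = 0, which is impossible
  -- in characteristic zero.
  have key : ∀ i : ℕ, ∃ v, evalAt y v = evalAt y u ∧
      (Ψ σ ^ i) (Ψ σ X - X) = (X - C (y : S)) ^ m * v := by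
    intro i
    induction i with
    | zero => exact ⟨u, rfl, by simpa using hmu⟩
    | succ i ih =>
      obtain ⟨v, hv, hv'⟩ := ih
      refine ⟨w ^ m * Ψ σ v, ?_, ?_⟩
      · rw [map_mul, map_pow, h1, one_pow, one_mul, evalAt_map_of_pointAct_eq Ψ hy, hv]
      · rw [pow_succ', AlgEquiv.mul_apply, hv', map_mul, map_pow, map_sub, algEquiv_C, hw,
          mul_pow, mul_assoc]
  choose v hv hv' using key
  have hsum : ∑ i ∈ Finset.range (orderOf σ), (Ψ σ ^ i) (Ψ σ X - X) = 0 := by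
    have : ∀ i, (Ψ σ ^ i) (Ψ σ X - X) = (Ψ σ ^ (i + 1)) X - (Ψ σ ^ i) X := by
      intro i
      rw [map_sub, pow_succ, AlgEquiv.mul_apply]
    rw [Finset.sum_congr rfl fun i _ => this i, Finset.sum_range_sub (fun i => (Ψ σ ^ i) X), ← map_pow,
      pow_orderOf_eq_one, map_one]
    simp
  rw [Finset.sum_congr rfl fun i _ => hv' i, ← Finset.mul_sum, mul_eq_zero,
    or_iff_right (pow_ne_zero _ (X_sub_C_ne_zero _))] at hsum
  have := congrArg (evalAt y) hsum
  rw [map_sum, Finset.sum_congr rfl fun i _ => hv i, Finset.sum_const, Finset.card_range,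
    map_zero, nsmul_eq_mul, mul_eq_zero, or_iff_left hu, Nat.cast_eq_zero] at this
  exact (orderOf_pos σ).ne' this

-- At a multiple zero of σ(X) - X the derivative of σ(X) would be 1.
variable {Ψ} in
theorem IsFactorization.nodup {σ : G} {s : Multiset (maximalIdeal S)}
    (h : IsFactorization Ψ σ s) : s.Nodup := by
  classical
  rw [Multiset.nodup_iff_count_le_one]
  intro y
  by_contra! hc
  have hy : pointAct Ψ σ y = y := (h.mem_iff y).1 (Multiset.count_pos.1 (by omega))
  refine h.multiplier_ne_one hy ?_
  obtain ⟨t, rfl⟩ : ∃ t, s = y ::ₘ y ::ₘ t := by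
    have h1 : Multiset.replicate 2 y ≤ s := Multiset.le_count_iff_replicate_le.1 hc
    obtain ⟨t, rfl⟩ := Multiset.le_iff_exists_add.1 h1
    exact ⟨t, by simp [Multiset.replicate_succ]⟩
  obtain ⟨u, -, h⟩ := h
  rw [Multiset.map_cons, Multiset.map_cons, Multiset.prod_cons, Multiset.prod_cons] at h
  rw [multiplier_eq Ψ (w := 1 + (X - C (y : S)) * (u * (t.map fun y : maximalIdeal S => X - C (y : S)).prod))]
  · simp
  · linear_combination h

-- The multiplier minus 1 is the derivative of σ(X) - X at y, that is, a unit times the product of y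
-- - z over the other zeros z.
variable {Ψ} in
theorem IsFactorization.multiplier_sub_one [DecidableEq (maximalIdeal S)] {σ : G}
    {s : Multiset (maximalIdeal S)} (h : IsFactorization Ψ σ s) {y : maximalIdeal S}
    (hy : pointAct Ψ σ y = y) :
    addVal S (multiplier Ψ y σ - 1) = ∑ z ∈ s.toFinset.erase y, addVal S (y - z : S) := by
  have hys : y ∈ s := (h.mem_iff y).2 hy
  have hnd := h.nodup
  obtain ⟨t, rfl⟩ := Multiset.exists_cons_of_mem hys
  obtain ⟨u, hu, h⟩ := h
  rw [Multiset.map_cons, Multiset.prod_cons] at h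
  rw [multiplier_eq Ψ (w := 1 + u * (t.map fun y : maximalIdeal S => X - C (y : S)).prod)]
  · rw [map_add, map_one, add_sub_cancel_left, map_mul, map_multiset_prod, Multiset.map_map,
      AddValuation.map_mul, addVal_eq_zero_iff.2 (hu.map _), zero_add, Multiset.toFinset_cons,
      Finset.erase_insert (by simpa using (Multiset.nodup_cons.1 hnd).1), ← addVal_prod]
    congr 1
    rw [Finset.prod_eq_multiset_prod, Multiset.toFinset_val,
      (Multiset.nodup_cons.1 hnd).2.dedup]
    simp
  · linear_combination h

variable {Ψ} in
theorem IsFactorization.addVal_sub [DecidableEq (maximalIdeal S)] {σ : G}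
    {s : Multiset (maximalIdeal S)} (h : IsFactorization Ψ σ s) (x : maximalIdeal S) :
    addVal S (x - pointAct Ψ σ x : S) = ∑ z ∈ s.toFinset, addVal S (x - z : S) := by
  have h1 := addVal_pointAct_sub Ψ σ⁻¹ x (pointAct Ψ σ x)
  rw [(pointAct_inv_eq_iff Ψ).2 rfl] at h1
  obtain ⟨u, hu, h2⟩ := h.evalAt_eq x
  rw [← h1, h2, AddValuation.map_mul, addVal_eq_zero_iff.2 hu, zero_add, ← addVal_prod,
    Finset.prod_eq_multiset_prod, Multiset.toFinset_val, h.nodup.dedup]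

end Action

end Hurwitz

/-! ### Fixed point data from an action on the disc -/

namespace Hurwitz

open PowerSeries IsLocalRing
open IsDiscreteValuationRing hiding maximalIdeal

section FixedPoints

variable {G : Type*} [Group G] {S : Type*} [CommRing S] [IsDomain S] [IsDiscreteValuationRing S]
  [IsAdicComplete (maximalIdeal S) S] {Ψ : G →* (S⟦X⟧ ≃ₐ[S] S⟦X⟧)}
  {s : G → Multiset (maximalIdeal S)} {Δ : Type} [Fintype Δ] [DecidableEq Δ] [MulAction G Δ]
  {pt : Δ → maximalIdeal S}

theorem map_filter_smul_eq [DecidableEq (maximalIdeal S)] (hinj : Function.Injective pt)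
    (hsmul : ∀ (σ : G) i, pt (σ • i) = pointAct Ψ σ (pt i))
    (hrange : ∀ y, y ∈ Set.range pt ↔ ∃ σ : G, σ ≠ 1 ∧ pointAct Ψ σ y = y)
    {σ : G} (hσ : σ ≠ 1) (hs : IsFactorization Ψ σ (s σ)) :
    (Finset.univ.filter fun i => σ • i = i).image pt = (s σ).toFinset := by
  ext y
  rw [Finset.mem_image, Multiset.mem_toFinset, hs.mem_iff]
  constructor
  · rintro ⟨i, hi, rfl⟩
    rw [← hsmul, (Finset.mem_filter.1 hi).2]
  · intro hy
    obtain ⟨i, rfl⟩ := (hrange y).2 ⟨σ, hσ, hy⟩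
    exact ⟨i, Finset.mem_filter.2 ⟨Finset.mem_univ _, hinj (by rw [hsmul, hy])⟩, rfl⟩

theorem sum_filter_smul_eq [DecidableEq (maximalIdeal S)] (hinj : Function.Injective pt)
    (hsmul : ∀ (σ : G) i, pt (σ • i) = pointAct Ψ σ (pt i))
    (hrange : ∀ y, y ∈ Set.range pt ↔ ∃ σ : G, σ ≠ 1 ∧ pointAct Ψ σ y = y)
    {σ : G} (hσ : σ ≠ 1) (hs : IsFactorization Ψ σ (s σ)) (f : maximalIdeal S → ℕ∞) :
    ∑ i with σ • i = i, f (pt i) = ∑ z ∈ (s σ).toFinset, f z := by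
  rw [← map_filter_smul_eq hinj hsmul hrange hσ hs, Finset.sum_image hinj.injOn]

variable [CharZero S] [Finite G]

/-- The multiplier is injective on the subgroup generated by σ, all of which fixes y. -/
theorem orderOf_multiplier (hs : ∀ σ, σ ≠ 1 → IsFactorization Ψ σ (s σ)) {y : maximalIdeal S}
    {σ : G} (hy : pointAct Ψ σ y = y) : orderOf (multiplier Ψ y σ) = orderOf σ := by
  have hH : ∀ τ ∈ Subgroup.zpowers σ, pointAct Ψ τ y = y := by
    have hle : Subgroup.zpowers σ ≤ Subgroup.closure {σ} := by rw [Subgroup.zpowers_eq_closure]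
    intro τ hτ
    replace hτ := hle hτ
    induction hτ using Subgroup.closure_induction with
    | mem τ h => rwa [Set.mem_singleton_iff.1 h]
    | one => exact pointAct_one Ψ y
    | mul τ ρ _ _ h1 h2 => rw [pointAct_mul, h2, h1]
    | inv τ _ h => rw [pointAct_inv_eq_iff, h]
  have hinj : Function.Injective (multiplierHom Ψ y _ hH) := by
    rw [injective_iff_map_eq_one]
    intro τ hτ
    by_contra h
    exact (hs τ fun h' => h (Subtype.ext h')).multiplier_ne_one (hH τ τ.2) hτ
  have := orderOf_injective _ hinj ⟨σ, Subgroup.mem_zpowers σ⟩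
  rw [Subgroup.orderOf_mk] at this
  exact this

/-- The multiplier embeds H into the multiplicative monoid of the domain S, and a finite group so
embedded is cyclic. -/
theorem isCyclic_of_forall_pointAct_eq (hs : ∀ σ, σ ≠ 1 → IsFactorization Ψ σ (s σ))
    {y : maximalIdeal S} (H : Subgroup G) (hH : ∀ τ ∈ H, pointAct Ψ τ y = y) : IsCyclic H := by
  refine isCyclic_of_injective_ringHom (f := multiplierHom Ψ y H hH) ?_
  rw [injective_iff_map_eq_one]
  intro τ hτ
  by_contra h
  exact (hs τ fun h' => h (Subtype.ext h')).multiplier_ne_one (hH τ τ.2) hτ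

open Classical in
/-- The points of the open disc with a nontrivial stabilizer. -/
noncomputable def FixedPointData.ofPoints [Infinite (ResidueField S)] {p : ℕ} (hp : p.Prime)
    (hpS : (p : S) ∈ maximalIdeal S) (hs : ∀ σ, σ ≠ 1 → IsFactorization Ψ σ (s σ))
    [hne : Nonempty Δ] (hinj : Function.Injective pt)
    (hsmul : ∀ (σ : G) i, pt (σ • i) = pointAct Ψ σ (pt i))
    (hrange : ∀ y, y ∈ Set.range pt ↔ ∃ σ : G, σ ≠ 1 ∧ pointAct Ψ σ y = y) :
    FixedPointData G p Δ where
  d x y := addVal S (pt x - pt y : S)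
  e := (addVal S (p : S)).toNat
  e_pos := by
    rw [Nat.pos_iff_ne_zero, ne_eq, ENat.toNat_eq_zero, not_or, addVal_eq_zero_iff,
      addVal_eq_top_iff, Nat.cast_eq_zero]
    exact ⟨hpS, hp.ne_zero⟩
  nonempty := hne
  d_eq_top x y := by
    rw [addVal_eq_top_iff, sub_eq_zero, SetLike.coe_eq_coe, hinj.eq_iff]
  d_pos x y := by
    rw [pos_iff_ne_zero, ne_eq, addVal_eq_zero_iff]
    exact (sub_mem (pt x).2 (pt y).2 : _)
  d_symm x y := AddValuation.map_sub_swap _ _ _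
  d_ultra x y z := by
    rw [← sub_add_sub_cancel (pt x : S) (pt y) (pt z)]
    exact AddValuation.map_add _ _ _
  d_smul g x y := by rw [hsmul, hsmul, addVal_pointAct_sub]
  stabilizer_ne_bot y := by
    obtain ⟨σ, hσ, h⟩ := (hrange _).1 ⟨y, rfl⟩
    exact fun hbot => hσ ((Subgroup.eq_bot_iff_forall _).1 hbot σ (hinj (by rw [hsmul, h])))
  isCyclic_stabilizer y := by
    refine isCyclic_of_forall_pointAct_eq hs (y := pt y) _ fun τ hτ => ?_
    rw [← hsmul, MulAction.mem_stabilizer_iff.1 hτ]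
  d_smul_self σ hσ x := by
    rw [sum_filter_smul_eq hinj hsmul hrange hσ (hs σ hσ) fun z => addVal S (pt x - z : S), hsmul,
      (hs σ hσ).addVal_sub]
  min_sum_le σ τ hσ hτ hστ c c' := by
    have hsum : ∀ ρ : G, ρ ≠ 1 → ∑ y with ρ • y = y,
        min (addVal S (pt c - pt c' : S)) (addVal S (pt c - pt y : S)) =
        ∑ z ∈ (s ρ).toFinset, min (addVal S (pt c - pt c' : S)) (addVal S (pt c - z : S)) :=
      fun ρ hρ => sum_filter_smul_eq hinj hsmul hrange hρ (hs ρ hρ) fun z =>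
        min (addVal S (pt c - pt c' : S)) (addVal S (pt c - z : S))
    rw [hsum σ hσ, hsum τ hτ, hsum _ hστ]
    -- At a generic point x the three sums become v(x - ρx) for ρ = σ, τ, στ, and σx - στx has the
    -- valuation of x - τx because σ is an isometry.
    obtain ⟨x, hx, hxy⟩ := exists_generic_point
      (((s σ).toFinset ∪ (s τ).toFinset ∪ (s (σ * τ)).toFinset).image
        (fun y : maximalIdeal S => (y : S))) (pt c : S) (pt c')
    have hxm : x ∈ maximalIdeal S := by
      rw [← sub_add_cancel x (pt c : S)]
      exact add_mem (Ideal.mem_of_dvd _ hx (sub_mem (pt c).2 (pt c').2)) (pt c).2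
    have hval : ∀ ρ : G, ρ ≠ 1 → (s ρ).toFinset ⊆
        (s σ).toFinset ∪ (s τ).toFinset ∪ (s (σ * τ)).toFinset →
        ∑ z ∈ (s ρ).toFinset, min (addVal S (pt c - pt c' : S)) (addVal S (pt c - z : S)) =
          addVal S (x - pointAct Ψ ρ ⟨x, hxm⟩ : S) := by
      intro ρ hρ hsub
      rw [(hs ρ hρ).addVal_sub ⟨x, hxm⟩]
      exact Finset.sum_congr rfl fun z hz => (hxy z (Finset.mem_image_of_mem _ (hsub hz))).symm
    have h1 := addVal_pointAct_sub Ψ σ ⟨x, hxm⟩ (pointAct Ψ τ ⟨x, hxm⟩)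
    rw [← pointAct_mul] at h1
    rw [hval σ hσ (fun z hz => by simp_all), hval τ hτ (fun z hz => by simp_all),
      hval _ hστ (fun z hz => by simp_all), ← h1]
    have h2 := AddValuation.map_add (addVal S) (x - pointAct Ψ σ ⟨x, hxm⟩ : S)
      (pointAct Ψ σ ⟨x, hxm⟩ - pointAct Ψ (σ * τ) ⟨x, hxm⟩ : S)
    rwa [sub_add_sub_cancel] at h2
  sum_of_orderOf σ y hy i hi := by
    have hσ : σ ≠ 1 := by
      rintro rfl
      rw [orderOf_one] at hi
      exact (Nat.one_lt_pow i.succ_ne_zero hp.one_lt).ne hi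
    have hy' : pointAct Ψ σ (pt y) = pt y := by rw [← hsmul, hy]
    have h1 := (hs σ hσ).multiplier_sub_one hy'
    rw [← map_filter_smul_eq hinj hsmul hrange hσ (hs σ hσ), ← Finset.image_erase hinj,
      Finset.sum_image hinj.injOn] at h1
    have h2 : (Finset.univ.filter fun x => σ • x = x ∧ x ≠ y) =
        (Finset.univ.filter fun i => σ • i = i).erase y := by
      ext x; simp [and_comm]
    rw [h2, ← h1, mul_addVal_sub_one hp (by rw [orderOf_multiplier hs hy', hi]), ENat.natCast_toNat]
    rw [ne_eq, addVal_eq_top_iff, Nat.cast_eq_zero]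
    exact hp.ne_zero
  sum_of_orderOf_ne σ y hy hi := by
    have hσ : σ ≠ 1 := by
      rintro rfl
      exact hi 0 (by simp)
    have hy' : pointAct Ψ σ (pt y) = pt y := by rw [← hsmul, hy]
    have h1 := (hs σ hσ).multiplier_sub_one hy'
    rw [← map_filter_smul_eq hinj hsmul hrange hσ (hs σ hσ), ← Finset.image_erase hinj,
      Finset.sum_image hinj.injOn] at h1
    have h2 : (Finset.univ.filter fun x => σ • x = x ∧ x ≠ y) =
        (Finset.univ.filter fun i => σ • i = i).erase y := by
      ext x; simp [and_comm]
    have ho := orderOf_multiplier hs hy'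
    rw [h2, ← h1]
    refine addVal_sub_one_eq_zero hp hpS ?_ fun i => ?_
    · rw [ho]; exact (orderOf_pos σ).ne'
    · rw [ho]; exact hi i

theorem exists_fixedPointData [Infinite (ResidueField S)] {p : ℕ} (hp : p.Prime)
    (hpS : (p : S) ∈ maximalIdeal S) (hs : ∀ σ, σ ≠ 1 → IsFactorization Ψ σ (s σ))
    (hne : ∃ σ, σ ≠ 1 ∧ s σ ≠ 0) :
    ∃ (n : ℕ) (_ : MulAction G (Fin n)) (_ : FixedPointData G p (Fin n)),
      ∀ σ : G, σ ≠ 1 → (Finset.univ.filter fun i : Fin n => σ • i = i).card = (s σ).card := by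
  classical
  let Z : Set (maximalIdeal S) := {y | ∃ σ : G, σ ≠ 1 ∧ pointAct Ψ σ y = y}
  have hZ : Finite Z := by
    have : Z ⊆ ⋃ σ : {σ : G // σ ≠ 1}, ((s σ).toFinset : Set (maximalIdeal S)) := by
      rintro y ⟨σ, hσ, hy⟩
      exact Set.mem_iUnion.2 ⟨⟨σ, hσ⟩, Multiset.mem_toFinset.2 (((hs σ hσ).mem_iff y).2 hy)⟩
    exact (Set.finite_iUnion fun _ => Finset.finite_toSet _).subset this
  have hact : ∀ (σ : G) (y : Z), pointAct Ψ σ y ∈ Z := by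
    rintro τ ⟨y, σ, hσ, hy⟩
    refine ⟨τ * σ * τ⁻¹, fun h => hσ (conj_eq_one_iff.1 h), ?_⟩
    change pointAct Ψ _ (pointAct Ψ τ y) = pointAct Ψ τ y
    rw [pointAct_mul, pointAct_mul, (pointAct_inv_eq_iff Ψ).2 rfl, hy]
  -- The points are numbered because the vertices of the tree must lie in `Type`, whereas S may live
  -- in another universe.
  obtain ⟨n, ⟨e⟩⟩ := Finite.exists_equiv_fin Z
  let _ : MulAction G (Fin n) :=
    { smul := fun σ i => e ⟨pointAct Ψ σ (e.symm i), hact σ _⟩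
      one_smul := fun i => by
        change e ⟨pointAct Ψ 1 (e.symm i), _⟩ = i
        simp [pointAct_one]
      mul_smul := fun σ τ i => by
        change e _ = e ⟨pointAct Ψ σ (e.symm (e _)), _⟩
        simp [pointAct_mul] }
  let pt : Fin n → maximalIdeal S := fun i => e.symm i
  have hinj : Function.Injective pt := Subtype.val_injective.comp e.symm.injective
  have hsmul : ∀ (σ : G) i, pt (σ • i) = pointAct Ψ σ (pt i) := by
    intro σ i
    change ((e.symm (e _) : Z) : maximalIdeal S) = _
    rw [Equiv.symm_apply_apply]
  have hrange : ∀ y, y ∈ Set.range pt ↔ ∃ σ : G, σ ≠ 1 ∧ pointAct Ψ σ y = y := by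
    intro y
    constructor
    · rintro ⟨i, rfl⟩; exact (e.symm i).2
    · intro hy; exact ⟨e ⟨y, hy⟩, by simp [pt]⟩
  have : Nonempty (Fin n) := by
    obtain ⟨σ, hσ, h⟩ := hne
    obtain ⟨y, hy⟩ := Multiset.exists_mem_of_ne_zero h
    exact ⟨e ⟨y, σ, hσ, ((hs σ hσ).mem_iff y).1 hy⟩⟩
  refine ⟨n, inferInstance, FixedPointData.ofPoints hp hpS hs hinj hsmul hrange, fun σ hσ => ?_⟩
  rw [← Finset.card_image_of_injective _ hinj,
    map_filter_smul_eq hinj hsmul hrange hσ (hs σ hσ), Multiset.toFinset_card_of_nodup (hs σ hσ).nodup]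

end FixedPoints

end Hurwitz

/-! ### Complete and splitting extensions of discrete valuation rings -/

namespace Hurwitz

open IsLocalRing

universe u

section Completion

/-- n is the largest exponent such that x lies in the n-th power of the maximal ideal; it exists
since these powers intersect in 0. -/
theorem exists_eq_pow_mul_unit {A : Type*} [CommRing A] [IsLocalRing A]
    [IsHausdorff (maximalIdeal A) A] {ϖ : A} (hm : maximalIdeal A = Ideal.span {ϖ}) {x : A}
    (hx : x ≠ 0) : ∃ (n : ℕ) (y : A), IsUnit y ∧ x = ϖ ^ n * y := by
  classical
  have hex : ∃ n, x ∉ maximalIdeal A ^ n := by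
    by_contra! h
    refine hx (IsHausdorff.haus (I := maximalIdeal A) inferInstance x fun n => ?_)
    rw [SModEq.zero]
    simpa using h n
  have h1 := Nat.find_spec hex
  have h0 : Nat.find hex ≠ 0 := by
    intro h
    rw [h] at h1
    simp at h1
  obtain ⟨n, hn⟩ := Nat.exists_eq_succ_of_ne_zero h0
  have h2 : x ∈ maximalIdeal A ^ n := by
    by_contra h
    exact Nat.find_min hex (m := n) (by omega) h
  rw [hn] at h1
  rw [hm, Ideal.span_singleton_pow, Ideal.mem_span_singleton] at h1 h2
  obtain ⟨y, rfl⟩ := h2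
  refine ⟨n, y, ?_, rfl⟩
  by_contra hy
  have hy' : y ∈ maximalIdeal A := hy
  rw [hm, Ideal.mem_span_singleton] at hy'
  exact h1 (by rw [pow_succ]; exact mul_dvd_mul_left _ hy')

theorem isDomain_of_maximalIdeal_eq_span {A : Type*} [CommRing A] [IsLocalRing A]
    [IsHausdorff (maximalIdeal A) A] {ϖ : A} (hm : maximalIdeal A = Ideal.span {ϖ})
    (h0 : ∀ n : ℕ, ϖ ^ n ≠ 0) : IsDomain A := by
  have : NoZeroDivisors A := by
    refine ⟨fun {a b} hab => ?_⟩
    by_contra! h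
    obtain ⟨n, y, hy, rfl⟩ := exists_eq_pow_mul_unit hm h.1
    obtain ⟨n', y', hy', rfl⟩ := exists_eq_pow_mul_unit hm h.2
    apply h0 (n + n')
    rw [← (hy.mul hy').mul_left_eq_zero, ← hab]
    ring
  exact NoZeroDivisors.to_isDomain A

theorem isDiscreteValuationRing_of_maximalIdeal_eq_span {A : Type*} [CommRing A] [IsLocalRing A]
    [IsHausdorff (maximalIdeal A) A] [IsDomain A] {ϖ : A}
    (hm : maximalIdeal A = Ideal.span {ϖ}) (h0 : ϖ ≠ 0) : IsDiscreteValuationRing A := by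
  refine IsDiscreteValuationRing.ofHasUnitMulPowIrreducibleFactorization ⟨ϖ, ?_, fun {x} hx => ?_⟩
  · exact ((Ideal.span_singleton_prime h0).1 (hm ▸ inferInstance)).irreducible
  · obtain ⟨n, y, hy, rfl⟩ := exists_eq_pow_mul_unit hm hx
    exact ⟨n, hy.unit, rfl⟩

/-- A discrete valuation ring embeds into a complete one. -/
theorem exists_complete_extension (R : Type u) [CommRing R] [IsDomain R]
    [IsDiscreteValuationRing R] :
    ∃ (S : Type u) (_ : CommRing S) (_ : IsDomain S) (_ : IsDiscreteValuationRing S)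
      (_ : IsAdicComplete (maximalIdeal S) S) (F : R →+* S),
      Function.Injective F ∧ IsLocalHom F := by
  let S := AdicCompletion (maximalIdeal R) R
  let F := algebraMap R S
  have hF : Function.Injective F := AdicCompletion.of_injective (maximalIdeal R) R
  obtain ⟨ϖ, hϖ⟩ := IsDiscreteValuationRing.exists_irreducible R
  have hm : maximalIdeal S = Ideal.span {F ϖ} := by
    refine AdicCompletion.maximalIdeal_eq_map.trans ?_
    refine (congrArg (Ideal.map F) hϖ.maximalIdeal_eq).trans ?_
    rw [Ideal.map_span, Set.image_singleton]
  have h0 : ∀ n : ℕ, F ϖ ^ n ≠ 0 := fun n => by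
    rw [← map_pow, ne_eq, map_eq_zero_iff F hF]
    exact pow_ne_zero _ hϖ.ne_zero
  have : IsDomain S := isDomain_of_maximalIdeal_eq_span hm h0
  exact ⟨S, inferInstance, this, isDiscreteValuationRing_of_maximalIdeal_eq_span hm
    (by simpa using h0 1), inferInstance, F, hF, inferInstanceAs (IsLocalHom (algebraMap R S))⟩

end Completion

section Splitting

theorem exists_multiset_of_splits_of_monic {R L : Type*} [CommRing R] [Field L] [Algebra R L]
    {g : Polynomial R} (hg : g.Monic) (hs : (g.map (algebraMap R L)).Splits) :
    ∃ t : Multiset (integralClosure R L),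
      g.map (algebraMap R (integralClosure R L)) =
        (t.map fun y => Polynomial.X - Polynomial.C y).prod := by
  have hroots : ∀ r ∈ (g.map (algebraMap R L)).roots, r ∈ integralClosure R L := by
    intro r hr
    refine ⟨g, hg, ?_⟩
    have := (Polynomial.mem_roots'.1 hr).2
    rwa [Polynomial.IsRoot, Polynomial.eval_map] at this
  refine ⟨(g.map (algebraMap R L)).roots.attach.map fun r => ⟨r.1, hroots r.1 r.2⟩, ?_⟩
  apply Polynomial.map_injective (algebraMap (integralClosure R L) L) Subtype.val_injective
  rw [Polynomial.map_map, ← IsScalarTower.algebraMap_eq, Polynomial.map_multiset_prod,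
    Multiset.map_map, Multiset.map_map]
  refine (hs.eq_prod_roots_of_monic (hg.map _)).trans ?_
  conv_lhs => rw [← Multiset.attach_map_val (g.map (algebraMap R L)).roots, Multiset.map_map]
  congr 1
  refine Multiset.map_congr rfl fun r _ => ?_
  simp

/-- S is the localization, at a prime above the maximal ideal, of the integral closure of R in a
splitting field of g. This closure is Dedekind, the field extension being separable in
characteristic zero, and it contains the roots because g is monic. -/
theorem exists_splitting_extension {R : Type u} [CommRing R] [IsDomain R]
    [IsDiscreteValuationRing R] [CharZero R] {g : Polynomial R} (hg : g.Monic) :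
    ∃ (S : Type u) (_ : CommRing S) (_ : IsDomain S) (_ : IsDiscreteValuationRing S)
      (F : R →+* S), Function.Injective F ∧ IsLocalHom F ∧ ∃ t : Multiset S,
        g.map F = (t.map fun y => Polynomial.X - Polynomial.C y).prod := by
  let K := FractionRing R
  let L := (g.map (algebraMap R K)).SplittingField
  let B := integralClosure R L
  have : CharZero K := charZero_of_injective_algebraMap (IsFractionRing.injective R K)
  have hsp : (g.map (algebraMap R L)).Splits := by
    have := Polynomial.SplittingField.splits (g.map (algebraMap R K))
    rwa [Polynomial.map_map, ← IsScalarTower.algebraMap_eq] at this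
  obtain ⟨t, ht⟩ := exists_multiset_of_splits_of_monic hg hsp
  have hRL : Function.Injective (algebraMap R L) := by
    rw [IsScalarTower.algebraMap_eq R K L]
    exact (algebraMap K L).injective.comp (IsFractionRing.injective R K)
  have hRB : Function.Injective (algebraMap R B) := by
    have : Function.Injective (algebraMap B L ∘ algebraMap R B) := by
      rwa [← RingHom.coe_comp, ← IsScalarTower.algebraMap_eq]
    exact this.of_comp
  have : Module.IsTorsionFree R B := by
    rwa [Module.isTorsionFree_iff_algebraMap_injective]
  have hD : IsDedekindDomain B := integralClosure.isDedekindDomain R K L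
  obtain ⟨P, hP, hPm⟩ := Ideal.exists_ideal_over_maximal_of_isIntegral (S := B) (maximalIdeal R)
    (by rw [(RingHom.injective_iff_ker_eq_bot _).1 hRB]; exact bot_le)
  have hP0 : P ≠ ⊥ := by
    rintro rfl
    rw [← RingHom.ker, (RingHom.injective_iff_ker_eq_bot _).1 hRB] at hPm
    exact IsDiscreteValuationRing.not_a_field R hPm.symm
  let S := Localization.AtPrime P
  have : IsDomain S := IsLocalization.isDomain_localization P.primeCompl_le_nonZeroDivisors
  have hS : IsDiscreteValuationRing S :=
    IsLocalization.AtPrime.isDiscreteValuationRing_of_dedekind_domain B hP0 S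
  have hBS : Function.Injective (algebraMap B S) :=
    IsLocalization.injective S P.primeCompl_le_nonZeroDivisors
  refine ⟨S, inferInstance, this, hS, (algebraMap B S).comp (algebraMap R B), hBS.comp hRB,
    ⟨fun a ha => ?_⟩, t.map (algebraMap B S), ?_⟩
  · by_contra h
    have h1 : a ∈ maximalIdeal R := h
    rw [← hPm, Ideal.mem_comap, ← IsLocalization.AtPrime.to_map_mem_maximal_iff S P] at h1
    exact h1 ha
  · rw [← Polynomial.map_map, ht, Polynomial.map_multiset_prod, Multiset.map_map, Multiset.map_map]
    refine congrArg Multiset.prod (Multiset.map_congr rfl fun y _ => ?_)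
    simp only [Function.comp_apply, Polynomial.map_sub, Polynomial.map_X, Polynomial.map_C]

end Splitting

end Hurwitz

/-! ### Linear factorization of power series, and extension of scalars -/

namespace Hurwitz

open IsLocalRing PowerSeries

universe u

theorem exists_isUnit_coeff {A : Type*} [CommRing A] [IsLocalRing A] {f : A⟦X⟧} :
    f.map (residue A) ≠ 0 ↔ ∃ n, IsUnit (coeff n f) := by
  rw [ne_eq, PowerSeries.ext_iff, not_forall]
  refine exists_congr fun n => ?_
  rw [coeff_map, map_zero, ← ne_eq, residue_ne_zero_iff_isUnit]

theorem order_eq_order_of_forall_coeff {A B : Type*} [CommRing A] [CommRing B] {f : A⟦X⟧}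
    {g : B⟦X⟧} (h : ∀ n, coeff n f = 0 ↔ coeff n g = 0) : f.order = g.order :=
  le_antisymm (le_order _ _ fun n hn => (h n).1 (coeff_of_lt_order n hn))
    (le_order _ _ fun n hn => (h n).2 (coeff_of_lt_order n hn))

/-- Finitely many power series split into linear factors over an extension. -/
theorem exists_linear_factorization {R : Type u} [CommRing R] [IsDomain R]
    [IsDiscreteValuationRing R] [CharZero R] {ι : Type*} [Finite ι] (f : ι → R⟦X⟧)
    (hf : ∀ i, (f i).map (residue R) ≠ 0) :
    ∃ (S : Type u) (_ : CommRing S) (_ : IsDomain S) (_ : IsDiscreteValuationRing S)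
      (_ : IsAdicComplete (maximalIdeal S) S) (F : R →+* S),
      Function.Injective F ∧ IsLocalHom F ∧ ∀ i, ∃ (s : Multiset (maximalIdeal S)) (u : S⟦X⟧),
        IsUnit u ∧ (f i).map F =
          u * (s.map fun y : maximalIdeal S => (X - C (y : S) : S⟦X⟧)).prod ∧
        s.card = ((f i).map (residue R)).order.toNat := by
  classical
  cases nonempty_fintype ι
  -- Weierstrass preparation requires completeness, and the splitting extension need not be
  -- complete, whence a second completion at the end.
  obtain ⟨R₁, _, _, _, _, F₁, hF₁, _⟩ := exists_complete_extension R
  have : CharZero R₁ := charZero_of_injective_ringHom hF₁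
  have hf₁ : ∀ i, ((f i).map F₁).map (residue R₁) ≠ 0 := by
    intro i
    obtain ⟨n, hn⟩ := exists_isUnit_coeff.1 (hf i)
    exact exists_isUnit_coeff.2 ⟨n, by rw [coeff_map]; exact hn.map F₁⟩
  choose P h H using fun i => exists_isWeierstrassFactorization (hf₁ i)
  have hmonic : (∏ i, P i).Monic :=
    Polynomial.monic_prod_of_monic _ _ fun i _ => (H i).isDistinguishedAt.monic
  obtain ⟨R₂, _, _, _, F₂, hF₂, _, t, ht⟩ := exists_splitting_extension hmonic
  obtain ⟨S, _, _, _, _, F₃, hF₃, _⟩ := exists_complete_extension R₂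
  refine ⟨S, inferInstance, inferInstance, inferInstance, inferInstance, F₃.comp (F₂.comp F₁),
    hF₃.comp (hF₂.comp hF₁), inferInstance, fun i => ?_⟩
  have hsplit : ((P i).map (F₃.comp F₂)).Splits := by
    have h1 : ((∏ i, P i).map (F₃.comp F₂)).Splits := by
      rw [← Polynomial.map_map, ht, Polynomial.map_multiset_prod]
      refine Polynomial.Splits.multisetProd fun q hq => ?_
      rw [Multiset.map_map, Multiset.mem_map] at hq
      obtain ⟨y, -, rfl⟩ := hq
      simp
    refine h1.of_dvd (hmonic.map _).ne_zero ?_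
    exact Polynomial.map_dvd _ (Finset.dvd_prod_of_mem _ (Finset.mem_univ i))
  have hP := (H i).isDistinguishedAt.monic
  -- The leading power of a root r is minus a combination of the lower coefficients, which lie in
  -- the maximal ideal because the polynomial is distinguished.
  have hroots : ∀ r ∈ ((P i).map (F₃.comp F₂)).roots, r ∈ maximalIdeal S := by
    intro r hr
    have h1 := (Polynomial.mem_roots'.1 hr).2
    rw [Polynomial.IsRoot, Polynomial.eval_map, Polynomial.eval₂_eq_sum_range,
      Finset.sum_range_succ, hP.coeff_natDegree, map_one, one_mul] at h1
    have h2 : r ^ (P i).natDegree ∈ maximalIdeal S := by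
      rw [← neg_eq_of_add_eq_zero_right h1]
      refine neg_mem (Ideal.sum_mem _ fun j hj => Ideal.mul_mem_right _ _ ?_)
      have h3 := (H i).isDistinguishedAt.mem (Finset.mem_range.1 hj)
      exact map_nonunit (F₃.comp F₂) _ h3
    exact Ideal.IsPrime.mem_of_pow_mem inferInstance _ h2
  refine ⟨((P i).map (F₃.comp F₂)).roots.attach.map fun r => ⟨r.1, hroots r.1 r.2⟩,
    (h i).map (F₃.comp F₂), (H i).isUnit.map _, ?_, ?_⟩
  · have h1 := congrArg (PowerSeries.map (F₃.comp F₂)) (H i).eq_mul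
    rw [map_mul, mul_comm, ← Polynomial.polynomial_map_coe, hsplit.eq_prod_roots_of_monic (hP.map _)] at h1
    refine h1.trans (congrArg _ ?_)
    rw [Multiset.map_map]
    conv_lhs => rw [← Multiset.attach_map_val ((P i).map (F₃.comp F₂)).roots, Multiset.map_map]
    rw [← Polynomial.coeToPowerSeries.ringHom_apply, map_multiset_prod, Multiset.map_map]
    refine congrArg Multiset.prod (Multiset.map_congr rfl fun y _ => ?_)
    simp
  · rw [Multiset.card_map, Multiset.card_attach, ← hsplit.natDegree_eq_card_roots,
      hP.natDegree_map, (H i).natDegree_eq_toNat_order_map]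
    congr 1
    refine order_eq_order_of_forall_coeff fun n => ?_
    simp only [coeff_map, residue_eq_zero_iff, mem_maximalIdeal, mem_nonunits_iff, isUnit_map_iff]

/-- Extension of scalars for an action on a power series ring. -/
theorem exists_extension_of_action {G R S : Type*} [Group G] [CommRing R] [IsLocalRing R]
    [CommRing S] [IsLocalRing S] [IsNoetherianRing S] [IsAdicComplete (maximalIdeal S) S]
    (F : R →+* S) [IsLocalHom F] (Φ : G →* (R⟦X⟧ ≃ₐ[R] R⟦X⟧)) :
    ∃ Ψ : G →* (S⟦X⟧ ≃ₐ[S] S⟦X⟧), ∀ σ, Ψ σ X = (Φ σ X).map F := by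
  have hmem : ∀ {f : R⟦X⟧}, f ∈ maximalIdeal R⟦X⟧ → f.map F ∈ maximalIdeal S⟦X⟧ := by
    intro f hf
    rw [mem_maximalIdeal_powerSeries_iff] at hf ⊢
    rw [← coeff_zero_eq_constantCoeff_apply, coeff_map, coeff_zero_eq_constantCoeff_apply]
    exact map_nonunit F _ hf
  have hΦ := fun σ => algEquiv_X_mem_maximalIdeal (Φ σ)
  choose ψ hψ using fun σ => exists_algHom_X_eq (maximalIdeal S) ((Φ σ X).map F)
    (mem_maximalIdeal_powerSeries_iff.1 (hmem (hΦ σ)))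
  have hcomm : ∀ σ f, ψ σ (f.map F) = (Φ σ f).map F := by
    intro σ f
    have : (ψ σ : S⟦X⟧ →+* S⟦X⟧).comp (PowerSeries.map F) =
        (PowerSeries.map F).comp (Φ σ : R⟦X⟧ →+* R⟦X⟧) := by
      refine ringHom_powerSeries_ext (fun a => ?_) ?_ ?_
      · have h1 : Φ σ (C a) = C a := (Φ σ).commutes a
        have h2 : ψ σ (C (F a)) = C (F a) := (ψ σ).commutes (F a)
        change ψ σ (PowerSeries.map F (C a)) = PowerSeries.map F (Φ σ (C a))
        rw [map_C, h1, h2, map_C]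
      · change ψ σ (PowerSeries.map F X) = PowerSeries.map F (Φ σ X)
        rw [map_X, hψ]
      · change ψ σ (PowerSeries.map F X) ∈ _
        rw [map_X, hψ]
        exact hmem (hΦ σ)
    exact congrArg (fun g : R⟦X⟧ →+* S⟦X⟧ => g f) this
  have hmul : ∀ σ τ, (ψ σ).comp (ψ τ) = ψ (σ * τ) := by
    intro σ τ
    have hX : ((ψ σ).comp (ψ τ)) X = ψ (σ * τ) X := by
      rw [AlgHom.comp_apply, hψ, hcomm, hψ, map_mul, AlgEquiv.mul_apply]
    refine algHom_powerSeries_ext hX ?_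
    rw [hX, hψ]
    exact hmem (hΦ _)
  have hone : ψ 1 = AlgHom.id S S⟦X⟧ := by
    have hX : ψ 1 X = AlgHom.id S S⟦X⟧ X := by
      rw [hψ, map_one, AlgEquiv.one_apply, map_X, AlgHom.id_apply]
    refine algHom_powerSeries_ext hX ?_
    rw [hX]
    exact X_mem_maximalIdeal
  refine ⟨{ toFun := fun σ => AlgEquiv.ofAlgHom (ψ σ) (ψ σ⁻¹) ?_ ?_
            map_one' := ?_
            map_mul' := fun σ τ => ?_ }, fun σ => hψ σ⟩
  · rw [hmul, mul_inv_cancel, hone]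
  · rw [hmul, inv_mul_cancel, hone]
  · ext1 f
    exact congrArg (fun g : S⟦X⟧ →ₐ[S] S⟦X⟧ => g f) hone
  · ext1 f
    exact (congrArg (fun g : S⟦X⟧ →ₐ[S] S⟦X⟧ => g f) (hmul σ τ)).symm

end Hurwitz

/-! ### From a lift to a Hurwitz tree -/

namespace Hurwitz

open IsLocalRing PowerSeries

theorem sum_artinCharacter {G k : Type*} [Group G] [Fintype G] [Field k]
    (φ : G →* (k⟦X⟧ ≃ₐ[k] k⟦X⟧)) : ∑ σ, artinCharacter φ σ = 0 := by
  classical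
  rw [← Finset.add_sum_erase _ _ (Finset.mem_univ 1)]
  simp only [artinCharacter, if_true]
  rw [Finset.sum_congr rfl fun c hc => if_neg (Finset.ne_of_mem_erase hc), Finset.sum_neg_distrib,
    add_neg_cancel]

theorem map_X_sub_X_ne_zero {G k : Type*} [Group G] [Field k] {φ : G →* (k⟦X⟧ ≃ₐ[k] k⟦X⟧)}
    (hφ : Function.Injective φ) {σ : G} (hσ : σ ≠ 1) : φ σ X - X ≠ 0 := by
  intro h
  refine hσ (hφ ?_)
  rw [map_one]
  have : (φ σ : k⟦X⟧ →ₐ[k] k⟦X⟧) = AlgHom.id k k⟦X⟧ :=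
    algHom_powerSeries_ext (sub_eq_zero.1 h) (algEquiv_X_mem_maximalIdeal _)
  ext1 f
  exact congrArg (fun g : k⟦X⟧ →ₐ[k] k⟦X⟧ => g f) this

/-- The series σ(X) - X is nonzero without constant term, so its order is finite and positive. For
the lift this means that σ has a fixed point, so that Δ is not empty. -/
theorem ramificationOrder_ne_zero {G k : Type*} [Group G] [Field k]
    {φ : G →* (k⟦X⟧ ≃ₐ[k] k⟦X⟧)} (hφ : Function.Injective φ) {σ : G} (hσ : σ ≠ 1) :
    ramificationOrder φ σ ≠ 0 := by
  rw [ramificationOrder, ne_eq, ENat.toNat_eq_zero, not_or, order_eq_top]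
  refine ⟨?_, map_X_sub_X_ne_zero hφ hσ⟩
  rw [← ne_eq, order_ne_zero_iff_constCoeff_eq_zero]
  refine (Ideal.mem_bot).1 (maximalIdeal_eq_bot (R := k) ▸ mem_maximalIdeal_powerSeries_iff.1 ?_)
  exact sub_mem (algEquiv_X_mem_maximalIdeal (φ σ)) X_mem_maximalIdeal

theorem exists_hurwitzTree_of_liftsToCharZero {G : Type uG} [Group G] [Fintype G] [Nontrivial G]
    {k : Type uk} [Field k] [IsAlgClosed k] (p : ℕ) [hp : Fact p.Prime] [CharP k p]
    {φ : G →* (k⟦X⟧ ≃ₐ[k] k⟦X⟧)} (hφ : Function.Injective φ)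
    (hlift : LiftsToCharZero.{uG, uk, uR} φ) :
    ∃ T : HurwitzTree G p, T.artinChar = artinCharacter φ ∧ T.depthChar = 0 := by
  obtain ⟨R, _, _, _, _, ι, Φ, hΦ⟩ := hlift
  set j : R →+* k := (ι : ResidueField R →+* k).comp (residue R) with hj
  have hj0 : ∀ a, j a = 0 ↔ residue R a = 0 := fun a => map_eq_zero_iff ι ι.injective
  have hred : ∀ σ, (Φ σ X - X).map j = φ σ X - X := fun σ => by
    rw [map_sub, hΦ, map_X]
  have hord : ∀ σ, ((Φ σ X - X).map (residue R)).order = (φ σ X - X).order := fun σ => by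
    rw [← hred]
    refine order_eq_order_of_forall_coeff fun n => ?_
    rw [coeff_map, coeff_map, hj0]
  have hne : ∀ σ : {σ : G // σ ≠ 1}, (Φ σ X - X).map (residue R) ≠ 0 := fun σ h => by
    refine map_X_sub_X_ne_zero hφ σ.2 ?_
    rw [← order_eq_top, ← hord, h, order_zero]
  obtain ⟨S, _, _, _, _, F, hF, _, hs⟩ :=
    exists_linear_factorization (fun σ : {σ : G // σ ≠ 1} => Φ σ X - X) hne
  choose s u hu hs hcard using hs
  obtain ⟨Ψ, hΨ⟩ := exists_extension_of_action F Φ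
  classical
  -- The value at 1 is a filler, as σ(X) - X = 0 there.
  let t : G → Multiset (maximalIdeal S) := fun σ => if h : σ ≠ 1 then s ⟨σ, h⟩ else 0
  have ht : ∀ σ, σ ≠ 1 → IsFactorization Ψ σ (t σ) := fun σ h => by
    refine ⟨u ⟨σ, h⟩, hu _, ?_⟩
    simp only [t, dif_pos h]
    rw [← hs ⟨σ, h⟩, map_sub, map_X, hΨ]
  have htcard : ∀ σ, σ ≠ 1 → (t σ).card = ramificationOrder φ σ := fun σ h => by
    simp only [t, dif_pos h]
    rw [hcard, hord, ramificationOrder]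
  have : CharZero S := charZero_of_injective_ringHom hF
  have hpS : (p : S) ∈ maximalIdeal S := by
    rw [← map_natCast F]
    refine map_nonunit F _ ?_
    rw [← residue_eq_zero_iff, ← hj0, map_natCast, CharP.cast_eq_zero]
  -- The field k is infinite and embeds into the residue field of S, which provides the generic
  -- points.
  have : Infinite k := IsAlgClosed.instInfinite
  have : Infinite (ResidueField R) := Infinite.of_injective ι.symm ι.symm.injective
  have : Infinite (ResidueField S) :=
    Infinite.of_injective (ResidueField.map F) (RingHom.injective _)
  obtain ⟨σ₀, hσ₀⟩ := exists_ne (1 : G)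
  obtain ⟨n, _, D, hD⟩ := exists_fixedPointData hp.out hpS ht ⟨σ₀, hσ₀, fun h =>
    ramificationOrder_ne_zero hφ hσ₀ (by rw [← htcard _ hσ₀, h, Multiset.card_zero])⟩
  refine ⟨D.hurwitzTree, ?_, D.hurwitzTree_depthChar⟩
  refine eq_of_sum_eq_of_forall_ne_one ?_ fun σ hσ => ?_
  · rw [D.sum_hurwitzTree_artinChar, sum_artinCharacter]
  · rw [D.hurwitzTree_artinChar hσ, artinCharacter, if_neg hσ, ← htcard σ hσ, ← hD σ hσ]

end Hurwitz

theorem theorem4p2 {G : Type uG} [Group G] [Fintype G] [Nontrivial G]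
    {k : Type uk} [Field k] [IsAlgClosed k] (p : ℕ) [Fact p.Prime] [CharP k p]
    (φ : G →* (PowerSeries k ≃ₐ[k] PowerSeries k)) (hφ : Function.Injective φ) :
    (Hurwitz.LiftsToCharZero.{uG, uk, uR} φ →
      ∃ T : Hurwitz.HurwitzTree G p,
        T.artinChar = Hurwitz.artinCharacter φ ∧ T.depthChar = 0) ∧
    (∀ T : Hurwitz.HurwitzTree G p,
      T.artinChar = Hurwitz.artinCharacter φ → Hurwitz.BertinObstructionVanishes φ) :=
  ⟨Hurwitz.exists_hurwitzTree_of_liftsToCharZero p hφ,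
    fun T hT => Hurwitz.bertinObstructionVanishes_of_hurwitzTree φ T hT⟩
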